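/- Let $b\in\mathbb R$ with $b\neq 1$, and consider the Cauchy problem for the $b$-equation on the line, $$u_t+uu_x=-\partial_x(1-\partial_{xx})^{-1}\Big(\tfrac b2u^2+\tfrac{3-b}2u_x^2\Big),\quad t>0,\ x\in\mathbb R,\qquad u(0,x)=u_0(x),\tag{1}$$ where $(1-\partial_{xx})^{-1}f=p*f$ with $p(x)=\frac12e^{-|x|}$. For $T>0$, a smooth solution of (1) on $[0,T)$ is a function $u\in C([0,T);C^\infty(\mathbb R))$ such that $u$ and $u_x$ are bounded on $[0,T']\times\mathbb R$ for every $T'<T$, $u(0,\cdot)=u_0$, and the equation holds pointwise on $(0,T)\times\mathbb R$. Fix a Littlewood–Paley pair: smooth even functions $\chi,\varphi:\mathbb R\to[0,1]$ with $\operatorname{supp}\chi\subset\{|\xi|\le\frac43\}$, $\operatorname{supp}\varphi\subset\{\frac34\le|\xi|\le\frac83\}$ and $\chi(\xi)+\sum_{j\ge0}\varphi(2^{-j}\xi)=1$ for all $\xi$. Put $\Delta_j=0$ for $j\le-2$, $\Delta_{-1}=\chi(D)$, $\Delta_j=\varphi(2^{-j}D)$ for $j\ge0$, and $\|f\|_{B^{s}_{2,q}}=\big\|(2^{js}\|\Delta_jf\|_{L^2})_{j}\big\|_{\ell^q(\mathbb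 Z)}$. Put $\|f\|_{H^s}^2=\int_{\mathbb R}(1+\xi^2)^s|\hat f(\xi)|^2\,d\xi$ with $\hat f(\xi)=\int_{\mathbb R} e^{-ix\xi}f(x)\,dx$, and $H^\infty=\bigcap_sH^s$. (A) Let $1<q\le\infty$. There is $N_0$ such that for every integer $N\ge N_0$ there are $u_0\in C^\infty(\mathbb R)$ and a time $T$ with $0<T\le\frac1{\ln N}$ such that 1. $\|u_0\|_{B^{3/2}_{2,q}}\le\frac1{\ln N}$; 2. there is a unique smooth solution $u$ of (1) on $[0,T)$ with initial value $u_0$, and $u\in C([0,T);H^\infty(\mathbb R))$; 3. $\|u\|_{L^\infty(0,T;B^{3/2}_{2,q})}\ge\ln N$. (B) Consequently (by the case $q=2$) (1) is ill-posed in $H^{3/2}(\mathbb R)$ in the sense of norm inflation: for every $\varepsilon>0$ there are $u_0\in C^\infty(\mathbb R)$ with $\|u_0\|_{H^{3/2}}\le\varepsilon$ and a time $0<T\le\varepsilon$ such that (1) has a unique smooth solution $u$ on $[0,T)$ with initial value $u_0$, $u\in C([0,T);H^\infty(\mathbb R))$, and $\|u\|_{L^\infty(0,T;H^{3/2})}\ge\frac1\varepsilon$.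 -/

import Mathlib

open MeasureTheory Set Filter Topology
open scoped ENNReal ContDiff FourierTransform

noncomputable section

/-! ### Littlewood–Paley decomposition and Besov norms on the line -/

/-- A dyadic partition of unity `(χ, φ)` on `ℝ`: both functions are smooth, even (that is, radial)
and valued in `[0, 1]`, `χ` is supported in `{|ξ| ≤ 4/3}`, `φ` in `{3/4 ≤ |ξ| ≤ 8/3}`, and
`χ(ξ) + ∑_{j ≥ 0} φ(2^{-j} ξ) = 1` for every `ξ`. -/
structure LittlewoodPaleyPair where
  chi : ℝ → ℝ
  phi : ℝ → ℝ
  chi_smooth : ContDiff ℝ ∞ chi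
  phi_smooth : ContDiff ℝ ∞ phi
  chi_even : ∀ ξ, chi (-ξ) = chi ξ
  phi_even : ∀ ξ, phi (-ξ) = phi ξ
  chi_mem : ∀ ξ, chi ξ ∈ Icc (0 : ℝ) 1
  phi_mem : ∀ ξ, phi ξ ∈ Icc (0 : ℝ) 1
  chi_supp : ∀ ξ, chi ξ ≠ 0 → |ξ| ≤ 4 / 3
  phi_supp : ∀ ξ, phi ξ ≠ 0 → 3 / 4 ≤ |ξ| ∧ |ξ| ≤ 8 / 3
  partition : ∀ ξ, HasSum (fun j : ℕ => phi (ξ / 2 ^ j)) (1 - chi ξ)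

/-- Littlewood–Paley pairs exist. -/
theorem LittlewoodPaleyPair.nonempty : Nonempty LittlewoodPaleyPair := by
  let c : ℝ → ℝ := fun ξ => Real.smoothTransition ((16 / 9 - ξ ^ 2) / (16 / 9 - 9 / 16))
  have hc : ContDiff ℝ ∞ c := Real.smoothTransition.contDiff.comp (by fun_prop)
  have hle : ∀ ξ, c ξ ≤ c (ξ / 2) := fun ξ => by
    apply Real.smoothTransition.monotone
    rw [div_le_div_iff_of_pos_right (by norm_num)]
    nlinarith [sq_nonneg ξ]
  have h0 : ∀ ξ, 0 ≤ c ξ := fun ξ => Real.smoothTransition.nonneg _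
  have h1 : ∀ ξ, c ξ ≤ 1 := fun ξ => Real.smoothTransition.le_one _
  have hs : ∀ ξ, c ξ ≠ 0 → |ξ| ≤ 4 / 3 := fun ξ h => by
    by_contra! h'
    apply h
    apply Real.smoothTransition.zero_of_nonpos
    have : ξ ^ 2 = |ξ| ^ 2 := (sq_abs ξ).symm
    apply div_nonpos_of_nonpos_of_nonneg <;> nlinarith
  have hone : ∀ ξ, |ξ| < 3 / 4 → c ξ = 1 := fun ξ h => by
    apply Real.smoothTransition.one_of_one_le
    have : ξ ^ 2 = |ξ| ^ 2 := (sq_abs ξ).symm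
    rw [le_div_iff₀ (by norm_num)]
    nlinarith [abs_nonneg ξ]
  have habs : ∀ ξ : ℝ, |ξ / 2| = |ξ| / 2 := fun ξ => by rw [abs_div]; norm_num
  refine ⟨⟨c, fun ξ => c (ξ / 2) - c ξ, hc, ?_, ?_, ?_, fun ξ => ⟨h0 ξ, h1 ξ⟩, ?_, hs, ?_, ?_⟩⟩
  · exact (hc.comp (by fun_prop)).sub hc
  · intro ξ; simp [c]
  · intro ξ; simp [c, neg_div]
  · intro ξ; constructor <;> linarith [hle ξ, h0 ξ, h1 (ξ / 2)]
  · intro ξ h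
    constructor
    · by_contra! h'
      apply h
      rw [hone ξ h', hone (ξ / 2) (by rw [habs]; linarith [abs_nonneg ξ]), sub_self]
    · by_contra! h'
      apply h
      have e1 : c ξ = 0 := by
        by_contra h2; linarith [hs ξ h2]
      have e2 : c (ξ / 2) = 0 := by
        by_contra h2
        have := hs _ h2
        rw [habs] at this; linarith
      simp [e1, e2]
  · intro ξ
    rw [hasSum_iff_tendsto_nat_of_nonneg (fun j => sub_nonneg.2 (hle _))]
    have e : ∀ n : ℕ, ∑ i ∈ Finset.range n, (c (ξ / 2 ^ i / 2) - c (ξ / 2 ^ i))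
        = c (ξ / 2 ^ n) - c ξ := fun n => by
      have := Finset.sum_range_sub (fun i : ℕ => c (ξ / 2 ^ i)) n
      simpa [pow_succ, div_div] using this
    simp only [e]
    have l : Tendsto (fun n : ℕ => ξ / 2 ^ n) atTop (𝓝 0) :=
      tendsto_const_nhds.div_atTop (tendsto_pow_atTop_atTop_of_one_lt (by norm_num))
    have := (hc.continuous.tendsto 0).comp l
    rw [hone 0 (by norm_num)] at this
    exact this.sub_const _

/-- The inverse Fourier transform `(2π)⁻¹ ∫ e^{ixξ} g(ξ) dξ`. -/
def invFourier (g : ℝ → ℝ) (x : ℝ) : ℂ :=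
  (1 / (2 * Real.pi) : ℝ) * ∫ ξ : ℝ, Complex.exp (Complex.I * x * ξ) * (g ξ : ℂ)

/-- The nonhomogeneous dyadic block `Δ_j f`: it is `0` for `j ≤ -2`, it is `χ(D) f` for `j = -1`
and `φ(2^{-j} D) f` for `j ≥ 0`, written as convolutions with the inverse Fourier transforms of
`χ` and `φ(2^{-j} ·)`. -/
def LittlewoodPaleyPair.block (P : LittlewoodPaleyPair) (j : ℤ) (f : ℝ → ℝ) (x : ℝ) : ℂ :=
  if j ≤ -2 then 0
  else if j = -1 then ∫ y, invFourier P.chi y * (f (x - y) : ℂ)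
  else ∫ y, ((2 : ℝ) ^ j : ℝ) * invFourier P.phi ((2 : ℝ) ^ j * y) * (f (x - y) : ℂ)

/-- The `ℓ^r(ℤ)` norm of a sequence of extended nonnegative numbers. -/
def ellNorm (r : ℝ≥0∞) (a : ℤ → ℝ≥0∞) : ℝ≥0∞ :=
  if r = ⊤ then ⨆ j, a j else (∑' j, a j ^ r.toReal) ^ (1 / r.toReal)

/-- The norm of the nonhomogeneous Besov space `B^s_{p,r}(ℝ)`, with values in `[0, ∞]`. -/
def besovNorm (P : LittlewoodPaleyPair) (s : ℝ) (p r : ℝ≥0∞) (f : ℝ → ℝ) : ℝ≥0∞ :=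
  ellNorm r fun j => (2 : ℝ≥0∞) ^ ((j : ℝ) * s) * eLpNorm (P.block j f) p volume

/-! ### Sobolev norms on the line -/

open Classical in
/-- The norm of `H^s(ℝ)` of an `L²` function, `(∫ (1 + ξ²)^s |f̂(ξ)|² dξ)^{1/2}` with
`f̂(ξ) = ∫ e^{-ixξ} f(x) dx`; it is `∞` for functions outside `L²`. The Fourier transform `𝓕` of
Mathlib on `L²` has the kernel `e^{-2πixη}`, so that `f̂(ξ) = 𝓕 f (ξ / 2π)`; the integral below
is the one above after the substitution `ξ = 2πη`. -/
def sobolevNorm (s : ℝ) (f : ℝ → ℝ) : ℝ≥0∞ :=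
  if h : MemLp (fun x => (f x : ℂ)) 2 (volume : Measure ℝ) then
    (ENNReal.ofReal (2 * Real.pi) *
      ∫⁻ η : ℝ, ENNReal.ofReal ((1 + (2 * Real.pi * η) ^ 2) ^ s) *
        ‖(𝓕 (h.toLp (fun x => (f x : ℂ))) : Lp (α := ℝ) ℂ 2 volume) η‖ₑ ^ 2) ^ (1 / 2 : ℝ)
  else ⊤

/-- `u ∈ C([0, T); H^∞(ℝ))`, where `H^∞ = ⋂_s H^s`. -/
def ContinuousInHInfty (T : ℝ) (u : ℝ → ℝ → ℝ) : Prop :=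
  ∀ s : ℝ, ∀ t ∈ Ico 0 T, sobolevNorm s (u t) < ⊤ ∧
    Tendsto (fun τ => sobolevNorm s (fun x => u τ x - u t x)) (𝓝[Ico 0 T] t) (𝓝 0)

/-! ### The `b`-equation -/

/-- `(1 - ∂_{xx})⁻¹ f = p * f` with `p(x) = e^{-|x|} / 2`. -/
def helmholtzInv (f : ℝ → ℝ) (x : ℝ) : ℝ :=
  ∫ y, 1 / 2 * Real.exp (-|x - y|) * f y

/-- `u ∈ C([0, T); C^∞(ℝ))`, for the topology of locally uniform convergence of all derivatives:
every `u(t)` is smooth and all the derivatives `∂_x^k u` are continuous on `[0, T) × ℝ`. -/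
def ContinuousInSmooth (T : ℝ) (u : ℝ → ℝ → ℝ) : Prop :=
  (∀ t ∈ Ico 0 T, ContDiff ℝ ∞ (u t)) ∧
    ∀ k : ℕ, ContinuousOn (fun z : ℝ × ℝ => iteratedDeriv k (u z.1) z.2) (Ico 0 T ×ˢ univ)

/-- `u` is a smooth solution on `[0, T)` of the Cauchy problem
`u_t + u u_x = -∂_x (1 - ∂_{xx})⁻¹ (b/2 u² + (3-b)/2 u_x²)`, `u(0) = u₀`:
it lies in `C([0, T); C^∞(ℝ))`, `u` and `u_x` are bounded on `[0, T'] × ℝ` for every `T' < T`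
(so that the nonlocal term makes sense), and the equation holds at every point of
`(0, T) × ℝ`. -/
structure IsSmoothSolution (b T : ℝ) (u₀ : ℝ → ℝ) (u : ℝ → ℝ → ℝ) : Prop where
  smooth : ContinuousInSmooth T u
  bounded : ∀ T' < T, ∃ M : ℝ, ∀ t ∈ Icc 0 T', ∀ x, |u t x| ≤ M ∧ |deriv (u t) x| ≤ M
  initial : u 0 = u₀
  equation : ∀ t ∈ Ioo 0 T, ∀ x, HasDerivAt (fun τ => u τ x)
    (-(u t x * deriv (u t) x) -
      deriv (helmholtzInv fun y => b / 2 * u t y ^ 2 + (3 - b) / 2 * deriv (u t) y ^ 2) x) t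

/-- `u` is the unique smooth solution on `[0, T)` with data `u₀`, and it lies in
`C([0, T); H^∞(ℝ))`. Uniqueness holds among all smooth solutions. -/
structure IsUniqueSmoothSolution (b T : ℝ) (u₀ : ℝ → ℝ) (u : ℝ → ℝ → ℝ) : Prop where
  isSolution : IsSmoothSolution b T u₀ u
  hInfty : ContinuousInHInfty T u
  unique : ∀ v, IsSmoothSolution b T u₀ v → ∀ t ∈ Ico 0 T, v t = u t

end

namespace BEquation

/-! ### Calculus with parameters -/

/-! For `q > 1` the space `B^{3/2}_{2,q}` just fails to control `u_x` uniformly. The rescalings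
`2^{-k} f(2^k x)`, `k < n`, of one profile live essentially on different frequency shells, while
their slopes at the origin add up. With weight `h / n` they sum to a function of slope `h` at `0`
and of norm `O(|h| n^{1/q - 1})`. Data of norm at most `1/ρ` may thus have a slope of any size `H`
at `0`, with the sign of `1 - b` (`exists_small_besovNorm_deriv_eq`).

Suppose that the norm of the solution stays below `ρ`. Two consequences contradict each other.

Blow-up. Along a trajectory the slope `V` satisfies the Riccati equation `V' = (1-b)/2 V² + b/2 U² -
p * (b/2 u² + (3-b)/2 u_x²)` (`hasDerivAt_slope`). The norm controls `u` in `L^∞` and `u_x` in `L²`,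
so everything except the first term is `O(ρ²)`, however large `u_x` is. For `H` large the slope
becomes infinite before time `4 / (|1-b| H) < 1/ρ` (`false_of_slope`).

No blow-up. Let `g` be the logarithm of the stretching of the flow, so that `g_t` is `u_x` along
trajectories. The momentum `u - u_xx` equals `m e^{-bg}` in Lagrangian coordinates, so its `L²` norm
is at most a constant times `e^{(|b|+1) ‖g‖}`. Each of the shells below `J` contributes `O(ρ)` to
`u_x`, and those above contribute `O(2^{-J/2})` times the norm of the momentum. Taking `J`
proportional to `‖g‖` gives `|u_x| ≤ C₁ + C₂ ‖g‖` (`bounds_of_besovNorm_le`), and Gronwall's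
inequality keeps `g` bounded up to time `1/ρ`.

The solution itself comes from the closed equation `g_t = lagV(g)`, an ordinary differential
equation in the bounded continuous functions. With `g` truncated at a level `R` the field is bounded
and globally Lipschitz, so Picard–Lindelöf gives a solution on any time interval; it solves the
original equation until `‖g‖` reaches `R` (`exists_truncated_solution`,
`isLagrangianSolution_of_truncated`). The Eulerian fields are recovered by inverting the flow, and
the nonlocal term is identified by uniqueness of bounded solutions of `α - α'' = f`
(`helmholtz_source`). Uniqueness among all smooth solutions follows by integration along
characteristics (`eq_of_bounded_deriv2`).

Part (A) is the case `ρ = log N` of `exists_norm_inflation`. Part (B) is `q = 2`, `ρ = 100/ε`, with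
the equivalence of the norms of `B^{3/2}_{2,2}` and `H^{3/2}`. -/

theorem hasDerivAt_along_curve {f f' : ℝ → ℝ → ℝ} {Y : ℝ → ℝ} {s y' : ℝ}
    (hx : ∀ᶠ t in 𝓝 s, ∀ x, HasDerivAt (f t) (f' t x) x)
    (hc : ContinuousAt (Function.uncurry f') (s, Y s)) (hY : HasDerivAt Y y' s) :
    HasDerivAt (fun t => f t (Y t) - f t (Y s)) (f' s (Y s) * y') s := by
  set c := f' s (Y s) with hcdef
  -- The mean value inequality is applied to `x ↦ f t x - c x` on a ball where `f'` differs from `c`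
  -- by less than `ε`. Only the space derivative enters, so nothing is assumed about the dependence
  -- of `f` on time.
  have h1 : (fun t => f t (Y t) - f t (Y s) - c * (Y t - Y s)) =o[𝓝 s] fun t => Y t - Y s := by
    rw [Asymptotics.isLittleO_iff]
    intro ε hε
    obtain ⟨δ, hδ, hball⟩ := Metric.continuousAt_iff.1 hc ε hε
    have hYc : ∀ᶠ t in 𝓝 s, dist (Y t) (Y s) < δ := Metric.tendsto_nhds.1 hY.continuousAt δ hδ
    have ht : ∀ᶠ t in 𝓝 s, dist t s < δ := Metric.ball_mem_nhds s hδ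
    filter_upwards [hx, hYc, ht] with t hxt hYt htt
    have key := (convex_ball (Y s) δ).norm_image_sub_le_of_norm_hasDerivWithin_le
      (f := fun x => f t x - c * x) (f' := fun x => f' t x - c * 1) (C := ε)
      (x := Y s) (y := Y t)
      (fun x _ => ((hxt x).sub ((hasDerivAt_id x).const_mul c)).hasDerivWithinAt)
      (fun x hx => by
        have hd : dist (t, x) (s, Y s) < δ := by
          rw [Prod.dist_eq]; exact max_lt htt hx
        have := (hball hd).le
        rw [Real.dist_eq] at this
        simpa [Function.uncurry, hcdef] using this)
      (Metric.mem_ball_self hδ) hYt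
    refine le_trans (le_of_eq ?_) key
    congr 1; ring
  have h2 : HasDerivAt (fun t => f t (Y t) - f t (Y s) - c * (Y t - Y s)) 0 s := by
    rw [hasDerivAt_iff_isLittleO]
    have := h1.trans_isBigO hY.isBigO_sub
    simpa using this
  have h3 : HasDerivAt (fun t => c * (Y t - Y s)) (c * y') s := (hY.sub_const _).const_mul c
  have := h2.fun_add h3
  simpa using this

theorem continuousOn_intervalIntegral_param {X : Type*} [TopologicalSpace X] {S : Set X}
    {F : X → ℝ → ℝ} {a b : ℝ} (hab : a ≤ b)
    (hF : ContinuousOn (Function.uncurry F) (S ×ˢ Icc a b)) :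
    ContinuousOn (fun x => ∫ s in a..b, F x s) S := by
  rw [continuousOn_iff_continuous_domRestrict]
  -- Projecting `s` to `[a, b]` makes the integrand globally continuous without changing the
  -- integral.
  have h1 : Continuous (Function.uncurry fun (x : S) (s : ℝ) => F x (projIcc a b hab s)) := by
    have : Continuous fun z : S × ℝ => ((z.1 : X), ((projIcc a b hab z.2 : Icc a b) : ℝ)) := by
      fun_prop
    exact hF.comp_continuous this fun z => ⟨z.1.2, (projIcc a b hab z.2).2⟩
  have h2 := intervalIntegral.continuous_parametric_intervalIntegral_of_continuous'
    (μ := volume) h1 a b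
  refine h2.congr fun x => ?_
  apply intervalIntegral.integral_congr
  intro s hs
  rw [uIcc_of_le hab] at hs
  simp [projIcc_of_mem hab hs]

theorem hasDerivAt_intervalIntegral_param {I : Set ℝ} (hI : IsOpen I) {F F' : ℝ → ℝ → ℝ}
    {a b : ℝ} (hF : ∀ t ∈ I, ContinuousOn (F t) (uIcc a b))
    (hd : ∀ t ∈ I, ∀ η ∈ uIcc a b, HasDerivAt (fun τ => F τ η) (F' t η) t)
    (hc : ContinuousOn (Function.uncurry F') (I ×ˢ uIcc a b)) {t : ℝ} (ht : t ∈ I) :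
    HasDerivAt (fun τ => ∫ η in a..b, F τ η) (∫ η in a..b, F' t η) t := by
  obtain ⟨ε, hε, hball⟩ := Metric.isOpen_iff.1 hI t ht
  have hsub : Metric.closedBall t (ε / 2) ⊆ I :=
    (Metric.closedBall_subset_ball (by linarith)).trans hball
  have hcomp : IsCompact (Metric.closedBall t (ε / 2) ×ˢ uIcc a b) :=
    (isCompact_closedBall _ _).prod isCompact_uIcc
  obtain ⟨M, hM⟩ := hcomp.exists_bound_of_continuousOn (hc.mono (prod_mono hsub subset_rfl))
  have hF' : ∀ t ∈ I, ContinuousOn (F' t) (uIcc a b) := fun t ht =>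
    hc.comp (f := fun η => (t, η)) (by fun_prop) fun η hη => ⟨ht, hη⟩
  refine (intervalIntegral.hasDerivAt_integral_of_dominated_loc_of_deriv_le
    (F := F) (F' := F') (bound := fun _ => M) (Metric.closedBall_mem_nhds t (half_pos hε)) ?_
    (hF t ht).intervalIntegrable ?_ ?_ intervalIntegrable_const ?_).2
  · filter_upwards [hI.mem_nhds ht] with τ hτ
    exact ((hF τ hτ).mono uIoc_subset_uIcc).aestronglyMeasurable measurableSet_uIoc
  · exact ((hF' t ht).mono uIoc_subset_uIcc).aestronglyMeasurable measurableSet_uIoc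
  · exact ae_of_all _ fun η hη τ hτ => hM (τ, η) ⟨hτ, uIoc_subset_uIcc hη⟩
  · exact ae_of_all _ fun η hη τ hτ => hd τ (hsub hτ) η (uIoc_subset_uIcc hη)

theorem continuousOn_section_left {f : ℝ → ℝ → ℝ} {S U : Set ℝ}
    (hf : ContinuousOn (Function.uncurry f) (S ×ˢ U)) {x : ℝ} (hx : x ∈ U) :
    ContinuousOn (fun t => f t x) S :=
  hf.comp (f := fun t => (t, x)) (by fun_prop) fun _ ht => ⟨ht, hx⟩

theorem continuousOn_section_right {f : ℝ → ℝ → ℝ} {S U : Set ℝ}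
    (hf : ContinuousOn (Function.uncurry f) (S ×ˢ U)) {t : ℝ} (ht : t ∈ S) :
    ContinuousOn (f t) U :=
  hf.comp (f := fun x => (t, x)) (by fun_prop) fun _ hx => ⟨ht, hx⟩

theorem continuous_section_right {f : ℝ → ℝ → ℝ} {S : Set ℝ}
    (hf : ContinuousOn (Function.uncurry f) (S ×ˢ univ)) {t : ℝ} (ht : t ∈ S) :
    Continuous (f t) :=
  continuousOn_univ.1 (continuousOn_section_right hf ht)

/-- The time derivative of `∂ₓ f` is `∂ₓ ∂ₜ f`. -/
theorem hasDerivAt_deriv_swap {a c : ℝ} {f ft fx ftx : ℝ → ℝ → ℝ}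
    (h1 : ∀ t ∈ Ioo a c, ∀ x, HasDerivAt (fun τ => f τ x) (ft t x) t)
    (h2 : ∀ t ∈ Ioo a c, ∀ x, HasDerivAt (f t) (fx t x) x)
    (h3 : ∀ t ∈ Ioo a c, ∀ x, HasDerivAt (ft t) (ftx t x) x)
    (hft : ContinuousOn (Function.uncurry ft) (Ioo a c ×ˢ univ))
    (hftx : ContinuousOn (Function.uncurry ftx) (Ioo a c ×ˢ univ))
    {t : ℝ} (ht : t ∈ Ioo a c) (x : ℝ) :
    HasDerivAt (fun τ => fx τ x) (ftx t x) t := by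
  have hsub : ∀ τ ∈ Ioo a c, uIcc t τ ⊆ Ioo a c := fun τ hτ =>
    ordConnected_Ioo.uIcc_subset ht hτ
  -- Integrate in time, differentiate in space under the integral, and compare with `fx` by
  -- uniqueness of derivatives: `fx` becomes a time primitive of `ftx`.
  have e1 : ∀ τ ∈ Ioo a c, ∀ z, f τ z = f t z + ∫ s in t..τ, ft s z := by
    intro τ hτ z
    rw [intervalIntegral.integral_eq_sub_of_hasDerivAt (fun s hs => h1 s (hsub τ hτ hs) z)]
    · ring
    · exact ((continuousOn_section_left hft (mem_univ z)).mono (hsub τ hτ)).intervalIntegrable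
  have e2 : ∀ τ ∈ Ioo a c, fx τ x = fx t x + ∫ s in t..τ, ftx s x := by
    intro τ hτ
    have d1 : HasDerivAt (fun z => ∫ s in t..τ, ft s z) (∫ s in t..τ, ftx s x) x := by
      refine hasDerivAt_intervalIntegral_param (I := univ) isOpen_univ
        (F := fun z s => ft s z) (F' := fun z s => ftx s z) (fun z _ => ?_) (fun z _ s hs => ?_)
        ?_ (mem_univ x)
      · exact (continuousOn_section_left hft (mem_univ z)).mono (hsub τ hτ)
      · exact h3 s (hsub τ hτ hs) z
      · exact hftx.comp (f := fun z : ℝ × ℝ => (z.2, z.1)) (by fun_prop)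
          fun z hz => ⟨hsub τ hτ hz.2, mem_univ _⟩
    have d2 := (h2 t ht x).add d1
    have d3 : HasDerivAt (f τ) (fx t x + ∫ s in t..τ, ftx s x) x := by
      refine d2.congr_of_eventuallyEq (Eventually.of_forall fun z => ?_)
      exact e1 τ hτ z
    exact (h2 τ hτ x).unique d3
  have hcs := continuousOn_section_left hftx (mem_univ x)
  have d : HasDerivAt (fun τ => fx t x + ∫ s in t..τ, ftx s x) (ftx t x) t := by
    refine HasDerivAt.const_add _ ?_
    refine intervalIntegral.integral_hasDerivAt_right (by simp) ?_
      (hcs.continuousAt (isOpen_Ioo.mem_nhds ht))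
    exact hcs.stronglyMeasurableAtFilter isOpen_Ioo t ht
  refine d.congr_of_eventuallyEq ?_
  filter_upwards [isOpen_Ioo.mem_nhds ht] with τ hτ using e2 τ hτ

/-! ### Functions of time and space that are smooth in space, uniformly in time -/

/-- `f` has space derivatives up to order `n`, which are continuous on `I × ℝ`. -/
def JointSmooth (I : Set ℝ) : ℕ → (ℝ → ℝ → ℝ) → Prop
  | 0, f => ContinuousOn (Function.uncurry f) (I ×ˢ univ)
  | n + 1, f => ContinuousOn (Function.uncurry f) (I ×ˢ univ) ∧
      ∃ f' : ℝ → ℝ → ℝ, (∀ t ∈ I, ∀ x, HasDerivAt (f t) (f' t x) x) ∧ JointSmooth I n f'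

namespace JointSmooth

variable {I : Set ℝ} {n : ℕ} {f g : ℝ → ℝ → ℝ}

theorem continuousOn (h : JointSmooth I n f) : ContinuousOn (Function.uncurry f) (I ×ˢ univ) := by
  cases n with
  | zero => exact h
  | succ n => exact h.1

theorem of_hasDerivAt {f' : ℝ → ℝ → ℝ} (hc : ContinuousOn (Function.uncurry f) (I ×ˢ univ))
    (hd : ∀ t ∈ I, ∀ x, HasDerivAt (f t) (f' t x) x) (h : JointSmooth I n f') :
    JointSmooth I (n + 1) f := ⟨hc, f', hd, h⟩

theorem of_succ (h : JointSmooth I (n + 1) f) : JointSmooth I n f := by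
  induction n generalizing f with
  | zero => exact h.1
  | succ n ih =>
    obtain ⟨hc, f', hd, h'⟩ := h
    exact ⟨hc, f', hd, ih h'⟩

theorem add (hf : JointSmooth I n f) (hg : JointSmooth I n g) :
    JointSmooth I n (fun t x => f t x + g t x) := by
  induction n generalizing f g with
  | zero => exact ContinuousOn.add hf hg
  | succ n ih =>
    obtain ⟨hc, f', hd, h'⟩ := hf
    obtain ⟨gc, g', gd, g''⟩ := hg
    exact ⟨hc.add gc, _, fun t ht x => (hd t ht x).add (gd t ht x), ih h' g''⟩

theorem mul (hf : JointSmooth I n f) (hg : JointSmooth I n g) :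
    JointSmooth I n (fun t x => f t x * g t x) := by
  induction n generalizing f g with
  | zero => exact ContinuousOn.mul hf hg
  | succ n ih =>
    have hf0 := hf.of_succ
    have hg0 := hg.of_succ
    obtain ⟨hc, f', hd, h'⟩ := hf
    obtain ⟨gc, g', gd, g''⟩ := hg
    exact ⟨hc.mul gc, _, fun t ht x => (hd t ht x).mul (gd t ht x),
      (ih h' hg0).add (ih hf0 g'')⟩

theorem of_contDiff {φ : ℝ → ℝ} (hφ : ContDiff ℝ ∞ φ) : JointSmooth I n (fun _ x => φ x) := by
  induction n generalizing φ with
  | zero => exact (hφ.continuous.comp continuous_snd).continuousOn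
  | succ n ih =>
    refine ⟨(hφ.continuous.comp continuous_snd).continuousOn, fun _ x => deriv φ x,
      fun t _ x => (hφ.differentiable (by simp) x).hasDerivAt, ih ?_⟩
    exact (contDiff_infty_iff_deriv.1 hφ).2

theorem const_mul (c : ℝ) (hf : JointSmooth I n f) : JointSmooth I n (fun t x => c * f t x) :=
  (of_contDiff contDiff_const).mul hf

theorem sub (hf : JointSmooth I n f) (hg : JointSmooth I n g) :
    JointSmooth I n (fun t x => f t x - g t x) := by
  have := hf.add (hg.const_mul (-1))
  simpa [sub_eq_add_neg] using this

theorem exp (hf : JointSmooth I n f) : JointSmooth I n (fun t x => Real.exp (f t x)) := by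
  induction n generalizing f with
  | zero => exact ContinuousOn.rexp hf
  | succ n ih =>
    have hf0 := hf.of_succ
    obtain ⟨hc, f', hd, h'⟩ := hf
    exact ⟨hc.rexp, _, fun t ht x => (hd t ht x).exp, (ih hf0).mul h'⟩

/-- The slope of `Y` is taken in the form `G t (Y t x)`, as for the inverse of a flow. The
derivative of `f ∘ Y` is then `(f' G) ∘ Y`, again a composite with `Y`, and the induction closes. -/
theorem comp_curve {Y G : ℝ → ℝ → ℝ} (hY : ContinuousOn (Function.uncurry Y) (I ×ˢ univ))
    (hYd : ∀ t ∈ I, ∀ x, HasDerivAt (Y t) (G t (Y t x)) x) (hG : JointSmooth I n G)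
    (hf : JointSmooth I n f) : JointSmooth I n (fun t x => f t (Y t x)) := by
  have hcomp : ∀ f : ℝ → ℝ → ℝ, ContinuousOn (Function.uncurry f) (I ×ˢ univ) →
      ContinuousOn (Function.uncurry fun t x => f t (Y t x)) (I ×ˢ univ) := fun f hf =>
    hf.comp (f := fun z : ℝ × ℝ => (z.1, Y z.1 z.2)) (continuousOn_fst.prodMk hY)
      fun z hz => ⟨hz.1, mem_univ _⟩
  induction n generalizing f with
  | zero => exact hcomp f hf
  | succ n ih =>
    obtain ⟨hc, f', hd, h'⟩ := hf
    exact ⟨hcomp f hc, _, fun t ht x => (hd t ht _).comp x (hYd t ht x),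
      ih hG.of_succ (h'.mul hG.of_succ)⟩

theorem congr (hf : JointSmooth I n f) (h : ∀ t ∈ I, ∀ x, g t x = f t x) : JointSmooth I n g := by
  have hc : ContinuousOn (Function.uncurry f) (I ×ˢ univ) →
      ContinuousOn (Function.uncurry g) (I ×ˢ univ) := fun hf =>
    hf.congr fun z hz => h z.1 hz.1 z.2
  cases n with
  | zero => exact hc hf
  | succ n =>
    obtain ⟨hc', f', hd, h'⟩ := hf
    exact ⟨hc hc', f', fun t ht x => by rw [funext (h t ht)]; exact hd t ht x, h'⟩

theorem continuousOn_primitive {a c : ℝ} (h0 : (0 : ℝ) ∈ Ioo a c)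
    (hf : ContinuousOn (Function.uncurry f) (Ioo a c ×ˢ univ)) :
    ContinuousOn (Function.uncurry fun t x => ∫ s in (0 : ℝ)..t, f s x) (Ioo a c ×ˢ univ) := by
  -- Rescaling to a fixed interval of integration moves all the dependence on `t` into the
  -- integrand.
  have e : ∀ t x, ∫ s in (0 : ℝ)..t, f s x = t * ∫ σ in (0 : ℝ)..1, f (t * σ) x := by
    intro t x
    have := intervalIntegral.smul_integral_comp_mul_left (a := 0) (b := 1) (fun s => f s x) t
    simp only [mul_zero, mul_one, smul_eq_mul] at this
    exact this.symm
  have h1 : ContinuousOn (fun z : ℝ × ℝ => ∫ σ in (0 : ℝ)..1, f (z.1 * σ) z.2)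
      (Ioo a c ×ˢ univ) := by
    refine continuousOn_intervalIntegral_param (F := fun (z : ℝ × ℝ) σ => f (z.1 * σ) z.2)
      zero_le_one ?_
    refine hf.comp (f := fun w : (ℝ × ℝ) × ℝ => (w.1.1 * w.2, w.1.2)) (by fun_prop) ?_
    rintro ⟨⟨t, x⟩, σ⟩ ⟨⟨ht, -⟩, hσ⟩
    refine ⟨?_, mem_univ _⟩
    have hseg : uIcc 0 t ⊆ Ioo a c := ordConnected_Ioo.uIcc_subset h0 ht
    apply hseg
    simp only [mem_Icc] at hσ
    rcases le_total 0 t with h | h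
    · rw [uIcc_of_le h]; constructor <;> dsimp only <;> nlinarith
    · rw [uIcc_of_ge h]; constructor <;> dsimp only <;> nlinarith
  refine (continuousOn_fst.mul h1).congr fun z _ => ?_
  exact e z.1 z.2

theorem primitive {a c : ℝ} (h0 : (0 : ℝ) ∈ Ioo a c) (hf : JointSmooth (Ioo a c) n f) :
    JointSmooth (Ioo a c) n (fun t x => ∫ s in (0 : ℝ)..t, f s x) := by
  induction n generalizing f with
  | zero => exact continuousOn_primitive h0 hf
  | succ n ih =>
    obtain ⟨hc, f', hd, h'⟩ := hf
    refine ⟨continuousOn_primitive h0 hc, _, fun t ht x => ?_, ih h'⟩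
    have hseg : uIcc 0 t ⊆ Ioo a c := ordConnected_Ioo.uIcc_subset h0 ht
    refine hasDerivAt_intervalIntegral_param (I := univ) isOpen_univ
      (F := fun z s => f s z) (F' := fun z s => f' s z) (fun z _ => ?_) (fun z _ s hs => ?_)
      ?_ (mem_univ x)
    · exact (continuousOn_section_left hc (mem_univ z)).mono hseg
    · exact hd s (hseg hs) z
    · exact h'.continuousOn.comp (f := fun z : ℝ × ℝ => (z.2, z.1)) (by fun_prop)
        fun z hz => ⟨hseg hz.2, mem_univ _⟩

theorem contDiff (hf : JointSmooth I n f) {t : ℝ} (ht : t ∈ I) : ContDiff ℝ n (f t) := by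
  induction n generalizing f with
  | zero => exact contDiff_zero.2 (continuous_section_right hf ht)
  | succ n ih =>
    obtain ⟨hc, f', hd, h'⟩ := hf
    rw [Nat.cast_add, Nat.cast_one, contDiff_succ_iff_deriv]
    refine ⟨fun x => (hd t ht x).differentiableAt, by simp, ?_⟩
    rw [show deriv (f t) = f' t from funext fun x => (hd t ht x).deriv]
    exact ih h'

theorem continuousOn_iteratedDeriv (hf : JointSmooth I n f) :
    ContinuousOn (fun z : ℝ × ℝ => iteratedDeriv n (f z.1) z.2) (I ×ˢ univ) := by
  induction n generalizing f with
  | zero => exact ContinuousOn.congr hf fun z _ => by simp [Function.uncurry]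
  | succ n ih =>
    obtain ⟨hc, f', hd, h'⟩ := hf
    refine (ih h').congr fun z hz => ?_
    simp only
    rw [iteratedDeriv_succ', show deriv (f z.1) = f' z.1 from
      funext fun x => (hd z.1 hz.1 x).deriv]

theorem contDiff_infty (hf : ∀ n, JointSmooth I n f) {t : ℝ} (ht : t ∈ I) :
    ContDiff ℝ ∞ (f t) :=
  _root_.contDiff_infty.2 fun n => (hf n).contDiff ht

end JointSmooth

end BEquation

namespace BEquation

/-! ### The operator `(1 - ∂ₓₓ)⁻¹` on bounded continuous functions -/

/-- `∫₀^∞ e^{-z} f(x + z) dz`. -/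
noncomputable def laplaceRight (f : ℝ → ℝ) (x : ℝ) : ℝ := ∫ z in Ioi (0 : ℝ), Real.exp (-z) * f (x + z)

/-- `∫₀^∞ e^{-z} f(x - z) dz`. -/
noncomputable def laplaceLeft (f : ℝ → ℝ) (x : ℝ) : ℝ := ∫ z in Ioi (0 : ℝ), Real.exp (-z) * f (x - z)

/-- The derivative of `(1 - ∂ₓₓ)⁻¹ f`. -/
noncomputable def helmholtzDeriv (f : ℝ → ℝ) (x : ℝ) : ℝ := 1 / 2 * (laplaceRight f x - laplaceLeft f x)

theorem laplaceLeft_eq (f : ℝ → ℝ) (x : ℝ) :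
    laplaceLeft f x = laplaceRight (fun y => f (-y)) (-x) := by
  simp only [laplaceLeft, laplaceRight]
  congr 1; ext z; congr 2; ring

theorem integrableOn_exp_neg_mul {f : ℝ → ℝ} (hf : Continuous f) {M : ℝ} (hM : ∀ x, |f x| ≤ M)
    (c : ℝ) : IntegrableOn (fun z => Real.exp (-z) * f z) (Ioi c) := by
  refine Integrable.mono' ((integrableOn_exp_neg_Ioi c).mul_const M) ?_ ?_
  · exact (by fun_prop : Continuous fun z => Real.exp (-z) * f z).aestronglyMeasurable
  · refine ae_of_all _ fun z => ?_
    rw [norm_mul, Real.norm_eq_abs, Real.abs_exp, Real.norm_eq_abs]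
    gcongr
    exact hM z

theorem abs_laplaceRight_le {f : ℝ → ℝ} {M : ℝ} (hM : ∀ x, |f x| ≤ M)
    (x : ℝ) : |laplaceRight f x| ≤ M := by
  have h1 : ‖laplaceRight f x‖ ≤ ∫ z in Ioi (0 : ℝ), Real.exp (-z) * M := by
    refine norm_integral_le_of_norm_le ((integrableOn_exp_neg_Ioi 0).mul_const M) ?_
    refine ae_of_all _ fun z => ?_
    rw [norm_mul, Real.norm_eq_abs, Real.abs_exp, Real.norm_eq_abs]
    gcongr
    exact hM _
  rw [integral_mul_const, integral_exp_neg_Ioi_zero, one_mul] at h1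
  exact h1

theorem abs_laplaceLeft_le {f : ℝ → ℝ} {M : ℝ} (hM : ∀ x, |f x| ≤ M)
    (x : ℝ) : |laplaceLeft f x| ≤ M := by
  rw [laplaceLeft_eq]
  exact abs_laplaceRight_le (fun x => hM _) _

/-- After the substitution `y = x + z` the point `x` appears only in the factor `e^x` and in a limit
of integration, so the transform is differentiable although `f` is merely continuous. -/
theorem laplaceRight_eq {f : ℝ → ℝ} (hf : Continuous f) {M : ℝ} (hM : ∀ x, |f x| ≤ M)
    (x : ℝ) : laplaceRight f x =
    Real.exp x * ((∫ y in Ioi (0 : ℝ), Real.exp (-y) * f y) - ∫ y in (0 : ℝ)..x, Real.exp (-y) * f y) := by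
  have hint := fun c => integrableOn_exp_neg_mul hf hM c
  have e1 : laplaceRight f x = Real.exp x * ∫ y in Ioi x, Real.exp (-y) * f y := by
    have := (measurePreserving_add_left volume x).setIntegral_preimage_emb
      (measurableEmbedding_addLeft x) (fun y => Real.exp (-y) * f y) (Ioi x)
    rw [preimage_const_add_Ioi, sub_self] at this
    rw [← this, ← integral_const_mul, laplaceRight]
    congr 1; ext z
    rw [← mul_assoc, ← Real.exp_add]
    congr 2; ring
  rw [e1, ← intervalIntegral.integral_Ioi_sub_Ioi' (hint 0) (hint x)]
  ring

theorem hasDerivAt_laplaceRight {f : ℝ → ℝ} (hf : Continuous f) {M : ℝ} (hM : ∀ x, |f x| ≤ M)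
    (x : ℝ) :
    HasDerivAt (laplaceRight f) (laplaceRight f x - f x) x := by
  rw [funext (laplaceRight_eq hf hM)]
  have hc : Continuous fun y => Real.exp (-y) * f y := by fun_prop
  have h1 : HasDerivAt (fun x => ∫ y in (0 : ℝ)..x, Real.exp (-y) * f y) (Real.exp (-x) * f x) x :=
    hc.integral_hasStrictDerivAt 0 x |>.hasDerivAt
  have h2 := (Real.hasDerivAt_exp x).fun_mul (h1.const_sub (∫ y in Ioi (0 : ℝ), Real.exp (-y) * f y))
  refine HasDerivAt.congr_deriv (h2) ?_
  have : Real.exp x * Real.exp (-x) = 1 := by rw [← Real.exp_add]; simp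
  linear_combination (-f x) * this

theorem hasDerivAt_laplaceLeft {f : ℝ → ℝ} (hf : Continuous f) {M : ℝ} (hM : ∀ x, |f x| ≤ M)
    (x : ℝ) :
    HasDerivAt (laplaceLeft f) (f x - laplaceLeft f x) x := by
  rw [funext (laplaceLeft_eq f)]
  have h := hasDerivAt_laplaceRight (f := fun y => f (-y)) (by fun_prop) (fun x => hM _) (-x)
  have h2 := h.scomp x (hasDerivAt_neg x)
  refine HasDerivAt.congr_deriv (h2) ?_
  simp

theorem helmholtzInv_eq {f : ℝ → ℝ} (hf : Continuous f) {M : ℝ} (hM : ∀ x, |f x| ≤ M)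
    (x : ℝ) :
    helmholtzInv f x = 1 / 2 * (laplaceRight f x + laplaceLeft f x) := by
  have hR : IntegrableOn (fun z => Real.exp (-z) * f (x + z)) (Ioi 0) :=
    integrableOn_exp_neg_mul (f := fun z => f (x + z)) (by fun_prop) (fun _ => hM _) 0
  have hL : IntegrableOn (fun z => Real.exp (-z) * f (x - z)) (Ioi 0) :=
    integrableOn_exp_neg_mul (f := fun z => f (x - z)) (by fun_prop) (fun _ => hM _) 0
  have e1 : helmholtzInv f x = ∫ z, 1 / 2 * (Real.exp (-|z|) * f (x + z)) := by
    rw [helmholtzInv, ← integral_add_left_eq_self _ x]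
    congr 1; ext z
    rw [show x - (x + z) = -z by ring, abs_neg]; ring
  have hcR : EqOn (fun z => Real.exp (-|z|) * f (x + z)) (fun z => Real.exp (-z) * f (x + z))
      (Ioi 0) := fun z hz => by simp only; rw [abs_of_pos hz]
  have hcL : EqOn (fun z => Real.exp (-|z|) * f (x + z)) (fun z => Real.exp (- -z) * f (x - -z))
      (Iic 0) := fun z hz => by simp only; rw [abs_of_nonpos hz, sub_neg_eq_add]
  have hL' : IntegrableOn (fun z => Real.exp (- -z) * f (x - -z)) (Iic 0) := by
    have := (integrableOn_Ici_iff_integrableOn_Ioi (b := (0 : ℝ))).2 hL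
    have h2 := this.comp_neg
    simpa using h2
  have i1 : IntegrableOn (fun z => Real.exp (-|z|) * f (x + z)) (Ioi 0) :=
    hR.congr_fun hcR.symm measurableSet_Ioi
  have i2 : IntegrableOn (fun z => Real.exp (-|z|) * f (x + z)) (Iic 0) :=
    hL'.congr_fun hcL.symm measurableSet_Iic
  rw [e1, integral_const_mul, ← intervalIntegral.integral_Iic_add_Ioi i2 i1,
    setIntegral_congr_fun measurableSet_Iic hcL, setIntegral_congr_fun measurableSet_Ioi hcR,
    integral_comp_neg_Iic 0 (fun z => Real.exp (-z) * f (x - z)), neg_zero, add_comm]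
  rfl

theorem hasDerivAt_helmholtzInv {f : ℝ → ℝ} (hf : Continuous f) {M : ℝ} (hM : ∀ x, |f x| ≤ M)
    (x : ℝ) :
    HasDerivAt (helmholtzInv f) (helmholtzDeriv f x) x := by
  rw [funext (helmholtzInv_eq hf hM)]
  have h := ((hasDerivAt_laplaceRight hf hM x).fun_add (hasDerivAt_laplaceLeft hf hM x)).const_mul
    (1 / 2 : ℝ)
  refine HasDerivAt.congr_deriv (h) ?_
  rw [helmholtzDeriv]; ring

theorem hasDerivAt_helmholtzDeriv {f : ℝ → ℝ} (hf : Continuous f) {M : ℝ} (hM : ∀ x, |f x| ≤ M)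
    (x : ℝ) :
    HasDerivAt (helmholtzDeriv f) (helmholtzInv f x - f x) x := by
  rw [helmholtzInv_eq hf hM]
  have h := ((hasDerivAt_laplaceRight hf hM x).fun_sub (hasDerivAt_laplaceLeft hf hM x)).const_mul
    (1 / 2 : ℝ)
  refine HasDerivAt.congr_deriv (h) ?_
  ring

theorem abs_helmholtzInv_le {f : ℝ → ℝ} (hf : Continuous f) {M : ℝ} (hM : ∀ x, |f x| ≤ M)
    (x : ℝ) : |helmholtzInv f x| ≤ M := by
  rw [helmholtzInv_eq hf hM]
  have h1 := abs_le.1 (abs_laplaceRight_le hM x)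
  have h2 := abs_le.1 (abs_laplaceLeft_le hM x)
  rw [abs_le]; constructor <;> linarith

theorem abs_helmholtzDeriv_le {f : ℝ → ℝ} {M : ℝ} (hM : ∀ x, |f x| ≤ M)
    (x : ℝ) : |helmholtzDeriv f x| ≤ M := by
  rw [helmholtzDeriv]
  have h1 := abs_le.1 (abs_laplaceRight_le hM x)
  have h2 := abs_le.1 (abs_laplaceLeft_le hM x)
  rw [abs_le]; constructor <;> linarith

/-- A bounded function that equals its derivative vanishes. -/
theorem eq_zero_of_deriv_eq_self {α : ℝ → ℝ} (h : ∀ x, HasDerivAt α (α x) x) {M : ℝ}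
    (hM : ∀ x, |α x| ≤ M) (x : ℝ) : α x = 0 := by
  have hd : ∀ x, HasDerivAt (fun x => α x * Real.exp (-x)) 0 x := fun x => by
    have := (h x).fun_mul (hasDerivAt_neg x).exp
    refine HasDerivAt.congr_deriv (this) ?_; ring
  have hconst : ∀ y, α y * Real.exp (-y) = α x * Real.exp (-x) := fun y =>
    is_const_of_deriv_eq_zero (fun x => (hd x).differentiableAt) (fun x => (hd x).deriv) y x
  have hl : Tendsto (fun y => α y * Real.exp (-y)) atTop (𝓝 0) := by
    have h0 : Tendsto (fun y => M * Real.exp (-y)) atTop (𝓝 0) := by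
      simpa using (Real.tendsto_exp_neg_atTop_nhds_zero).const_mul M
    refine squeeze_zero_norm (fun y => ?_) h0
    rw [norm_mul, Real.norm_eq_abs, Real.norm_eq_abs, Real.abs_exp]
    gcongr; exact hM y
  have : α x * Real.exp (-x) = 0 := by
    refine tendsto_nhds_unique (tendsto_const_nhds (x := α x * Real.exp (-x)) (f := atTop (α := ℝ))) ?_
    exact hl.congr hconst
  exact (mul_eq_zero.1 this).resolve_right (Real.exp_pos _).ne'

/-- The only bounded solution of `α - αₓₓ = f` is `(1 - ∂ₓₓ)⁻¹ f`. -/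
theorem eq_helmholtzInv {f α β : ℝ → ℝ} (hf : Continuous f) {M N : ℝ} (hM : ∀ x, |f x| ≤ M)
    (hα : ∀ x, HasDerivAt α (β x) x) (hβ : ∀ x, HasDerivAt β (α x - f x) x)
    (hNα : ∀ x, |α x| ≤ N) (hNβ : ∀ x, |β x| ≤ N) (x : ℝ) :
    α x = helmholtzInv f x ∧ β x = helmholtzDeriv f x := by
  have h1 : ∀ x, |α x - helmholtzInv f x| ≤ N + M := fun x =>
    (abs_sub _ _).trans (add_le_add (hNα x) (abs_helmholtzInv_le hf hM x))
  have h2 : ∀ x, |β x - helmholtzDeriv f x| ≤ N + M := fun x =>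
    (abs_sub _ _).trans (add_le_add (hNβ x) (abs_helmholtzDeriv_le hM x))
  have d1 := fun x => (hα x).fun_sub (hasDerivAt_helmholtzInv hf hM x)
  have d2 := fun x => (hβ x).fun_sub (hasDerivAt_helmholtzDeriv hf hM x)
  -- The difference `δ` of the two solutions satisfies `δ'' = δ`. Hence `δ + δ'`, and `δ - δ'` after
  -- reflection, equal their own derivatives; being bounded, both vanish.
  have z1 := eq_zero_of_deriv_eq_self
    (α := fun x => (α x - helmholtzInv f x) + (β x - helmholtzDeriv f x)) (M := 2 * (N + M))
    (fun x => by
      refine HasDerivAt.congr_deriv ((d1 x).fun_add (d2 x)) ?_; ring)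
    (fun x => by
      refine (abs_add_le _ _).trans ?_
      linarith [h1 x, h2 x])
  have z2 := eq_zero_of_deriv_eq_self
    (α := fun x => (α (-x) - helmholtzInv f (-x)) - (β (-x) - helmholtzDeriv f (-x)))
    (M := 2 * (N + M))
    (fun x => by
      have := ((d1 (-x)).scomp x (hasDerivAt_neg x)).fun_sub
        ((d2 (-x)).scomp x (hasDerivAt_neg x))
      refine HasDerivAt.congr_deriv (this) ?_
      simp; ring)
    (fun x => by
      refine (abs_sub _ _).trans ?_
      linarith [h1 (-x), h2 (-x)])
  have e1 := z1 x
  have e2 := z2 (-x)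
  simp only [neg_neg] at e2
  constructor <;> linarith

/-- Linearity is read off from uniqueness: the difference of the two images is a bounded solution
for the source `f - g`. This yields the statement for the derivatives at the same time. -/
theorem helmholtzInv_sub {f g : ℝ → ℝ} (hf : Continuous f) (hg : Continuous g) {M : ℝ}
    (hM : ∀ x, |f x| ≤ M) (hN : ∀ x, |g x| ≤ M) (x : ℝ) :
    helmholtzInv f x - helmholtzInv g x = helmholtzInv (fun y => f y - g y) x ∧
      helmholtzDeriv f x - helmholtzDeriv g x = helmholtzDeriv (fun y => f y - g y) x := by
  refine eq_helmholtzInv (M := M + M) (N := M + M) (by fun_prop)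
    (fun x => (abs_sub _ _).trans (add_le_add (hM x) (hN x)))
    (fun x => (hasDerivAt_helmholtzInv hf hM x).fun_sub (hasDerivAt_helmholtzInv hg hN x))
    (fun x => ?_)
    (fun x => (abs_sub _ _).trans
      (add_le_add (abs_helmholtzInv_le hf hM x) (abs_helmholtzInv_le hg hN x)))
    (fun x => (abs_sub _ _).trans
      (add_le_add (abs_helmholtzDeriv_le hM x) (abs_helmholtzDeriv_le hN x))) x
  refine HasDerivAt.congr_deriv ((hasDerivAt_helmholtzDeriv hf hM x).fun_sub (hasDerivAt_helmholtzDeriv hg hN x)) ?_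
  ring

theorem continuousOn_laplaceRight {I : Set ℝ} {F : ℝ → ℝ → ℝ}
    (hF : ContinuousOn (Function.uncurry F) (I ×ˢ univ)) {M : ℝ} (hM : ∀ t ∈ I, ∀ x, |F t x| ≤ M) :
    ContinuousOn (Function.uncurry fun t x => laplaceRight (F t) x) (I ×ˢ univ) := by
  rw [continuousOn_iff_continuous_domRestrict]
  refine continuous_of_dominated
    (F := fun (z : (I ×ˢ univ : Set (ℝ × ℝ))) (s : ℝ) => Real.exp (-s) * F z.1.1 (z.1.2 + s))
    (bound := fun s => Real.exp (-s) * M) (fun z => ?_) (fun z => ?_)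
    ((integrableOn_exp_neg_Ioi 0).mul_const M) ?_
  · have := continuous_section_right hF z.2.1
    exact (by fun_prop : Continuous fun s => Real.exp (-s) * F z.1.1 (z.1.2 + s)).aestronglyMeasurable
  · refine ae_of_all _ fun s => ?_
    rw [norm_mul, Real.norm_eq_abs, Real.abs_exp, Real.norm_eq_abs]
    gcongr
    exact hM _ z.2.1 _
  · refine ae_of_all _ fun s => Continuous.mul continuous_const ?_
    exact hF.comp_continuous
      (f := fun z : (I ×ˢ univ : Set (ℝ × ℝ)) => (z.1.1, z.1.2 + s)) (by fun_prop)
      fun z => ⟨z.2.1, mem_univ _⟩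

theorem continuousOn_laplaceLeft {I : Set ℝ} {F : ℝ → ℝ → ℝ}
    (hF : ContinuousOn (Function.uncurry F) (I ×ˢ univ)) {M : ℝ} (hM : ∀ t ∈ I, ∀ x, |F t x| ≤ M) :
    ContinuousOn (Function.uncurry fun t x => laplaceLeft (F t) x) (I ×ˢ univ) := by
  have h1 : ContinuousOn (Function.uncurry fun t x => F t (-x)) (I ×ˢ univ) :=
    hF.comp (f := fun z : ℝ × ℝ => (z.1, -z.2)) (by fun_prop) fun z hz => ⟨hz.1, mem_univ _⟩
  have h2 := continuousOn_laplaceRight h1 (M := M) fun t ht x => hM t ht _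
  have h3 := h2.comp (f := fun z : ℝ × ℝ => (z.1, -z.2)) (s := I ×ˢ univ) (by fun_prop)
    fun z hz => ⟨hz.1, mem_univ _⟩
  refine h3.congr fun z _ => ?_
  exact laplaceLeft_eq _ _

theorem continuousOn_helmholtzInv {I : Set ℝ} {F : ℝ → ℝ → ℝ}
    (hF : ContinuousOn (Function.uncurry F) (I ×ˢ univ)) {M : ℝ} (hM : ∀ t ∈ I, ∀ x, |F t x| ≤ M) :
    ContinuousOn (Function.uncurry fun t x => helmholtzInv (F t) x) (I ×ˢ univ) := by
  refine (((continuousOn_laplaceRight hF hM).add (continuousOn_laplaceLeft hF hM)).const_smul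
    (1 / 2 : ℝ)).congr fun z hz => ?_
  exact helmholtzInv_eq (continuous_section_right hF hz.1) (hM _ hz.1) _

theorem continuousOn_helmholtzDeriv {I : Set ℝ} {F : ℝ → ℝ → ℝ}
    (hF : ContinuousOn (Function.uncurry F) (I ×ˢ univ)) {M : ℝ} (hM : ∀ t ∈ I, ∀ x, |F t x| ≤ M) :
    ContinuousOn (Function.uncurry fun t x => helmholtzDeriv (F t) x) (I ×ˢ univ) :=
  ((continuousOn_laplaceRight hF hM).sub (continuousOn_laplaceLeft hF hM)).const_smul (1 / 2 : ℝ)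

end BEquation

namespace BEquation

/-! ### Uniqueness of smooth solutions -/

/-- Both `B + q` and `B - q` are nondecreasing. -/
theorem abs_le_of_abs_deriv_le {q q' B B' : ℝ → ℝ} {a t : ℝ} (hat : a ≤ t)
    (hq : ContinuousOn q (Icc a t)) (hq' : ∀ s ∈ Ioo a t, HasDerivAt q (q' s) s)
    (hB : ∀ s, HasDerivAt B (B' s) s) (hle : ∀ s ∈ Ioo a t, |q' s| ≤ B' s) (h0 : |q a| ≤ B a) :
    |q t| ≤ B t := by
  have hBc : ContinuousOn B (Icc a t) := fun s _ => (hB s).continuousAt.continuousWithinAt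
  have key : ∀ σ : ℝ, |σ| = 1 → B a + σ * q a ≤ B t + σ * q t := by
    intro σ hσ
    have hm : MonotoneOn (fun s => B s + σ * q s) (Icc a t) := by
      refine monotoneOn_of_hasDerivWithinAt_nonneg (f' := fun s => B' s + σ * q' s)
        (convex_Icc a t) (hBc.add (hq.const_smul σ)) ?_ ?_
      · intro s hs
        rw [interior_Icc] at hs ⊢
        exact ((hB s).fun_add ((hq' s hs).const_mul σ)).hasDerivWithinAt
      · intro s hs
        rw [interior_Icc] at hs
        have h1 : |σ * q' s| ≤ B' s := by rw [abs_mul, hσ, one_mul]; exact hle s hs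
        linarith [(abs_le.1 h1).1]
    exact hm (left_mem_Icc.2 hat) (right_mem_Icc.2 hat) hat
  have k1 := key 1 (by simp)
  have k2 := key (-1) (by simp)
  rw [abs_le] at h0 ⊢
  constructor <;> linarith [h0.1, h0.2]

/-- Every point lies on a characteristic of a bounded Lipschitz velocity field. -/
theorem exists_characteristic {v vx : ℝ → ℝ → ℝ} {t M : ℝ} (ht : 0 ≤ t)
    (hv : ContinuousOn (Function.uncurry v) (Icc 0 t ×ˢ univ))
    (hvx : ∀ s ∈ Icc 0 t, ∀ x, HasDerivAt (v s) (vx s x) x)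
    (hM : ∀ s ∈ Icc 0 t, ∀ x, |v s x| ≤ M ∧ |vx s x| ≤ M) (x : ℝ) :
    ∃ Y : ℝ → ℝ, Y t = x ∧ ∀ s ∈ Icc 0 t, HasDerivWithinAt Y (v s (Y s)) (Icc 0 t) s := by
  have hM0 : 0 ≤ M := (abs_nonneg _).trans (hM 0 (left_mem_Icc.2 ht) 0).1
  -- The initial condition is posed at the final time `t`. A curve of speed at most `M` stays within
  -- `M * t` of `x`, so this radius gives existence on all of `[0, t]` at once.
  refine IsPicardLindelof.exists_eq_forall_mem_Icc_hasDerivWithinAt₀ (f := v) (tmin := 0)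
    (tmax := t) (t₀ := ⟨t, right_mem_Icc.2 ht⟩) (x₀ := x) (a := ⟨M * t, by positivity⟩)
    (L := ⟨M, hM0⟩) (K := ⟨M, hM0⟩) ⟨fun s hs => ?_, fun z _ => ?_, fun s hs z _ => ?_, ?_⟩
  · refine LipschitzWith.lipschitzOnWith ?_
    refine lipschitzWith_of_nnnorm_deriv_le (fun z => (hvx s hs z).differentiableAt) fun z => ?_
    rw [(hvx s hs z).deriv]
    exact (hM s hs z).2
  · exact continuousOn_section_left hv (mem_univ z)
  · exact (hM s hs z).1
  · simp only [sub_self, sub_zero, NNReal.coe_zero]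
    rw [max_eq_right ht]
    exact le_rfl

/-- A bound for a transported quantity, by integration along characteristics. -/
theorem transport_bound {v vx r rt rx : ℝ → ℝ → ℝ} {B B' : ℝ → ℝ} {t M : ℝ} (ht : 0 ≤ t)
    (hv : ContinuousOn (Function.uncurry v) (Icc 0 t ×ˢ univ))
    (hvx : ∀ s ∈ Icc 0 t, ∀ x, HasDerivAt (v s) (vx s x) x)
    (hM : ∀ s ∈ Icc 0 t, ∀ x, |v s x| ≤ M ∧ |vx s x| ≤ M)
    (hr : ContinuousOn (Function.uncurry r) (Icc 0 t ×ˢ univ))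
    (hrt : ∀ s ∈ Ioo 0 t, ∀ x, HasDerivAt (fun τ => r τ x) (rt s x) s)
    (hrx : ∀ s ∈ Ioo 0 t, ∀ x, HasDerivAt (r s) (rx s x) x)
    (hrxc : ContinuousOn (Function.uncurry rx) (Ioo 0 t ×ˢ univ))
    (hB : ∀ s, HasDerivAt B (B' s) s) (hle : ∀ s ∈ Ioo 0 t, ∀ x, |rt s x + rx s x * v s x| ≤ B' s)
    (h0 : ∀ x, |r 0 x| ≤ B 0) (x : ℝ) : |r t x| ≤ B t := by
  obtain ⟨Y, hYt, hY⟩ := exists_characteristic ht hv hvx hM x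
  have hYc : ContinuousOn Y (Icc 0 t) := fun s hs => (hY s hs).continuousWithinAt
  have := abs_le_of_abs_deriv_le (q := fun s => r s (Y s))
    (q' := fun s => rt s (Y s) + rx s (Y s) * v s (Y s)) ht ?_ ?_ hB
    (fun s hs => hle s hs _) (h0 _)
  · rwa [hYt] at this
  · exact hr.comp (f := fun s => (s, Y s)) (continuousOn_id.prodMk hYc) fun s hs => ⟨hs, mem_univ _⟩
  · intro s hs
    have hYs : HasDerivAt Y (v s (Y s)) s :=
      (hY s (Ioo_subset_Icc_self hs)).hasDerivAt (Icc_mem_nhds hs.1 hs.2)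
    have h1 := hasDerivAt_along_curve (f := r) (f' := rx) (Y := Y) (s := s)
      (by filter_upwards [isOpen_Ioo.mem_nhds hs] with τ hτ using hrx τ hτ)
      (hrxc.continuousAt ((isOpen_Ioo.prod isOpen_univ).mem_nhds ⟨hs, mem_univ _⟩)) hYs
    have h2 := (hrt s hs (Y s)).fun_add h1
    simpa using h2

/-- The source term of the nonlocal part of the equation. -/
noncomputable def source (b : ℝ) (u ux : ℝ → ℝ) (x : ℝ) : ℝ := b / 2 * u x ^ 2 + (3 - b) / 2 * ux x ^ 2

theorem abs_source_le {b M : ℝ} {u ux : ℝ → ℝ} {x : ℝ} (h1 : |u x| ≤ M) (h2 : |ux x| ≤ M) :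
    |source b u ux x| ≤ (|b| + |3 - b|) * M ^ 2 := by
  have e1 : u x ^ 2 ≤ M ^ 2 := by rw [← sq_abs]; gcongr
  have e2 : ux x ^ 2 ≤ M ^ 2 := by rw [← sq_abs]; gcongr
  rw [source]
  refine (abs_add_le _ _).trans ?_
  rw [abs_mul, abs_mul, abs_div, abs_div, abs_of_nonneg (sq_nonneg (u x)),
    abs_of_nonneg (sq_nonneg (ux x)), abs_two]
  nlinarith [abs_nonneg b, abs_nonneg (3 - b), sq_nonneg (u x), sq_nonneg (ux x),
    mul_le_mul_of_nonneg_left e1 (abs_nonneg b), mul_le_mul_of_nonneg_left e2 (abs_nonneg (3 - b)),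
    mul_nonneg (abs_nonneg b) (sq_nonneg (u x)), mul_nonneg (abs_nonneg (3 - b)) (sq_nonneg (ux x))]

theorem abs_source_sub_le {b M W : ℝ} {u ux v vx : ℝ → ℝ} {x : ℝ} (h1 : |u x| ≤ M)
    (h2 : |ux x| ≤ M) (h3 : |v x| ≤ M) (h4 : |vx x| ≤ M) (h5 : |v x - u x| ≤ W)
    (h6 : |vx x - ux x| ≤ W) :
    |source b v vx x - source b u ux x| ≤ (|b| + |3 - b|) * M * W := by
  have hM : 0 ≤ M := (abs_nonneg _).trans h1
  have e : source b v vx x - source b u ux x = b * ((v x + u x) / 2) * (v x - u x) +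
      (3 - b) * ((vx x + ux x) / 2) * (vx x - ux x) := by simp only [source]; ring
  have e1 : |(v x + u x) / 2| ≤ M := by
    rw [abs_le] at *; constructor <;> linarith [h1.1, h1.2, h3.1, h3.2]
  have e2 : |(vx x + ux x) / 2| ≤ M := by
    rw [abs_le] at *; constructor <;> linarith [h2.1, h2.2, h4.1, h4.2]
  rw [e]
  refine (abs_add_le _ _).trans ?_
  rw [abs_mul, abs_mul, abs_mul, abs_mul, add_mul, add_mul]
  gcongr

end BEquation

namespace IsSmoothSolution

open BEquation

variable {b T : ℝ} {u₀ : ℝ → ℝ} {u : ℝ → ℝ → ℝ}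

theorem hasDerivAt_x (hu : IsSmoothSolution b T u₀ u) {t : ℝ} (ht : t ∈ Ico 0 T) (x : ℝ) :
    HasDerivAt (u t) (deriv (u t) x) x :=
  ((hu.smooth.1 t ht).differentiable (by simp) x).hasDerivAt

theorem hasDerivAt_xx (hu : IsSmoothSolution b T u₀ u) {t : ℝ} (ht : t ∈ Ico 0 T) (x : ℝ) :
    HasDerivAt (deriv (u t)) (deriv (deriv (u t)) x) x :=
  ((contDiff_infty_iff_deriv.1 (hu.smooth.1 t ht)).2.differentiable (by simp) x).hasDerivAt

theorem continuousOn_u (hu : IsSmoothSolution b T u₀ u) :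
    ContinuousOn (Function.uncurry u) (Ico 0 T ×ˢ univ) := by
  have := hu.smooth.2 0
  simp only [iteratedDeriv_zero] at this
  exact this

theorem continuousOn_ux (hu : IsSmoothSolution b T u₀ u) :
    ContinuousOn (Function.uncurry fun t x => deriv (u t) x) (Ico 0 T ×ˢ univ) := by
  have := hu.smooth.2 1
  simp only [iteratedDeriv_one] at this
  exact this

theorem continuousOn_uxx (hu : IsSmoothSolution b T u₀ u) :
    ContinuousOn (Function.uncurry fun t x => deriv (deriv (u t)) x) (Ico 0 T ×ˢ univ) := by
  have := hu.smooth.2 2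
  simp only [iteratedDeriv_succ', iteratedDeriv_zero] at this
  exact this

theorem continuousOn_source (hu : IsSmoothSolution b T u₀ u) :
    ContinuousOn (Function.uncurry fun t => source b (u t) (deriv (u t))) (Ico 0 T ×ˢ univ) :=
  ((hu.continuousOn_u.pow 2).const_smul (b / 2)).add
    ((hu.continuousOn_ux.pow 2).const_smul ((3 - b) / 2))

theorem bounded_source (hu : IsSmoothSolution b T u₀ u) {T' : ℝ} (hT' : T' < T) :
    ∃ M, ∀ t ∈ Icc 0 T', ∀ x, |source b (u t) (deriv (u t)) x| ≤ M := by
  obtain ⟨M, hM⟩ := hu.bounded T' hT'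
  exact ⟨_, fun t ht x => abs_source_le (hM t ht x).1 (hM t ht x).2⟩

theorem hasDerivAt_t (hu : IsSmoothSolution b T u₀ u) {t : ℝ} (ht : t ∈ Ioo 0 T) (x : ℝ) :
    HasDerivAt (fun τ => u τ x)
      (-(u t x * deriv (u t) x) - helmholtzDeriv (source b (u t) (deriv (u t))) x) t := by
  obtain ⟨M, hM⟩ := hu.bounded_source ht.2
  have hc := continuous_section_right hu.continuousOn_source (Ioo_subset_Ico_self ht)
  have : HasDerivAt (fun τ => u τ x) (-(u t x * deriv (u t) x) -
      deriv (helmholtzInv (source b (u t) (deriv (u t)))) x) t := hu.equation t ht x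
  rwa [(hasDerivAt_helmholtzInv hc (hM t ⟨ht.1.le, le_rfl⟩) x).deriv] at this

theorem hasDerivAt_tx (hu : IsSmoothSolution b T u₀ u) {t : ℝ} (ht : t ∈ Ioo 0 T) (x : ℝ) :
    HasDerivAt (fun τ => deriv (u τ) x)
      (-(deriv (u t) x ^ 2 + u t x * deriv (deriv (u t)) x) -
        (helmholtzInv (source b (u t) (deriv (u t))) x - source b (u t) (deriv (u t)) x)) t := by
  -- The source is bounded only up to times strictly before `T`, and the continuity of the nonlocal
  -- terms needs such a bound.
  obtain ⟨T', htT', hT'⟩ := exists_between ht.2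
  obtain ⟨M, hM⟩ := hu.bounded_source hT'
  have hsub : Ioo 0 T' ⊆ Ico 0 T := fun s hs => ⟨hs.1.le, hs.2.trans hT'⟩
  have hprod : Ioo 0 T' ×ˢ (univ : Set ℝ) ⊆ Ico 0 T ×ˢ univ := prod_mono hsub subset_rfl
  have cs := hu.continuousOn_source.mono hprod
  have cu := hu.continuousOn_u.mono hprod
  have cux := hu.continuousOn_ux.mono hprod
  have cuxx := hu.continuousOn_uxx.mono hprod
  have hM' : ∀ s ∈ Ioo 0 T', ∀ x, |source b (u s) (deriv (u s)) x| ≤ M := fun s hs =>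
    hM s (Ioo_subset_Icc_self hs)
  refine hasDerivAt_deriv_swap (a := 0) (c := T') (f := u)
    (ft := fun t x => -(u t x * deriv (u t) x) - helmholtzDeriv (source b (u t) (deriv (u t))) x)
    (fx := fun t x => deriv (u t) x)
    (ftx := fun t x => -(deriv (u t) x ^ 2 + u t x * deriv (deriv (u t)) x) -
        (helmholtzInv (source b (u t) (deriv (u t))) x - source b (u t) (deriv (u t)) x))
    (fun s hs x => hu.hasDerivAt_t ⟨hs.1, hs.2.trans hT'⟩ x)
    (fun s hs x => hu.hasDerivAt_x (hsub hs) x) (fun s hs x => ?_) ?_ ?_ ⟨ht.1, htT'⟩ x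
  · have h1 := (hu.hasDerivAt_x (hsub hs) x).fun_mul (hu.hasDerivAt_xx (hsub hs) x)
    have h2 := hasDerivAt_helmholtzDeriv (continuous_section_right cs hs) (hM' s hs) x
    exact (h1.fun_neg.fun_sub h2).congr_deriv (by ring)
  · exact (cu.mul cux).neg.sub (continuousOn_helmholtzDeriv cs hM')
  · exact ((cux.pow 2).add (cu.mul cuxx)).neg.sub ((continuousOn_helmholtzInv cs hM').sub cs)

/-- Smooth solutions are determined by their data, if the second derivative of one of them is
bounded. -/
theorem eq_of_bounded_deriv2 {v : ℝ → ℝ → ℝ} (hu : IsSmoothSolution b T u₀ u)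
    (hv : IsSmoothSolution b T u₀ v)
    (hxx : ∀ T' < T, ∃ M : ℝ, ∀ t ∈ Icc 0 T', ∀ x, |deriv (deriv (u t)) x| ≤ M) :
    ∀ t ∈ Ico 0 T, v t = u t := by
  intro T' hT'
  obtain ⟨M₁, hM₁⟩ := hu.bounded T' hT'.2
  obtain ⟨M₂, hM₂⟩ := hv.bounded T' hT'.2
  obtain ⟨M₃, hM₃⟩ := hxx T' hT'.2
  set M := max M₁ (max M₂ M₃) with hMdef
  have l1 : M₁ ≤ M := le_max_left _ _
  have l2 : M₂ ≤ M := (le_max_left _ _).trans (le_max_right _ _)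
  have l3 : M₃ ≤ M := (le_max_right _ _).trans (le_max_right _ _)
  have hM : 0 ≤ M := (abs_nonneg _).trans ((hM₁ 0 ⟨le_rfl, hT'.1⟩ 0).1.trans l1)
  have bu := fun t ht x => (hM₁ t ht x).1.trans l1
  have bux := fun t ht x => (hM₁ t ht x).2.trans l1
  have bv := fun t ht x => (hM₂ t ht x).1.trans l2
  have bvx := fun t ht x => (hM₂ t ht x).2.trans l2
  have buxx := fun t ht x => (hM₃ t ht x).trans l3
  set k := (|b| + |3 - b|) * M with hk
  have hk0 : 0 ≤ k := by positivity
  -- In the equation for the difference of the slopes, `u_xx` costs `M`, `v_x² - u_x²` costs `2 M`,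
  -- and the nonlocal and local source terms cost `k` each; the `1` keeps `C` positive.
  set C := 3 * M + 2 * k + 1 with hC
  have hC0 : 0 < C := by positivity
  have hsub : ∀ {t}, t ∈ Icc 0 T' → t ∈ Ico 0 T := fun ht => ⟨ht.1, ht.2.trans_lt hT'.2⟩
  -- Gronwall's inequality by iteration: the primitive of `C D e^{2Cs}` is `D/2 e^{2Cs}`, so each
  -- pass through the equation halves the constant. Suprema over `x` and their regularity in time
  -- never enter.
  have key : ∀ n : ℕ, ∀ t ∈ Icc 0 T', ∀ x,
      |v t x - u t x| ≤ 2 * M / 2 ^ n * Real.exp (2 * C * t) ∧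
      |deriv (v t) x - deriv (u t) x| ≤ 2 * M / 2 ^ n * Real.exp (2 * C * t) := by
    intro n
    induction n with
    | zero =>
      intro t ht x
      have h1 : (1 : ℝ) ≤ Real.exp (2 * C * t) := Real.one_le_exp (by have := ht.1; positivity)
      have h2 : 2 * M ≤ 2 * M * Real.exp (2 * C * t) := le_mul_of_one_le_right (by positivity) h1
      simp only [pow_zero, div_one]
      constructor
      · exact (abs_sub _ _).trans (by linarith [bu t ht x, bv t ht x])
      · exact (abs_sub _ _).trans (by linarith [bux t ht x, bvx t ht x])
    | succ n ih =>
      intro t ht x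
      set D := 2 * M / 2 ^ n with hD
      have hD0 : 0 ≤ D := by positivity
      have hB : ∀ s, HasDerivAt (fun s => D / 2 * Real.exp (2 * C * s))
          (C * (D * Real.exp (2 * C * s))) s := fun s =>
        ((((hasDerivAt_id s).const_mul (2 * C)).exp).const_mul (D / 2)).congr_deriv
          (by simp only [id]; ring)
      have e : 2 * M / 2 ^ (n + 1) * Real.exp (2 * C * t) = D / 2 * Real.exp (2 * C * t) := by
        rw [hD, pow_succ]; ring
      rw [e]
      have hin : ∀ {s}, s ∈ Icc 0 t → s ∈ Icc 0 T' := fun hs => ⟨hs.1, hs.2.trans ht.2⟩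
      have hin' : ∀ {s}, s ∈ Ioo 0 t → s ∈ Icc 0 T' := fun hs => hin (Ioo_subset_Icc_self hs)
      have hin'' : ∀ {s}, s ∈ Ioo 0 t → s ∈ Ioo 0 T := fun hs =>
        ⟨hs.1, hs.2.trans (ht.2.trans_lt hT'.2)⟩
      have pI : Icc 0 t ×ˢ (univ : Set ℝ) ⊆ Ico 0 T ×ˢ univ :=
        prod_mono (fun s hs => hsub (hin hs)) subset_rfl
      have pO : Ioo 0 t ×ˢ (univ : Set ℝ) ⊆ Ico 0 T ×ˢ univ :=
        prod_mono (fun s hs => hsub (hin' hs)) subset_rfl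
      have hS : ∀ s ∈ Ioo 0 t, ∀ x, |source b (v s) (deriv (v s)) x - source b (u s) (deriv (u s)) x|
          ≤ k * (D * Real.exp (2 * C * s)) := fun s hs x =>
        abs_source_sub_le (bu s (hin' hs) x) (bux s (hin' hs) x) (bv s (hin' hs) x)
          (bvx s (hin' hs) x) (ih s (hin' hs) x).1 (ih s (hin' hs) x).2
      have hH : ∀ s ∈ Ioo 0 t, ∀ x,
          |helmholtzInv (source b (v s) (deriv (v s))) x -
            helmholtzInv (source b (u s) (deriv (u s))) x| ≤ k * (D * Real.exp (2 * C * s)) ∧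
          |helmholtzDeriv (source b (v s) (deriv (v s))) x -
            helmholtzDeriv (source b (u s) (deriv (u s))) x| ≤ k * (D * Real.exp (2 * C * s)) := by
        intro s hs x
        have cv := continuous_section_right hv.continuousOn_source (hsub (hin' hs))
        have cu := continuous_section_right hu.continuousOn_source (hsub (hin' hs))
        have := helmholtzInv_sub cv cu
          (fun x => abs_source_le (bv s (hin' hs) x) (bvx s (hin' hs) x))
          (fun x => abs_source_le (bu s (hin' hs) x) (bux s (hin' hs) x)) x
        rw [this.1, this.2]
        exact ⟨abs_helmholtzInv_le (cv.sub cu) (hS s hs) x, abs_helmholtzDeriv_le (hS s hs) x⟩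
      have h00 : ∀ x, v 0 x - u 0 x = 0 := fun x => by rw [hu.initial, hv.initial, sub_self]
      have h01 : ∀ x, deriv (v 0) x - deriv (u 0) x = 0 := fun x => by
        rw [hu.initial, hv.initial, sub_self]
      constructor
      · refine transport_bound (v := v) (vx := fun t x => deriv (v t) x) (M := M)
          (r := fun s x => v s x - u s x)
          (rx := fun s x => deriv (v s) x - deriv (u s) x) ht.1
          (hv.continuousOn_u.mono pI) (fun s hs x => hv.hasDerivAt_x (hsub (hin hs)) x)
          (fun s hs x => ⟨bv s (hin hs) x, bvx s (hin hs) x⟩)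
          ((hv.continuousOn_u.sub hu.continuousOn_u).mono pI)
          (fun s hs x => (hv.hasDerivAt_t (hin'' hs) x).fun_sub (hu.hasDerivAt_t (hin'' hs) x))
          (fun s hs x => (hv.hasDerivAt_x (hsub (hin' hs)) x).fun_sub
            (hu.hasDerivAt_x (hsub (hin' hs)) x))
          ((hv.continuousOn_ux.sub hu.continuousOn_ux).mono pO) hB (fun s hs x => ?_)
          (fun x => ?_) x
        · set E := D * Real.exp (2 * C * s)
          have hE : 0 ≤ E := by positivity
          have i1 : |(v s x - u s x) * deriv (u s) x| ≤ E * M := by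
            rw [abs_mul]
            exact mul_le_mul (ih s (hin' hs) x).1 (bux s (hin' hs) x) (abs_nonneg _) hE
          have i2 := (hH s hs x).2
          rw [abs_le] at i1 i2 ⊢
          constructor <;> nlinarith [i1.1, i1.2, i2.1, i2.2, mul_nonneg hM hE, mul_nonneg hk0 hE]
        · rw [h00, abs_zero]; positivity
      -- Along the characteristics of `v` the terms with `v_xx` cancel, and what is left is `(v - u)
      -- u_xx`. This is why only one of the two solutions needs a bounded second derivative.
      · refine transport_bound (v := v) (vx := fun t x => deriv (v t) x) (M := M)
          (r := fun s x => deriv (v s) x - deriv (u s) x)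
          (rx := fun s x => deriv (deriv (v s)) x - deriv (deriv (u s)) x) ht.1
          (hv.continuousOn_u.mono pI) (fun s hs x => hv.hasDerivAt_x (hsub (hin hs)) x)
          (fun s hs x => ⟨bv s (hin hs) x, bvx s (hin hs) x⟩)
          ((hv.continuousOn_ux.sub hu.continuousOn_ux).mono pI)
          (fun s hs x => (hv.hasDerivAt_tx (hin'' hs) x).fun_sub (hu.hasDerivAt_tx (hin'' hs) x))
          (fun s hs x => (hv.hasDerivAt_xx (hsub (hin' hs)) x).fun_sub
            (hu.hasDerivAt_xx (hsub (hin' hs)) x))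
          ((hv.continuousOn_uxx.sub hu.continuousOn_uxx).mono pO) hB (fun s hs x => ?_)
          (fun x => ?_) x
        · set E := D * Real.exp (2 * C * s)
          have hE : 0 ≤ E := by positivity
          have i1 : |(v s x - u s x) * deriv (deriv (u s)) x| ≤ E * M := by
            rw [abs_mul]
            exact mul_le_mul (ih s (hin' hs) x).1 (buxx s (hin' hs) x) (abs_nonneg _) hE
          have i3 : |(deriv (v s) x - deriv (u s) x) * (deriv (v s) x + deriv (u s) x)|
              ≤ E * (2 * M) := by
            rw [abs_mul]
            refine mul_le_mul (ih s (hin' hs) x).2 ?_ (abs_nonneg _) hE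
            exact (abs_add_le _ _).trans (by linarith [bux s (hin' hs) x, bvx s (hin' hs) x])
          have i2 := (hH s hs x).1
          have i4 := hS s hs x
          rw [abs_le] at i1 i2 i3 i4 ⊢
          constructor <;> nlinarith [i1.1, i1.2, i2.1, i2.2, i3.1, i3.2, i4.1, i4.2]
        · rw [h01, abs_zero]; positivity
  funext x
  have hT'' : T' ∈ Icc 0 T' := right_mem_Icc.2 hT'.1
  have hlim : Tendsto (fun n : ℕ => 2 * M / 2 ^ n * Real.exp (2 * C * T')) atTop (𝓝 0) := by
    have : Tendsto (fun n : ℕ => 2 * M / (2 : ℝ) ^ n) atTop (𝓝 0) :=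
      tendsto_const_nhds.div_atTop (tendsto_pow_atTop_atTop_of_one_lt (by norm_num))
    simpa using this.mul_const (Real.exp (2 * C * T'))
  have := ge_of_tendsto' hlim fun n => (key n T' hT'' x).1
  exact sub_eq_zero.1 (abs_nonpos_iff.1 this)

end IsSmoothSolution

namespace BEquation

/-! ### The equation in Lagrangian coordinates -/

/-- The monotone map with derivative `e^g` that fixes `0`. -/
noncomputable def flowMap (g : ℝ → ℝ) (ξ : ℝ) : ℝ := ∫ s in (0 : ℝ)..ξ, Real.exp (g s)

/-- `e^{y(ξ)} ∫_ξ^L e^{-y} ρ`. -/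
noncomputable def kernelRight (L : ℝ) (y ρ : ℝ → ℝ) (ξ : ℝ) : ℝ :=
  Real.exp (y ξ) * ∫ η in ξ..L, Real.exp (-y η) * ρ η

/-- `e^{-y(ξ)} ∫_{-L}^ξ e^{y} ρ`. -/
noncomputable def kernelLeft (L : ℝ) (y ρ : ℝ → ℝ) (ξ : ℝ) : ℝ :=
  Real.exp (-y ξ) * ∫ η in (-L)..ξ, Real.exp (y η) * ρ η

/-- The momentum density in Lagrangian coordinates. -/
noncomputable def density (b : ℝ) (m g : ℝ → ℝ) (ξ : ℝ) : ℝ := m ξ * Real.exp ((1 - b) * g ξ)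

/-- The velocity `u` in Lagrangian coordinates. -/
noncomputable def lagU (b L : ℝ) (m g : ℝ → ℝ) (ξ : ℝ) : ℝ :=
  1 / 2 * (kernelRight L (flowMap g) (density b m g) ξ + kernelLeft L (flowMap g) (density b m g) ξ)

/-- The slope `uₓ` in Lagrangian coordinates. -/
noncomputable def lagV (b L : ℝ) (m g : ℝ → ℝ) (ξ : ℝ) : ℝ :=
  1 / 2 * (kernelRight L (flowMap g) (density b m g) ξ - kernelLeft L (flowMap g) (density b m g) ξ)

theorem hasDerivAt_flowMap {g : ℝ → ℝ} (hg : Continuous g) (ξ : ℝ) :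
    HasDerivAt (flowMap g) (Real.exp (g ξ)) ξ :=
  ((by fun_prop : Continuous fun s => Real.exp (g s)).integral_hasStrictDerivAt 0 ξ).hasDerivAt

theorem continuous_flowMap {g : ℝ → ℝ} (hg : Continuous g) : Continuous (flowMap g) :=
  continuous_iff_continuousAt.2 fun ξ => (hasDerivAt_flowMap hg ξ).continuousAt

theorem flowMap_sub {g : ℝ → ℝ} (hg : Continuous g) (p q : ℝ) :
    flowMap g q - flowMap g p = ∫ s in p..q, Real.exp (g s) := by
  have hc : Continuous fun s => Real.exp (g s) := by fun_prop
  exact intervalIntegral.integral_interval_sub_left (hc.intervalIntegrable _ _)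
    (hc.intervalIntegrable _ _)

theorem le_flowMap_sub {g : ℝ → ℝ} (hg : Continuous g) {R : ℝ} (hR : ∀ ξ, |g ξ| ≤ R) {p q : ℝ}
    (hpq : p ≤ q) : Real.exp (-R) * (q - p) ≤ flowMap g q - flowMap g p := by
  rw [flowMap_sub hg]
  have hc : Continuous fun s => Real.exp (g s) := by fun_prop
  have := intervalIntegral.integral_mono_on (μ := volume) hpq (f := fun _ => Real.exp (-R))
    intervalIntegrable_const (hc.intervalIntegrable _ _)
    fun s _ => Real.exp_le_exp.2 (abs_le.1 (hR s)).1
  simpa [mul_comm] using this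

theorem flowMap_sub_le {g : ℝ → ℝ} (hg : Continuous g) {R : ℝ} (hR : ∀ ξ, |g ξ| ≤ R) {p q : ℝ}
    (hpq : p ≤ q) : flowMap g q - flowMap g p ≤ Real.exp R * (q - p) := by
  rw [flowMap_sub hg]
  have hc : Continuous fun s => Real.exp (g s) := by fun_prop
  have := intervalIntegral.integral_mono_on (μ := volume) hpq (g := fun _ => Real.exp R)
    (hc.intervalIntegrable _ _) intervalIntegrable_const
    fun s _ => Real.exp_le_exp.2 (abs_le.1 (hR s)).2
  simpa [mul_comm] using this

theorem monotone_flowMap {g : ℝ → ℝ} (hg : Continuous g) : Monotone (flowMap g) :=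
  monotone_of_hasDerivAt_nonneg (fun ξ => hasDerivAt_flowMap hg ξ) fun _ => (Real.exp_pos _).le

theorem continuous_density {b : ℝ} {m g : ℝ → ℝ} (hm : Continuous m) (hg : Continuous g) :
    Continuous (density b m g) := by unfold density; fun_prop

theorem hasDerivAt_kernelRight {L : ℝ} {y ρ : ℝ → ℝ} {y' ξ : ℝ} (hy : Continuous y)
    (hρ : Continuous ρ) (hy' : HasDerivAt y y' ξ) :
    HasDerivAt (kernelRight L y ρ) (y' * kernelRight L y ρ ξ - ρ ξ) ξ := by
  have hc : Continuous fun η => Real.exp (-y η) * ρ η := by fun_prop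
  have h1 : HasDerivAt (fun ξ => ∫ η in ξ..L, Real.exp (-y η) * ρ η) (-(Real.exp (-y ξ) * ρ ξ)) ξ :=
    intervalIntegral.integral_hasDerivAt_left (hc.intervalIntegrable _ _)
      (hc.stronglyMeasurableAtFilter _ _) hc.continuousAt
  refine (hy'.exp.fun_mul h1).congr_deriv ?_
  have : Real.exp (y ξ) * Real.exp (-y ξ) = 1 := by rw [← Real.exp_add]; simp
  rw [kernelRight]
  linear_combination (-ρ ξ) * this

theorem hasDerivAt_kernelLeft {L : ℝ} {y ρ : ℝ → ℝ} {y' ξ : ℝ} (hy : Continuous y)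
    (hρ : Continuous ρ) (hy' : HasDerivAt y y' ξ) :
    HasDerivAt (kernelLeft L y ρ) (-(y' * kernelLeft L y ρ ξ) + ρ ξ) ξ := by
  have hc : Continuous fun η => Real.exp (y η) * ρ η := by fun_prop
  have h1 : HasDerivAt (fun ξ => ∫ η in (-L)..ξ, Real.exp (y η) * ρ η) (Real.exp (y ξ) * ρ ξ) ξ :=
    (hc.integral_hasStrictDerivAt _ _).hasDerivAt
  refine (hy'.fun_neg.exp.fun_mul h1).congr_deriv ?_
  have : Real.exp (-y ξ) * Real.exp (y ξ) = 1 := by rw [← Real.exp_add]; simp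
  rw [kernelLeft]
  linear_combination (ρ ξ) * this

theorem hasDerivAt_lagU {b L : ℝ} {m g : ℝ → ℝ} (hm : Continuous m) (hg : Continuous g) (ξ : ℝ) :
    HasDerivAt (lagU b L m g) (lagV b L m g ξ * Real.exp (g ξ)) ξ := by
  have h := hasDerivAt_flowMap hg ξ
  refine (((hasDerivAt_kernelRight (continuous_flowMap hg) (continuous_density hm hg) h).fun_add
    (hasDerivAt_kernelLeft (continuous_flowMap hg) (continuous_density hm hg) h)).const_mul
      (1 / 2 : ℝ)).congr_deriv ?_
  rw [lagV]; ring

theorem hasDerivAt_lagV {b L : ℝ} {m g : ℝ → ℝ} (hm : Continuous m) (hg : Continuous g) (ξ : ℝ) :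
    HasDerivAt (lagV b L m g) (lagU b L m g ξ * Real.exp (g ξ) - density b m g ξ) ξ := by
  have h := hasDerivAt_flowMap hg ξ
  refine (((hasDerivAt_kernelRight (continuous_flowMap hg) (continuous_density hm hg) h).fun_sub
    (hasDerivAt_kernelLeft (continuous_flowMap hg) (continuous_density hm hg) h)).const_mul
      (1 / 2 : ℝ)).congr_deriv ?_
  rw [lagU]; ring

theorem continuous_lagU {b L : ℝ} {m g : ℝ → ℝ} (hm : Continuous m) (hg : Continuous g) :
    Continuous (lagU b L m g) :=
  continuous_iff_continuousAt.2 fun ξ => (hasDerivAt_lagU hm hg ξ).continuousAt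

theorem continuous_lagV {b L : ℝ} {m g : ℝ → ℝ} (hm : Continuous m) (hg : Continuous g) :
    Continuous (lagV b L m g) :=
  continuous_iff_continuousAt.2 fun ξ => (hasDerivAt_lagV hm hg ξ).continuousAt

/-! ### Bounds and Lipschitz estimates -/

theorem integrable_of_support {L : ℝ} {m : ℝ → ℝ} (hm : Continuous m)
    (hL : ∀ x, L ≤ |x| → m x = 0) : Integrable m := by
  refine hm.integrable_of_hasCompactSupport ?_
  refine HasCompactSupport.intro (isCompact_Icc (a := -L) (b := L)) fun x hx => hL x ?_
  by_contra! h
  exact hx ⟨(abs_lt.1 h).1.le, (abs_lt.1 h).2.le⟩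

theorem abs_intervalIntegral_le {m f : ℝ → ℝ} (hm : Integrable m) {K p q : ℝ} (hK : 0 ≤ K)
    (h : ∀ η ∈ uIoc p q, |f η| ≤ K * |m η|) : |∫ η in p..q, f η| ≤ K * ∫ η, |m η| := by
  have hi : Integrable fun η => K * |m η| := hm.abs.const_mul K
  have h1 := intervalIntegral.norm_integral_le_abs_of_norm_le (f := f) (ae_restrict_of_forall_mem
    measurableSet_uIoc h) (hi.intervalIntegrable (a := p) (b := q))
  refine h1.trans ?_
  rw [← integral_const_mul, intervalIntegral.abs_intervalIntegral_eq]
  rw [abs_of_nonneg (integral_nonneg fun η => by positivity)]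
  exact setIntegral_le_integral hi (ae_of_all _ fun η => by positivity)

theorem abs_exp_sub_exp_le {p q M : ℝ} (hp : p ≤ M) (hq : q ≤ M) :
    |Real.exp p - Real.exp q| ≤ Real.exp M * |p - q| := by
  have := (convex_Iic M).norm_image_sub_le_of_norm_hasDerivWithin_le (f := Real.exp)
    (f' := Real.exp) (C := Real.exp M) (x := q) (y := p)
    (fun x _ => (Real.hasDerivAt_exp x).hasDerivWithinAt)
    (fun x hx => by rw [Real.norm_eq_abs, Real.abs_exp]; exact Real.exp_le_exp.2 hx) hq hp
  simpa [Real.norm_eq_abs] using this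

/-- For `ξ > L` the integral over `ξ..L` runs backwards, but there `m` vanishes. So wherever the
integrand matters, the label `η` lies to the right of `ξ`. -/
theorem mem_uIoc_right {L : ℝ} {m : ℝ → ℝ} (hL : ∀ x, L ≤ |x| → m x = 0) {ξ η : ℝ}
    (hη : η ∈ uIoc ξ L) : ξ ≤ η ∨ m η = 0 := by
  rcases le_total ξ L with h | h
  · rw [uIoc_of_le h] at hη; exact Or.inl hη.1.le
  · rw [uIoc_of_ge h] at hη; exact Or.inr (hL _ (hη.1.le.trans (le_abs_self _)))

theorem mem_uIoc_left {L : ℝ} {m : ℝ → ℝ} (hL : ∀ x, L ≤ |x| → m x = 0) {ξ η : ℝ}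
    (hη : η ∈ uIoc (-L) ξ) : η ≤ ξ ∨ m η = 0 := by
  rcases le_total (-L) ξ with h | h
  · rw [uIoc_of_le h] at hη; exact Or.inl hη.2
  · rw [uIoc_of_ge h] at hη
    exact Or.inr (hL _ (by have := neg_le_abs η; linarith [hη.2]))

theorem kernelRight_eq {L : ℝ} {y ρ : ℝ → ℝ} (ξ : ℝ) :
    kernelRight L y ρ ξ = ∫ η in ξ..L, Real.exp (y ξ - y η) * ρ η := by
  rw [kernelRight, ← intervalIntegral.integral_const_mul]
  congr 1; ext η; rw [← mul_assoc, ← Real.exp_add, sub_eq_add_neg]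

theorem kernelLeft_eq {L : ℝ} {y ρ : ℝ → ℝ} (ξ : ℝ) :
    kernelLeft L y ρ ξ = ∫ η in (-L)..ξ, Real.exp (y η - y ξ) * ρ η := by
  rw [kernelLeft, ← intervalIntegral.integral_const_mul]
  congr 1; ext η; rw [← mul_assoc, ← Real.exp_add, sub_eq_add_neg, add_comm]

/-- Where the density lives, the exponents are nonpositive since `y` is monotone. The bound
therefore depends neither on `y` nor on `ξ`. -/
theorem abs_kernel_le {L K : ℝ} {m y ρ : ℝ → ℝ} (hm : Continuous m) (hL : ∀ x, L ≤ |x| → m x = 0)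
    (hK : 0 ≤ K) (hy : Monotone y) (hρ : ∀ η, |ρ η| ≤ K * |m η|) (ξ : ℝ) :
    |kernelRight L y ρ ξ| ≤ K * ∫ η, |m η| ∧ |kernelLeft L y ρ ξ| ≤ K * ∫ η, |m η| := by
  have hmi := integrable_of_support hm hL
  rw [kernelRight_eq, kernelLeft_eq]
  constructor
  · refine abs_intervalIntegral_le hmi hK fun η hη => ?_
    rw [abs_mul, Real.abs_exp]
    rcases mem_uIoc_right hL hη with h | h
    · have : Real.exp (y ξ - y η) ≤ 1 := Real.exp_le_one_iff.2 (by linarith [hy h])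
      exact (mul_le_of_le_one_left (abs_nonneg _) this).trans (hρ η)
    · have := hρ η
      rw [h, abs_zero, mul_zero] at this ⊢
      rw [le_antisymm this (abs_nonneg _), mul_zero]
  · refine abs_intervalIntegral_le hmi hK fun η hη => ?_
    rw [abs_mul, Real.abs_exp]
    rcases mem_uIoc_left hL hη with h | h
    · have : Real.exp (y η - y ξ) ≤ 1 := Real.exp_le_one_iff.2 (by linarith [hy h])
      exact (mul_le_of_le_one_left (abs_nonneg _) this).trans (hρ η)
    · have := hρ η
      rw [h, abs_zero, mul_zero] at this ⊢
      rw [le_antisymm this (abs_nonneg _), mul_zero]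

theorem exp_mul_le {c x R : ℝ} (h : |x| ≤ R) : Real.exp (c * x) ≤ Real.exp (|c| * R) := by
  apply Real.exp_le_exp.2
  calc c * x ≤ |c * x| := le_abs_self _
    _ = |c| * |x| := abs_mul _ _
    _ ≤ |c| * R := by gcongr

theorem abs_density_le {b R : ℝ} {m g : ℝ → ℝ} (hR : ∀ ξ, |g ξ| ≤ R) (η : ℝ) :
    |density b m g η| ≤ Real.exp (|1 - b| * R) * |m η| := by
  rw [density, abs_mul, Real.abs_exp, mul_comm]
  exact mul_le_mul_of_nonneg_right (exp_mul_le (hR η)) (abs_nonneg _)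

theorem abs_lagU_lagV_le {b L R : ℝ} {m g : ℝ → ℝ} (hm : Continuous m)
    (hL : ∀ x, L ≤ |x| → m x = 0) (hg : Continuous g) (hR : ∀ ξ, |g ξ| ≤ R) (ξ : ℝ) :
    |lagU b L m g ξ| ≤ Real.exp (|1 - b| * R) * ∫ η, |m η| ∧
      |lagV b L m g ξ| ≤ Real.exp (|1 - b| * R) * ∫ η, |m η| := by
  obtain ⟨h1, h2⟩ := abs_kernel_le hm hL (Real.exp_pos (|1 - b| * R)).le (monotone_flowMap hg)
    (abs_density_le (b := b) (m := m) hR) ξ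
  rw [abs_le] at h1 h2
  rw [lagU, lagV, abs_le, abs_le]
  refine ⟨⟨?_, ?_⟩, ?_, ?_⟩ <;> linarith [h1.1, h1.2, h2.1, h2.2]

/-- The distances between the images of `p` and `q` under the two flows differ by up to `e^R d (q -
p)`, which is unbounded in `q - p`. But both exponentials are at most `e^{-x}` with `x = e^{-R} (q -
p)`, and `x e^{-x} ≤ 1` absorbs the growth at the price of a factor `e^{2R}`. -/
theorem abs_kernel_sub_le {b R d : ℝ} {g₁ g₂ : ℝ → ℝ} (hg₁ : Continuous g₁) (hg₂ : Continuous g₂)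
    (h₁ : ∀ ξ, |g₁ ξ| ≤ R) (h₂ : ∀ ξ, |g₂ ξ| ≤ R) (hd : ∀ ξ, |g₁ ξ - g₂ ξ| ≤ d) {p q : ℝ}
    (hpq : p ≤ q) (η : ℝ) :
    |Real.exp (flowMap g₁ p - flowMap g₁ q) * Real.exp ((1 - b) * g₁ η) -
      Real.exp (flowMap g₂ p - flowMap g₂ q) * Real.exp ((1 - b) * g₂ η)| ≤
      Real.exp (|1 - b| * R) * (Real.exp (2 * R) + |1 - b|) * d := by
  have hd0 : 0 ≤ d := (abs_nonneg _).trans (hd 0)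
  have hR0 : 0 ≤ R := (abs_nonneg _).trans (h₁ 0)
  have a1 := le_flowMap_sub hg₁ h₁ hpq
  have a2 := le_flowMap_sub hg₂ h₂ hpq
  have hsub : |(flowMap g₁ p - flowMap g₁ q) - (flowMap g₂ p - flowMap g₂ q)| ≤
      Real.exp R * d * (q - p) := by
    have e : (flowMap g₁ p - flowMap g₁ q) - (flowMap g₂ p - flowMap g₂ q) =
        -∫ s in p..q, (Real.exp (g₁ s) - Real.exp (g₂ s)) := by
      rw [intervalIntegral.integral_sub
        ((by fun_prop : Continuous fun s => Real.exp (g₁ s)).intervalIntegrable _ _)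
        ((by fun_prop : Continuous fun s => Real.exp (g₂ s)).intervalIntegrable _ _),
        ← flowMap_sub hg₁, ← flowMap_sub hg₂]
      ring
    rw [e, abs_neg]
    have := intervalIntegral.norm_integral_le_of_norm_le_const (a := p) (b := q)
      (f := fun s => Real.exp (g₁ s) - Real.exp (g₂ s)) (C := Real.exp R * d) fun s _ =>
        (abs_exp_sub_exp_le (abs_le.1 (h₁ s)).2 (abs_le.1 (h₂ s)).2).trans
          (mul_le_mul_of_nonneg_left (hd s) (Real.exp_pos _).le)
    rwa [Real.norm_eq_abs, abs_of_nonneg (sub_nonneg.2 hpq)] at this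
  set x := Real.exp (-R) * (q - p) with hx
  have hx0 : 0 ≤ x := mul_nonneg (Real.exp_pos _).le (sub_nonneg.2 hpq)
  have hexp : |Real.exp (flowMap g₁ p - flowMap g₁ q) - Real.exp (flowMap g₂ p - flowMap g₂ q)| ≤
      Real.exp (2 * R) * d := by
    have i1 := abs_exp_sub_exp_le (p := flowMap g₁ p - flowMap g₁ q)
      (q := flowMap g₂ p - flowMap g₂ q) (M := -x) (by linarith) (by linarith)
    have i2 : Real.exp (-x) * x ≤ 1 := by
      have h3 : x ≤ Real.exp x := by linarith [Real.add_one_le_exp x]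
      calc Real.exp (-x) * x ≤ Real.exp (-x) * Real.exp x := by gcongr
        _ = 1 := by rw [← Real.exp_add]; simp
    have i3 : Real.exp R * d * (q - p) = Real.exp (2 * R) * d * x := by
      have : Real.exp (2 * R) * Real.exp (-R) = Real.exp R := by rw [← Real.exp_add]; ring_nf
      rw [hx]
      linear_combination (-d * (q - p)) * this
    calc _ ≤ _ := i1
      _ ≤ Real.exp (-x) * (Real.exp (2 * R) * d * x) := by rw [← i3]; gcongr
      _ = Real.exp (2 * R) * d * (Real.exp (-x) * x) := by ring
      _ ≤ Real.exp (2 * R) * d * 1 := by gcongr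
      _ = _ := mul_one _
  have hone : |Real.exp (flowMap g₂ p - flowMap g₂ q)| ≤ 1 := by
    rw [Real.abs_exp]; exact Real.exp_le_one_iff.2 (by linarith)
  have hw : |Real.exp ((1 - b) * g₁ η) - Real.exp ((1 - b) * g₂ η)| ≤
      Real.exp (|1 - b| * R) * (|1 - b| * d) := by
    have l1 : ∀ z, |z| ≤ R → (1 - b) * z ≤ |1 - b| * R := fun z hz =>
      (le_abs_self _).trans (by rw [abs_mul]; gcongr)
    refine (abs_exp_sub_exp_le (l1 _ (h₁ η)) (l1 _ (h₂ η))).trans ?_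
    rw [← mul_sub, abs_mul]
    gcongr
    exact hd η
  have e : ∀ A B C D : ℝ, A * C - B * D = (A - B) * C + B * (C - D) := fun _ _ _ _ => by ring
  rw [e]
  refine (abs_add_le _ _).trans ?_
  rw [abs_mul, abs_mul, Real.abs_exp ((1 - b) * g₁ η)]
  calc _ ≤ (Real.exp (2 * R) * d) * Real.exp (|1 - b| * R) +
        1 * (Real.exp (|1 - b| * R) * (|1 - b| * d)) :=
        add_le_add (mul_le_mul hexp (exp_mul_le (h₁ η)) (Real.exp_pos _).le (by positivity))
          (mul_le_mul hone hw (abs_nonneg _) zero_le_one)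
    _ = _ := by ring

/-- This is the Lipschitz property, in the uniform norm, of the field of the equation `g_t =
lagV(g)` on functions bounded by `R`. -/
theorem abs_lagV_sub_le {b L R d : ℝ} {m g₁ g₂ : ℝ → ℝ} (hm : Continuous m)
    (hL : ∀ x, L ≤ |x| → m x = 0) (hg₁ : Continuous g₁) (hg₂ : Continuous g₂)
    (h₁ : ∀ ξ, |g₁ ξ| ≤ R) (h₂ : ∀ ξ, |g₂ ξ| ≤ R) (hd : ∀ ξ, |g₁ ξ - g₂ ξ| ≤ d) (ξ : ℝ) :
    |lagV b L m g₁ ξ - lagV b L m g₂ ξ| ≤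
      Real.exp (|1 - b| * R) * (Real.exp (2 * R) + |1 - b|) * (∫ η, |m η|) * d := by
  have hd0 : 0 ≤ d := (abs_nonneg _).trans (hd 0)
  set K := Real.exp (|1 - b| * R) * (Real.exp (2 * R) + |1 - b|) * d with hK
  have hK0 : 0 ≤ K := by positivity
  have hmi := integrable_of_support hm hL
  have c1 := continuous_flowMap hg₁
  have c2 := continuous_flowMap hg₂
  have hR : |kernelRight L (flowMap g₁) (density b m g₁) ξ -
      kernelRight L (flowMap g₂) (density b m g₂) ξ| ≤ K * ∫ η, |m η| := by
    rw [kernelRight_eq, kernelRight_eq, ← intervalIntegral.integral_sub]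
    · refine abs_intervalIntegral_le hmi hK0 fun η hη => ?_
      rcases mem_uIoc_right hL hη with h | h
      · have := abs_kernel_sub_le (b := b) hg₁ hg₂ h₁ h₂ hd h η
        rw [← hK] at this
        rw [density, density, show ∀ A B C D, A * (m η * C) - B * (m η * D) = (A * C - B * D) * m η from
          fun _ _ _ _ => by ring, abs_mul]
        gcongr
      · simp [density, h]
    · exact (Continuous.mul (by fun_prop) (continuous_density hm hg₁)).intervalIntegrable _ _
    · exact (Continuous.mul (by fun_prop) (continuous_density hm hg₂)).intervalIntegrable _ _
  have hLf : |kernelLeft L (flowMap g₁) (density b m g₁) ξ -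
      kernelLeft L (flowMap g₂) (density b m g₂) ξ| ≤ K * ∫ η, |m η| := by
    rw [kernelLeft_eq, kernelLeft_eq, ← intervalIntegral.integral_sub]
    · refine abs_intervalIntegral_le hmi hK0 fun η hη => ?_
      rcases mem_uIoc_left hL hη with h | h
      · have := abs_kernel_sub_le (b := b) hg₁ hg₂ h₁ h₂ hd h η
        rw [← hK] at this
        rw [density, density, show ∀ A B C D, A * (m η * C) - B * (m η * D) = (A * C - B * D) * m η from
          fun _ _ _ _ => by ring, abs_mul]
        gcongr
      · simp [density, h]
    · exact (Continuous.mul (by fun_prop) (continuous_density hm hg₁)).intervalIntegrable _ _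
    · exact (Continuous.mul (by fun_prop) (continuous_density hm hg₂)).intervalIntegrable _ _
  have e : Real.exp (|1 - b| * R) * (Real.exp (2 * R) + |1 - b|) * (∫ η, |m η|) * d =
      K * ∫ η, |m η| := by rw [hK]; ring
  rw [e, lagV, lagV]
  rw [abs_le] at hR hLf ⊢
  constructor <;> linarith [hR.1, hR.2, hLf.1, hLf.2]

/-! ### Solving the truncated equation -/

/-- Truncation of a function at height `R`. -/
def clamp (R : ℝ) (g : ℝ → ℝ) (ξ : ℝ) : ℝ := max (-R) (min R (g ξ))

theorem abs_clamp_le {R : ℝ} (hR : 0 ≤ R) (g : ℝ → ℝ) (ξ : ℝ) : |clamp R g ξ| ≤ R :=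
  abs_le.2 ⟨le_max_left _ _, max_le (by linarith) (min_le_left _ _)⟩

theorem clamp_eq {R : ℝ} {g : ℝ → ℝ} (h : ∀ ξ, |g ξ| ≤ R) : clamp R g = g := by
  funext ξ
  rw [clamp, min_eq_right (abs_le.1 (h ξ)).2, max_eq_right (abs_le.1 (h ξ)).1]

theorem abs_clamp_sub_le (R : ℝ) (g₁ g₂ : ℝ → ℝ) (ξ : ℝ) :
    |clamp R g₁ ξ - clamp R g₂ ξ| ≤ |g₁ ξ - g₂ ξ| := by
  rw [clamp, clamp, max_comm, max_comm (-R)]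
  refine (abs_max_sub_max_le_abs _ _ (-R)).trans ?_
  have := abs_min_sub_min_le_max R (g₁ ξ) R (g₂ ξ)
  simpa using this

theorem continuous_clamp {R : ℝ} {g : ℝ → ℝ} (hg : Continuous g) : Continuous (clamp R g) := by
  unfold clamp; fun_prop

open BoundedContinuousFunction in
/-- The equation for the logarithm of the Lagrangian stretching, truncated at height `R`, has a
solution on any bounded interval of time. -/
theorem exists_truncated_solution (b : ℝ) {L R : ℝ} (hR : 0 ≤ R) {m : ℝ → ℝ} (hm : Continuous m)
    (hL : ∀ x, L ≤ |x| → m x = 0) {T : ℝ} (hT : 0 < T) :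
    ∃ g g' : ℝ → ℝ →ᵇ ℝ, g 0 = 0 ∧ (∀ t ξ, g' t ξ = lagV b L m (clamp R (g t)) ξ) ∧
      ∀ t ∈ Ioo (-T) T, HasDerivAt g (g' t) t := by
  set N := Real.exp (|1 - b| * R) * ∫ η, |m η| with hN
  set K := Real.exp (|1 - b| * R) * (Real.exp (2 * R) + |1 - b|) * (∫ η, |m η|) with hK
  have hI : 0 ≤ ∫ η, |m η| := integral_nonneg fun η => abs_nonneg _
  have hN0 : 0 ≤ N := by positivity
  have hK0 : 0 ≤ K := by positivity
  let F : (ℝ →ᵇ ℝ) → (ℝ →ᵇ ℝ) := fun g =>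
    BoundedContinuousFunction.ofNormedAddCommGroup (lagV b L m (clamp R g))
      (continuous_lagV hm (continuous_clamp g.continuous)) N
      fun ξ => (abs_lagU_lagV_le hm hL (continuous_clamp g.continuous) (abs_clamp_le hR g) ξ).2
  have hF : ∀ g ξ, F g ξ = lagV b L m (clamp R g) ξ := fun g ξ => rfl
  have hlip : LipschitzWith ⟨K, hK0⟩ F := by
    refine LipschitzWith.of_dist_le_mul fun g₁ g₂ => ?_
    refine (BoundedContinuousFunction.dist_le (mul_nonneg hK0 dist_nonneg)).2 fun ξ => ?_
    rw [Real.dist_eq, hF, hF]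
    exact abs_lagV_sub_le hm hL (continuous_clamp g₁.continuous) (continuous_clamp g₂.continuous)
      (abs_clamp_le hR g₁) (abs_clamp_le hR g₂) (fun ξ => (abs_clamp_sub_le R g₁ g₂ ξ).trans
        (by rw [← Real.dist_eq]; exact BoundedContinuousFunction.dist_coe_le_dist ξ)) ξ
  have hbd : ∀ g, ‖F g‖ ≤ N := fun g => BoundedContinuousFunction.norm_ofNormedAddCommGroup_le _ hN0 _
  -- After truncation `F` is bounded by `N` and Lipschitz on the whole space, so the ball of radius
  -- `N * T` is never left and `T` is arbitrary.
  have hPL : IsPicardLindelof (fun _ => F) (tmin := -T) (tmax := T)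
      ⟨0, by constructor <;> linarith⟩ 0 ⟨N * T, by positivity⟩ 0 ⟨N, hN0⟩ ⟨K, hK0⟩ := by
    refine IsPicardLindelof.of_time_independent (fun g _ => hbd g) hlip.lipschitzOnWith ?_
    simp only [sub_zero, zero_sub, neg_neg, max_self, NNReal.coe_zero]
    exact le_rfl
  obtain ⟨g, hg0, hg⟩ := hPL.exists_eq_forall_mem_Icc_hasDerivWithinAt₀
  refine ⟨g, fun t => F (g t), hg0, fun t ξ => hF _ _, fun t ht => ?_⟩
  exact (hg t (Ioo_subset_Icc_self ht)).hasDerivAt (Icc_mem_nhds ht.1 ht.2)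

end BEquation

namespace BEquation

/-! ### From Lagrangian to Eulerian coordinates -/

/-- `g` is the logarithm of the stretching of a Lagrangian flow of the `b`-equation on the time
interval `(a, c)`, for the initial momentum `m`. -/
structure IsLagrangianSolution (b L R a c : ℝ) (m : ℝ → ℝ) (g : ℝ → ℝ → ℝ) : Prop where
  zero_mem : (0 : ℝ) ∈ Ioo a c
  smooth : ContDiff ℝ ∞ m
  supp : ∀ x, L ≤ |x| → m x = 0
  initial : ∀ ξ, g 0 ξ = 0
  bounded : ∀ t ∈ Ioo a c, ∀ ξ, |g t ξ| ≤ R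
  continuousOn : ContinuousOn (Function.uncurry g) (Ioo a c ×ˢ univ)
  hasDerivAt : ∀ t ∈ Ioo a c, ∀ ξ, HasDerivAt (fun τ => g τ ξ) (lagV b L m (g t) ξ) t

theorem continuousOn_primitive_right {I : Set ℝ} {F : ℝ → ℝ → ℝ} (p : ℝ)
    (hF : ContinuousOn (Function.uncurry F) (I ×ˢ univ)) :
    ContinuousOn (Function.uncurry fun t ξ => ∫ η in p..ξ, F t η) (I ×ˢ univ) := by
  have e : ∀ t ξ, ∫ η in p..ξ, F t η = (ξ - p) * ∫ σ in (0 : ℝ)..1, F t (p + (ξ - p) * σ) := by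
    intro t ξ
    have := intervalIntegral.smul_integral_comp_add_mul (a := 0) (b := 1) (F t) (ξ - p) p
    simp only [mul_zero, mul_one, smul_eq_mul, add_zero, add_sub_cancel] at this
    exact this.symm
  have h1 : ContinuousOn (fun z : ℝ × ℝ => ∫ σ in (0 : ℝ)..1, F z.1 (p + (z.2 - p) * σ))
      (I ×ˢ univ) := by
    refine continuousOn_intervalIntegral_param
      (F := fun (z : ℝ × ℝ) σ => F z.1 (p + (z.2 - p) * σ)) zero_le_one ?_
    exact hF.comp (f := fun w : (ℝ × ℝ) × ℝ => (w.1.1, p + (w.1.2 - p) * w.2)) (by fun_prop)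
      fun w hw => ⟨hw.1.1, mem_univ _⟩
  refine ((continuousOn_snd.sub (continuousOn_const (c := p))).mul h1).congr fun z _ => ?_
  exact e z.1 z.2

theorem continuousOn_kernel {I : Set ℝ} {y ρ : ℝ → ℝ → ℝ} (L : ℝ)
    (hy : ContinuousOn (Function.uncurry y) (I ×ˢ univ))
    (hρ : ContinuousOn (Function.uncurry ρ) (I ×ˢ univ)) :
    ContinuousOn (Function.uncurry fun t => kernelRight L (y t) (ρ t)) (I ×ˢ univ) ∧
      ContinuousOn (Function.uncurry fun t => kernelLeft L (y t) (ρ t)) (I ×ˢ univ) := by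
  constructor
  · have h := continuousOn_primitive_right (F := fun t η => Real.exp (-y t η) * ρ t η) L
      (hy.neg.rexp.mul hρ)
    refine (hy.rexp.mul h.neg).congr fun z _ => ?_
    simp only [Function.uncurry, kernelRight, Pi.mul_apply, Pi.neg_apply]
    rw [intervalIntegral.integral_symm]
  · have h := continuousOn_primitive_right (F := fun t η => Real.exp (y t η) * ρ t η) (-L)
      (hy.rexp.mul hρ)
    exact hy.neg.rexp.mul h

/-- Since `flowMap` fixes the label `0`, its time derivative is the velocity relative to that label.
The constant `lagU … 0` has to be pulled out of the integral so that it cancels against the one from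
the exponential prefactor. -/
theorem kernelRight_lincomb {L : ℝ} {y ρ₁ ρ₂ : ℝ → ℝ} (hy : Continuous y) (h₁ : Continuous ρ₁)
    (h₂ : Continuous ρ₂) (k ξ : ℝ) :
    kernelRight L y (fun η => ρ₁ η + k * ρ₂ η) ξ =
      kernelRight L y ρ₁ ξ + k * kernelRight L y ρ₂ ξ := by
  simp only [kernelRight, mul_add]
  rw [intervalIntegral.integral_add
    ((by fun_prop : Continuous fun η => Real.exp (-y η) * ρ₁ η).intervalIntegrable _ _)
    ((by fun_prop : Continuous fun η => Real.exp (-y η) * (k * ρ₂ η)).intervalIntegrable _ _)]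
  simp only [mul_left_comm _ k, intervalIntegral.integral_const_mul]
  ring

theorem kernelLeft_lincomb {L : ℝ} {y ρ₁ ρ₂ : ℝ → ℝ} (hy : Continuous y) (h₁ : Continuous ρ₁)
    (h₂ : Continuous ρ₂) (k ξ : ℝ) :
    kernelLeft L y (fun η => ρ₁ η + k * ρ₂ η) ξ =
      kernelLeft L y ρ₁ ξ + k * kernelLeft L y ρ₂ ξ := by
  simp only [kernelLeft, mul_add]
  rw [intervalIntegral.integral_add
    ((by fun_prop : Continuous fun η => Real.exp (y η) * ρ₁ η).intervalIntegrable _ _)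
    ((by fun_prop : Continuous fun η => Real.exp (y η) * (k * ρ₂ η)).intervalIntegrable _ _)]
  simp only [mul_left_comm _ k, intervalIntegral.integral_const_mul]
  ring

/-- The time derivative of `lagU` along a Lagrangian solution. -/
noncomputable def lagA (b L : ℝ) (m g : ℝ → ℝ) (ξ : ℝ) : ℝ :=
  lagU b L m g ξ * lagV b L m g ξ + 1 / 2 *
    (kernelRight L (flowMap g)
      (fun η => (-lagU b L m g η + (1 - b) * lagV b L m g η) * density b m g η) ξ +
    kernelLeft L (flowMap g)
      (fun η => (lagU b L m g η + (1 - b) * lagV b L m g η) * density b m g η) ξ)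

/-- The time derivative of `lagV` along a Lagrangian solution. -/
noncomputable def lagB (b L : ℝ) (m g : ℝ → ℝ) (ξ : ℝ) : ℝ :=
  lagU b L m g ξ ^ 2 + 1 / 2 *
    (kernelRight L (flowMap g)
      (fun η => (-lagU b L m g η + (1 - b) * lagV b L m g η) * density b m g η) ξ -
    kernelLeft L (flowMap g)
      (fun η => (lagU b L m g η + (1 - b) * lagV b L m g η) * density b m g η) ξ)

theorem hasDerivAt_lagA {b L : ℝ} {m g : ℝ → ℝ} (hm : Continuous m) (hg : Continuous g) (ξ : ℝ) :
    HasDerivAt (lagA b L m g) ((lagB b L m g ξ + lagV b L m g ξ ^ 2) * Real.exp (g ξ)) ξ := by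
  have h := hasDerivAt_flowMap hg ξ
  have cU := continuous_lagU (b := b) (L := L) hm hg
  have cV := continuous_lagV (b := b) (L := L) hm hg
  have cρ := continuous_density (b := b) hm hg
  refine (((hasDerivAt_lagU hm hg ξ).fun_mul (hasDerivAt_lagV hm hg ξ)).fun_add
    (((hasDerivAt_kernelRight (L := L) (continuous_flowMap hg) (by fun_prop) h).fun_add
    (hasDerivAt_kernelLeft (L := L) (continuous_flowMap hg) (by fun_prop) h)).const_mul
      (1 / 2 : ℝ))).congr_deriv ?_
  rw [lagB]; ring

theorem hasDerivAt_lagB {b L : ℝ} {m g : ℝ → ℝ} (hm : Continuous m) (hg : Continuous g) (ξ : ℝ) :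
    HasDerivAt (lagB b L m g) ((lagA b L m g ξ + lagU b L m g ξ * lagV b L m g ξ) * Real.exp (g ξ) -
      (1 - b) * lagV b L m g ξ * density b m g ξ) ξ := by
  have h := hasDerivAt_flowMap hg ξ
  have cU := continuous_lagU (b := b) (L := L) hm hg
  have cV := continuous_lagV (b := b) (L := L) hm hg
  have cρ := continuous_density (b := b) hm hg
  refine (((hasDerivAt_lagU hm hg ξ).fun_pow 2).fun_add
    (((hasDerivAt_kernelRight (L := L) (continuous_flowMap hg) (by fun_prop) h).fun_sub
    (hasDerivAt_kernelLeft (L := L) (continuous_flowMap hg) (by fun_prop) h)).const_mul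
      (1 / 2 : ℝ))).congr_deriv ?_
  rw [lagA]; ring

theorem exists_bound_lagA_lagB {b L R : ℝ} {m g : ℝ → ℝ} (hm : Continuous m)
    (hL : ∀ x, L ≤ |x| → m x = 0) (hg : Continuous g) (hR : ∀ ξ, |g ξ| ≤ R) :
    ∃ N, ∀ ξ, |lagA b L m g ξ| ≤ N ∧ |lagB b L m g ξ| ≤ N := by
  set N := Real.exp (|1 - b| * R) * ∫ η, |m η| with hN
  have hUV := abs_lagU_lagV_le (b := b) hm hL hg hR
  rw [← hN] at hUV
  have hN0 : 0 ≤ N := (abs_nonneg _).trans (hUV 0).1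
  set K := (N + |1 - b| * N) * Real.exp (|1 - b| * R) with hK
  have hK0 : 0 ≤ K := by positivity
  have hb : ∀ (σ : ℝ) (η : ℝ), |σ| = 1 →
      |(σ * lagU b L m g η + (1 - b) * lagV b L m g η) * density b m g η| ≤ K * |m η| := by
    intro σ η hσ
    rw [abs_mul, hK, mul_assoc (N + |1 - b| * N)]
    refine mul_le_mul ((abs_add_le _ _).trans ?_) (abs_density_le hR η) (abs_nonneg _) (by positivity)
    rw [abs_mul, abs_mul, hσ, one_mul]
    gcongr
    · exact (hUV η).1
    · exact (hUV η).2
  refine ⟨N * N + K * ∫ η, |m η|, fun ξ => ?_⟩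
  have k1 := (abs_kernel_le hm hL hK0 (monotone_flowMap hg)
    (ρ := fun η => (-lagU b L m g η + (1 - b) * lagV b L m g η) * density b m g η)
    (fun η => by simpa using hb (-1) η (by simp)) ξ).1
  have k2 := (abs_kernel_le hm hL hK0 (monotone_flowMap hg)
    (ρ := fun η => (lagU b L m g η + (1 - b) * lagV b L m g η) * density b m g η)
    (fun η => by simpa using hb 1 η (by simp)) ξ).2
  have u1 : |lagU b L m g ξ * lagV b L m g ξ| ≤ N * N := by
    rw [abs_mul]; exact mul_le_mul (hUV ξ).1 (hUV ξ).2 (abs_nonneg _) hN0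
  have u2 : |lagU b L m g ξ ^ 2| ≤ N * N := by
    rw [sq, abs_mul]; exact mul_le_mul (hUV ξ).1 (hUV ξ).1 (abs_nonneg _) hN0
  rw [lagA, lagB]
  rw [abs_le] at k1 k2 u1 u2
  rw [abs_le, abs_le]
  refine ⟨⟨?_, ?_⟩, ?_, ?_⟩ <;> linarith [k1.1, k1.2, k2.1, k2.2, u1.1, u1.2, u2.1, u2.2]

/-- The Lagrangian flow: the position at time `t` of the particle with label `ξ`. -/
noncomputable def position (b L : ℝ) (m : ℝ → ℝ) (g : ℝ → ℝ → ℝ) (t ξ : ℝ) : ℝ :=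
  (∫ s in (0 : ℝ)..t, lagU b L m (g s) 0) + flowMap (g t) ξ

/-- The inverse of the Lagrangian flow. -/
noncomputable def label (b L : ℝ) (m : ℝ → ℝ) (g : ℝ → ℝ → ℝ) (t : ℝ) : ℝ → ℝ :=
  Function.invFun (position b L m g t)

/-- The Eulerian velocity. -/
noncomputable def eulerU (b L : ℝ) (m : ℝ → ℝ) (g : ℝ → ℝ → ℝ) (t x : ℝ) : ℝ :=
  lagU b L m (g t) (label b L m g t x)

/-- The Eulerian slope. -/
noncomputable def eulerV (b L : ℝ) (m : ℝ → ℝ) (g : ℝ → ℝ → ℝ) (t x : ℝ) : ℝ :=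
  lagV b L m (g t) (label b L m g t x)

/-- The Eulerian momentum `u - uₓₓ`. -/
noncomputable def momentum (b L : ℝ) (m : ℝ → ℝ) (g : ℝ → ℝ → ℝ) (t x : ℝ) : ℝ :=
  m (label b L m g t x) * Real.exp (-b * g t (label b L m g t x))

/-! ### The Lagrangian flow, its inverse, and the Eulerian equation -/

namespace IsLagrangianSolution

variable {b L R a c : ℝ} {m : ℝ → ℝ} {g : ℝ → ℝ → ℝ}

theorem continuous_g (h : IsLagrangianSolution b L R a c m g) {t : ℝ} (ht : t ∈ Ioo a c) :
    Continuous (g t) := continuous_section_right h.continuousOn ht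

theorem continuousOn_flowMap (h : IsLagrangianSolution b L R a c m g) :
    ContinuousOn (Function.uncurry fun t => flowMap (g t)) (Ioo a c ×ˢ univ) :=
  continuousOn_primitive_right 0 h.continuousOn.rexp

theorem continuousOn_density (h : IsLagrangianSolution b L R a c m g) :
    ContinuousOn (Function.uncurry fun t => density b m (g t)) (Ioo a c ×ˢ univ) :=
  (h.smooth.continuous.comp continuous_snd).continuousOn.mul
    (h.continuousOn.const_smul (1 - b)).rexp

theorem continuousOn_lagU (h : IsLagrangianSolution b L R a c m g) :
    ContinuousOn (Function.uncurry fun t => lagU b L m (g t)) (Ioo a c ×ˢ univ) :=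
  let k := continuousOn_kernel L h.continuousOn_flowMap h.continuousOn_density
  (k.1.add k.2).const_smul (1 / 2 : ℝ)

theorem continuousOn_lagV (h : IsLagrangianSolution b L R a c m g) :
    ContinuousOn (Function.uncurry fun t => lagV b L m (g t)) (Ioo a c ×ˢ univ) :=
  let k := continuousOn_kernel L h.continuousOn_flowMap h.continuousOn_density
  (k.1.sub k.2).const_smul (1 / 2 : ℝ)

theorem uIcc_subset (h : IsLagrangianSolution b L R a c m g) {t : ℝ} (ht : t ∈ Ioo a c) :
    uIcc 0 t ⊆ Ioo a c := ordConnected_Ioo.uIcc_subset h.zero_mem ht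

theorem eq_integral (h : IsLagrangianSolution b L R a c m g) {t : ℝ} (ht : t ∈ Ioo a c) (ξ : ℝ) :
    g t ξ = ∫ s in (0 : ℝ)..t, lagV b L m (g s) ξ := by
  rw [intervalIntegral.integral_eq_sub_of_hasDerivAt
    (fun s hs => h.hasDerivAt s (h.uIcc_subset ht hs) ξ), h.initial, sub_zero]
  exact ((continuousOn_section_left h.continuousOn_lagV (mem_univ ξ)).mono
    (h.uIcc_subset ht)).intervalIntegrable

/-- A bootstrap: the space derivatives of `lagU` and `lagV` are expressions in `lagU`, `lagV`, `g`
and `m` without further derivatives, so both gain one order. Then `g` gains it too, as the time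
primitive of `lagV`. -/
theorem jointSmooth (h : IsLagrangianSolution b L R a c m g) (n : ℕ) :
    JointSmooth (Ioo a c) n g ∧ JointSmooth (Ioo a c) n (fun t => lagU b L m (g t)) ∧
      JointSmooth (Ioo a c) n (fun t => lagV b L m (g t)) := by
  induction n with
  | zero => exact ⟨h.continuousOn, h.continuousOn_lagU, h.continuousOn_lagV⟩
  | succ n ih =>
    obtain ⟨ig, iU, iV⟩ := ih
    have hV : JointSmooth (Ioo a c) (n + 1) (fun t => lagV b L m (g t)) :=
      JointSmooth.of_hasDerivAt h.continuousOn_lagV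
        (fun t ht x => hasDerivAt_lagV h.smooth.continuous (h.continuous_g ht) x)
        ((iU.mul ig.exp).sub ((JointSmooth.of_contDiff h.smooth).mul (ig.const_mul (1 - b)).exp))
    refine ⟨?_, ?_, hV⟩
    · exact (hV.primitive h.zero_mem).congr fun t ht x => h.eq_integral ht x
    · exact JointSmooth.of_hasDerivAt h.continuousOn_lagU
        (fun t ht x => hasDerivAt_lagU h.smooth.continuous (h.continuous_g ht) x) (iV.mul ig.exp)

/-- Differentiating under the integral produces `e^g lagV`, which is exactly the label derivative of
`lagU`; the integral telescopes. -/
theorem hasDerivAt_flowMap_t (h : IsLagrangianSolution b L R a c m g) {t : ℝ} (ht : t ∈ Ioo a c)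
    (ξ : ℝ) : HasDerivAt (fun τ => flowMap (g τ) ξ)
      (lagU b L m (g t) ξ - lagU b L m (g t) 0) t := by
  have hd := hasDerivAt_intervalIntegral_param (I := Ioo a c) isOpen_Ioo
    (F := fun t η => Real.exp (g t η))
    (F' := fun t η => Real.exp (g t η) * lagV b L m (g t) η) (a := 0) (b := ξ)
    (fun t ht => (h.continuous_g ht).rexp.continuousOn)
    (fun t ht η _ => (h.hasDerivAt t ht η).exp)
    ((h.continuousOn.rexp.mul h.continuousOn_lagV).mono (prod_mono subset_rfl (subset_univ _))) ht
  refine hd.congr_deriv ?_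
  have hg := h.continuous_g ht
  have hV := continuous_lagV (b := b) (L := L) h.smooth.continuous hg
  rw [← intervalIntegral.integral_eq_sub_of_hasDerivAt
    (fun η _ => hasDerivAt_lagU (b := b) (L := L) h.smooth.continuous hg η)
    ((by fun_prop : Continuous fun η => lagV b L m (g t) η * Real.exp (g t η)).intervalIntegrable _ _)]
  congr 1; ext η; ring

theorem hasDerivAt_kernelRight_t (h : IsLagrangianSolution b L R a c m g) {t : ℝ}
    (ht : t ∈ Ioo a c) (ξ : ℝ) :
    HasDerivAt (fun τ => kernelRight L (flowMap (g τ)) (density b m (g τ)) ξ)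
      (lagU b L m (g t) ξ * kernelRight L (flowMap (g t)) (density b m (g t)) ξ +
        kernelRight L (flowMap (g t)) (fun η => (-lagU b L m (g t) η + (1 - b) * lagV b L m (g t) η) *
          density b m (g t) η) ξ) t := by
  have hg := h.continuous_g ht
  have hm := h.smooth.continuous
  have cU := continuous_lagU (b := b) (L := L) hm hg
  have cV := continuous_lagV (b := b) (L := L) hm hg
  have cρ := continuous_density (b := b) hm hg
  have cy := continuous_flowMap hg
  have hU0 : ContinuousOn (fun z : ℝ × ℝ => lagU b L m (g z.1) 0) (Ioo a c ×ˢ univ) :=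
    h.continuousOn_lagU.comp (f := fun z : ℝ × ℝ => (z.1, (0 : ℝ))) (by fun_prop)
      fun z hz => ⟨hz.1, mem_univ _⟩
  have hd := hasDerivAt_intervalIntegral_param (I := Ioo a c) isOpen_Ioo
    (F := fun t η => Real.exp (-flowMap (g t) η) * density b m (g t) η)
    (F' := fun t η => Real.exp (-flowMap (g t) η) * (-(lagU b L m (g t) η - lagU b L m (g t) 0)) *
      density b m (g t) η + Real.exp (-flowMap (g t) η) *
        (m η * (Real.exp ((1 - b) * g t η) * ((1 - b) * lagV b L m (g t) η)))) (a := ξ) (b := L)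
    (fun t ht => ((continuous_flowMap (h.continuous_g ht)).neg.rexp.mul
      (continuous_density hm (h.continuous_g ht))).continuousOn)
    (fun t ht η _ => ((h.hasDerivAt_flowMap_t ht η).fun_neg.exp).fun_mul
      ((((h.hasDerivAt t ht η).const_mul (1 - b)).exp).const_mul (m η)))
    (ContinuousOn.mono (((h.continuousOn_flowMap.neg.rexp.mul
      (h.continuousOn_lagU.sub hU0).neg).mul h.continuousOn_density).add
      (h.continuousOn_flowMap.neg.rexp.mul ((hm.comp continuous_snd).continuousOn.mul
        ((h.continuousOn.const_smul (1 - b)).rexp.mul (h.continuousOn_lagV.const_smul (1 - b))))))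
      (prod_mono subset_rfl (subset_univ _))) ht
  refine ((h.hasDerivAt_flowMap_t ht ξ).exp.fun_mul hd).congr_deriv ?_
  have key := kernelRight_lincomb (L := L) cy (ρ₁ := fun η => (-lagU b L m (g t) η +
    (1 - b) * lagV b L m (g t) η) * density b m (g t) η) (by fun_prop) cρ (lagU b L m (g t) 0) ξ
  have e2 : kernelRight L (flowMap (g t)) (fun η => (-lagU b L m (g t) η +
      (1 - b) * lagV b L m (g t) η) * density b m (g t) η +
      lagU b L m (g t) 0 * density b m (g t) η) ξ =
      Real.exp (flowMap (g t) ξ) * ∫ η in ξ..L, (Real.exp (-flowMap (g t) η) *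
        (-(lagU b L m (g t) η - lagU b L m (g t) 0)) * density b m (g t) η +
        Real.exp (-flowMap (g t) η) *
        (m η * (Real.exp ((1 - b) * g t η) * ((1 - b) * lagV b L m (g t) η)))) := by
    rw [kernelRight]
    congr 2; ext η; simp only [density]; ring
  rw [← e2, key]
  simp only [kernelRight]; ring

theorem hasDerivAt_kernelLeft_t (h : IsLagrangianSolution b L R a c m g) {t : ℝ}
    (ht : t ∈ Ioo a c) (ξ : ℝ) :
    HasDerivAt (fun τ => kernelLeft L (flowMap (g τ)) (density b m (g τ)) ξ)
      (-(lagU b L m (g t) ξ * kernelLeft L (flowMap (g t)) (density b m (g t)) ξ) +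
        kernelLeft L (flowMap (g t)) (fun η => (lagU b L m (g t) η + (1 - b) * lagV b L m (g t) η) *
          density b m (g t) η) ξ) t := by
  have hg := h.continuous_g ht
  have hm := h.smooth.continuous
  have cU := continuous_lagU (b := b) (L := L) hm hg
  have cV := continuous_lagV (b := b) (L := L) hm hg
  have cρ := continuous_density (b := b) hm hg
  have cy := continuous_flowMap hg
  have hU0 : ContinuousOn (fun z : ℝ × ℝ => lagU b L m (g z.1) 0) (Ioo a c ×ˢ univ) :=
    h.continuousOn_lagU.comp (f := fun z : ℝ × ℝ => (z.1, (0 : ℝ))) (by fun_prop)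
      fun z hz => ⟨hz.1, mem_univ _⟩
  have hd := hasDerivAt_intervalIntegral_param (I := Ioo a c) isOpen_Ioo
    (F := fun t η => Real.exp (flowMap (g t) η) * density b m (g t) η)
    (F' := fun t η => Real.exp (flowMap (g t) η) * (lagU b L m (g t) η - lagU b L m (g t) 0) *
      density b m (g t) η + Real.exp (flowMap (g t) η) *
        (m η * (Real.exp ((1 - b) * g t η) * ((1 - b) * lagV b L m (g t) η)))) (a := -L) (b := ξ)
    (fun t ht => ((continuous_flowMap (h.continuous_g ht)).rexp.mul
      (continuous_density hm (h.continuous_g ht))).continuousOn)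
    (fun t ht η _ => ((h.hasDerivAt_flowMap_t ht η).exp).fun_mul
      ((((h.hasDerivAt t ht η).const_mul (1 - b)).exp).const_mul (m η)))
    (ContinuousOn.mono (((h.continuousOn_flowMap.rexp.mul
      (h.continuousOn_lagU.sub hU0)).mul h.continuousOn_density).add
      (h.continuousOn_flowMap.rexp.mul ((hm.comp continuous_snd).continuousOn.mul
        ((h.continuousOn.const_smul (1 - b)).rexp.mul (h.continuousOn_lagV.const_smul (1 - b))))))
      (prod_mono subset_rfl (subset_univ _))) ht
  refine ((h.hasDerivAt_flowMap_t ht ξ).fun_neg.exp.fun_mul hd).congr_deriv ?_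
  have key := kernelLeft_lincomb (L := L) cy (ρ₁ := fun η => (lagU b L m (g t) η +
    (1 - b) * lagV b L m (g t) η) * density b m (g t) η) (by fun_prop) cρ (-lagU b L m (g t) 0) ξ
  have e2 : kernelLeft L (flowMap (g t)) (fun η => (lagU b L m (g t) η +
      (1 - b) * lagV b L m (g t) η) * density b m (g t) η +
      -lagU b L m (g t) 0 * density b m (g t) η) ξ =
      Real.exp (-flowMap (g t) ξ) * ∫ η in (-L)..ξ, (Real.exp (flowMap (g t) η) *
        (lagU b L m (g t) η - lagU b L m (g t) 0) * density b m (g t) η +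
        Real.exp (flowMap (g t) η) *
        (m η * (Real.exp ((1 - b) * g t η) * ((1 - b) * lagV b L m (g t) η)))) := by
    rw [kernelLeft]
    congr 2; ext η; simp only [density]; ring
  rw [← e2, key]
  simp only [kernelLeft]; ring

theorem hasDerivAt_lagU_t (h : IsLagrangianSolution b L R a c m g) {t : ℝ} (ht : t ∈ Ioo a c)
    (ξ : ℝ) : HasDerivAt (fun τ => lagU b L m (g τ) ξ) (lagA b L m (g t) ξ) t := by
  refine (((h.hasDerivAt_kernelRight_t ht ξ).fun_add
    (h.hasDerivAt_kernelLeft_t ht ξ)).const_mul (1 / 2 : ℝ)).congr_deriv ?_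
  rw [lagA, lagV]; ring

theorem hasDerivAt_lagV_t (h : IsLagrangianSolution b L R a c m g) {t : ℝ} (ht : t ∈ Ioo a c)
    (ξ : ℝ) : HasDerivAt (fun τ => lagV b L m (g τ) ξ) (lagB b L m (g t) ξ) t := by
  refine (((h.hasDerivAt_kernelRight_t ht ξ).fun_sub
    (h.hasDerivAt_kernelLeft_t ht ξ)).const_mul (1 / 2 : ℝ)).congr_deriv ?_
  have e : lagU b L m (g t) ξ ^ 2 = lagU b L m (g t) ξ * (1 / 2 *
    (kernelRight L (flowMap (g t)) (density b m (g t)) ξ +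
      kernelLeft L (flowMap (g t)) (density b m (g t)) ξ)) := by rw [sq]; rfl
  rw [lagB, e]; ring

theorem hasDerivAt_position_t (h : IsLagrangianSolution b L R a c m g) {t : ℝ} (ht : t ∈ Ioo a c)
    (ξ : ℝ) : HasDerivAt (fun τ => position b L m g τ ξ) (lagU b L m (g t) ξ) t := by
  have hc := continuousOn_section_left h.continuousOn_lagU (mem_univ (0 : ℝ))
  have h1 : HasDerivAt (fun τ => ∫ s in (0 : ℝ)..τ, lagU b L m (g s) 0) (lagU b L m (g t) 0) t :=
    intervalIntegral.integral_hasDerivAt_right ((hc.mono (h.uIcc_subset ht)).intervalIntegrable)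
      (hc.stronglyMeasurableAtFilter isOpen_Ioo t ht) (hc.continuousAt (isOpen_Ioo.mem_nhds ht))
  exact (h1.fun_add (h.hasDerivAt_flowMap_t ht ξ)).congr_deriv (by ring)

theorem hasDerivAt_position (h : IsLagrangianSolution b L R a c m g) {t : ℝ} (ht : t ∈ Ioo a c)
    (ξ : ℝ) : HasDerivAt (position b L m g t) (Real.exp (g t ξ)) ξ :=
  (hasDerivAt_flowMap (h.continuous_g ht) ξ).const_add _

theorem le_abs_position_sub (h : IsLagrangianSolution b L R a c m g) {t : ℝ} (ht : t ∈ Ioo a c)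
    (p q : ℝ) : Real.exp (-R) * |q - p| ≤ |position b L m g t q - position b L m g t p| := by
  have key := fun p q => le_flowMap_sub (h.continuous_g ht) (h.bounded t ht) (p := p) (q := q)
  have e : position b L m g t q - position b L m g t p = flowMap (g t) q - flowMap (g t) p := by
    simp only [position]; ring
  rw [e]
  rcases le_total p q with hpq | hpq
  · rw [abs_of_nonneg (sub_nonneg.2 hpq)]
    exact (key p q hpq).trans (le_abs_self _)
  · rw [abs_of_nonpos (sub_nonpos.2 hpq), neg_sub, abs_sub_comm]
    exact (key q p hpq).trans (le_abs_self _)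

theorem position_injective (h : IsLagrangianSolution b L R a c m g) {t : ℝ} (ht : t ∈ Ioo a c) :
    Function.Injective (position b L m g t) := by
  intro p q hpq
  have := h.le_abs_position_sub ht p q
  rw [hpq, sub_self, abs_zero] at this
  have h2 : |q - p| ≤ 0 := by
    by_contra! h3
    have := mul_pos (Real.exp_pos (-R)) h3
    linarith
  exact (sub_eq_zero.1 (abs_nonpos_iff.1 h2)).symm

theorem position_surjective (h : IsLagrangianSolution b L R a c m g) {t : ℝ} (ht : t ∈ Ioo a c) :
    Function.Surjective (position b L m g t) := by
  have hc : Continuous (position b L m g t) :=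
    continuous_iff_continuousAt.2 fun ξ => (h.hasDerivAt_position ht ξ).continuousAt
  have key := fun p q => le_flowMap_sub (h.continuous_g ht) (h.bounded t ht) (p := p) (q := q)
  have e : ∀ p q, position b L m g t q - position b L m g t p = flowMap (g t) q - flowMap (g t) p :=
    fun p q => by simp only [position]; ring
  refine hc.surjective ?_ ?_
  · have h1 : Tendsto (fun q => position b L m g t 0 + Real.exp (-R) * q) atTop atTop :=
      tendsto_atTop_add_const_left _ _ (tendsto_id.const_mul_atTop (Real.exp_pos _))
    refine tendsto_atTop_mono' _ ?_ h1
    filter_upwards [eventually_ge_atTop 0] with q hq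
    have := key 0 q hq
    linarith [e 0 q]
  · have h1 : Tendsto (fun q => position b L m g t 0 + Real.exp (-R) * q) atBot atBot :=
      tendsto_atBot_add_const_left _ _ (tendsto_id.const_mul_atBot (Real.exp_pos _))
    refine tendsto_atBot_mono' _ ?_ h1
    filter_upwards [eventually_le_atBot 0] with q hq
    have := key q 0 hq
    linarith [e q 0]

theorem position_label (h : IsLagrangianSolution b L R a c m g) {t : ℝ} (ht : t ∈ Ioo a c) (x : ℝ) :
    position b L m g t (label b L m g t x) = x :=
  Function.rightInverse_invFun (h.position_surjective ht) x

theorem label_position (h : IsLagrangianSolution b L R a c m g) {t : ℝ} (ht : t ∈ Ioo a c) (ξ : ℝ) :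
    label b L m g t (position b L m g t ξ) = ξ :=
  Function.leftInverse_invFun (h.position_injective ht) ξ

theorem continuousOn_label (h : IsLagrangianSolution b L R a c m g) :
    ContinuousOn (Function.uncurry (label b L m g)) (Ioo a c ×ˢ univ) := by
  rintro ⟨t, x⟩ ⟨ht, -⟩
  set ξ := label b L m g t x with hξ
  refine ContinuousAt.continuousWithinAt ?_
  rw [ContinuousAt, tendsto_iff_norm_sub_tendsto_zero]
  -- The inverse flow at each time is Lipschitz with constant `e^R`. Comparing with the position of
  -- the fixed label `ξ` at the varying time reduces joint continuity to continuity of one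
  -- trajectory.
  have h1 : Tendsto (fun z : ℝ × ℝ => Real.exp R * |z.2 - position b L m g z.1 ξ|) (𝓝 (t, x))
      (𝓝 0) := by
    have hp : ContinuousAt (fun z : ℝ × ℝ => position b L m g z.1 ξ) (t, x) :=
      (h.hasDerivAt_position_t ht ξ).continuousAt.comp (f := Prod.fst) continuousAt_fst
    have := ((continuousAt_snd (p := (t, x))).sub hp).abs.const_mul (Real.exp R)
    rw [ContinuousAt] at this
    simpa [hξ, h.position_label ht] using this
  refine squeeze_zero' (Eventually.of_forall fun _ => norm_nonneg _) ?_ h1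
  filter_upwards [(isOpen_Ioo.prod isOpen_univ).mem_nhds (⟨ht, mem_univ x⟩ : (t, x) ∈ Ioo a c ×ˢ univ)]
    with z hz
  have := h.le_abs_position_sub hz.1 ξ (label b L m g z.1 z.2)
  rw [h.position_label hz.1] at this
  have e : Real.exp R * Real.exp (-R) = 1 := by rw [← Real.exp_add]; simp
  calc ‖Function.uncurry (label b L m g) z - Function.uncurry (label b L m g) (t, x)‖
      = Real.exp R * (Real.exp (-R) * |label b L m g z.1 z.2 - ξ|) := by
        rw [← mul_assoc, e, one_mul]; rfl
    _ ≤ _ := by gcongr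

theorem hasDerivAt_label (h : IsLagrangianSolution b L R a c m g) {t : ℝ} (ht : t ∈ Ioo a c) (x : ℝ) :
    HasDerivAt (label b L m g t) (Real.exp (-g t (label b L m g t x))) x := by
  rw [Real.exp_neg]
  exact HasDerivAt.of_local_left_inverse
    (continuous_section_right h.continuousOn_label ht).continuousAt
    (h.hasDerivAt_position ht _) (Real.exp_pos _).ne'
    (Eventually.of_forall fun x => h.position_label ht x)

theorem jointSmooth_comp_label (h : IsLagrangianSolution b L R a c m g) {f : ℝ → ℝ → ℝ} {n : ℕ}
    (hf : JointSmooth (Ioo a c) n f) :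
    JointSmooth (Ioo a c) n (fun t x => f t (label b L m g t x)) := by
  refine JointSmooth.comp_curve (G := fun t ξ => Real.exp (-g t ξ)) h.continuousOn_label
    (fun t ht x => h.hasDerivAt_label ht x) ?_ hf
  have := ((h.jointSmooth n).1.const_mul (-1)).exp
  simpa using this

theorem jointSmooth_eulerU (h : IsLagrangianSolution b L R a c m g) (n : ℕ) :
    JointSmooth (Ioo a c) n (eulerU b L m g) := h.jointSmooth_comp_label (h.jointSmooth n).2.1

theorem jointSmooth_eulerV (h : IsLagrangianSolution b L R a c m g) (n : ℕ) :
    JointSmooth (Ioo a c) n (eulerV b L m g) := h.jointSmooth_comp_label (h.jointSmooth n).2.2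

theorem jointSmooth_momentum (h : IsLagrangianSolution b L R a c m g) (n : ℕ) :
    JointSmooth (Ioo a c) n (momentum b L m g) :=
  h.jointSmooth_comp_label (f := fun t ξ => m ξ * Real.exp (-b * g t ξ))
    ((JointSmooth.of_contDiff h.smooth).mul ((h.jointSmooth n).1.const_mul (-b)).exp)

theorem hasDerivAt_comp_label (h : IsLagrangianSolution b L R a c m g) {t : ℝ} (ht : t ∈ Ioo a c)
    {f : ℝ → ℝ} {f' x : ℝ}
    (hf : HasDerivAt f (f' * Real.exp (g t (label b L m g t x))) (label b L m g t x)) :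
    HasDerivAt (fun x => f (label b L m g t x)) f' x := by
  refine (hf.comp x (h.hasDerivAt_label ht x)).congr_deriv ?_
  rw [mul_assoc, ← Real.exp_add]; simp

theorem density_eq (t x : ℝ) : density b m (g t) (label b L m g t x) =
    momentum b L m g t x * Real.exp (g t (label b L m g t x)) := by
  rw [density, momentum, mul_assoc, ← Real.exp_add]; ring_nf

theorem hasDerivAt_eulerU (h : IsLagrangianSolution b L R a c m g) {t : ℝ} (ht : t ∈ Ioo a c)
    (x : ℝ) : HasDerivAt (eulerU b L m g t) (eulerV b L m g t x) x :=
  h.hasDerivAt_comp_label ht (hasDerivAt_lagU h.smooth.continuous (h.continuous_g ht) _)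

theorem hasDerivAt_eulerV (h : IsLagrangianSolution b L R a c m g) {t : ℝ} (ht : t ∈ Ioo a c)
    (x : ℝ) : HasDerivAt (eulerV b L m g t) (eulerU b L m g t x - momentum b L m g t x) x := by
  refine h.hasDerivAt_comp_label ht
    ((hasDerivAt_lagV h.smooth.continuous (h.continuous_g ht) _).congr_deriv ?_)
  rw [density_eq, eulerU]; ring

theorem deriv_eulerU (h : IsLagrangianSolution b L R a c m g) {t : ℝ} (ht : t ∈ Ioo a c) :
    deriv (eulerU b L m g t) = eulerV b L m g t :=
  funext fun x => (h.hasDerivAt_eulerU ht x).deriv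

theorem bounded_euler (h : IsLagrangianSolution b L R a c m g) {t : ℝ} (ht : t ∈ Ioo a c) (x : ℝ) :
    |eulerU b L m g t x| ≤ Real.exp (|1 - b| * R) * ∫ η, |m η| ∧
      |eulerV b L m g t x| ≤ Real.exp (|1 - b| * R) * ∫ η, |m η| :=
  abs_lagU_lagV_le h.smooth.continuous h.supp (h.continuous_g ht) (h.bounded t ht) _

/-- The nonlocal term is never computed from its integral. The left-hand sides are bounded, the
second is the derivative of the first, and together they solve `α - α'' = source`, so
`eq_helmholtzInv` applies. Since `lagA` and `lagB` are the time derivatives of velocity and slope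
along trajectories, the second identity is the equation and the first one the Riccati law. -/
theorem helmholtz_source (h : IsLagrangianSolution b L R a c m g) {t : ℝ} (ht : t ∈ Ioo a c)
    (x : ℝ) :
    b / 2 * eulerU b L m g t x ^ 2 + (1 - b) / 2 * eulerV b L m g t x ^ 2 -
        lagB b L m (g t) (label b L m g t x) =
      helmholtzInv (source b (eulerU b L m g t) (eulerV b L m g t)) x ∧
    -lagA b L m (g t) (label b L m g t x) =
      helmholtzDeriv (source b (eulerU b L m g t) (eulerV b L m g t)) x := by
  have hm := h.smooth.continuous
  have hg := h.continuous_g ht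
  have cU := continuous_section_right (h.jointSmooth_eulerU 0).continuousOn ht
  have cV := continuous_section_right (h.jointSmooth_eulerV 0).continuousOn ht
  obtain ⟨N, hN⟩ := exists_bound_lagA_lagB (b := b) hm h.supp hg (h.bounded t ht)
  set M := Real.exp (|1 - b| * R) * ∫ η, |m η| with hM
  have hMb := h.bounded_euler ht
  have hsrc : ∀ x, |source b (eulerU b L m g t) (eulerV b L m g t) x| ≤ (|b| + |3 - b|) * M ^ 2 :=
    fun x => abs_source_le (hMb x).1 (hMb x).2
  have hα : ∀ x, HasDerivAt (fun x => b / 2 * eulerU b L m g t x ^ 2 +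
      (1 - b) / 2 * eulerV b L m g t x ^ 2 - lagB b L m (g t) (label b L m g t x))
      (-lagA b L m (g t) (label b L m g t x)) x := fun x => by
    have dB : HasDerivAt (fun x => lagB b L m (g t) (label b L m g t x))
        (lagA b L m (g t) (label b L m g t x) + eulerU b L m g t x * eulerV b L m g t x -
          (1 - b) * eulerV b L m g t x * momentum b L m g t x) x := by
      refine h.hasDerivAt_comp_label ht ((hasDerivAt_lagB hm hg _).congr_deriv ?_)
      rw [density_eq, eulerU, eulerV]; ring
    refine (((((h.hasDerivAt_eulerU ht x).fun_pow 2).const_mul (b / 2)).fun_add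
      (((h.hasDerivAt_eulerV ht x).fun_pow 2).const_mul ((1 - b) / 2))).fun_sub dB).congr_deriv ?_
    push_cast; ring
  have hβ : ∀ x, HasDerivAt (fun x => -lagA b L m (g t) (label b L m g t x))
      (b / 2 * eulerU b L m g t x ^ 2 + (1 - b) / 2 * eulerV b L m g t x ^ 2 -
        lagB b L m (g t) (label b L m g t x) -
          source b (eulerU b L m g t) (eulerV b L m g t) x) x := fun x => by
    have dA : HasDerivAt (fun x => lagA b L m (g t) (label b L m g t x))
        (lagB b L m (g t) (label b L m g t x) + eulerV b L m g t x ^ 2) x :=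
      h.hasDerivAt_comp_label ht (hasDerivAt_lagA hm hg _)
    refine dA.fun_neg.congr_deriv ?_
    rw [source]; ring
  have hαb : ∀ x, |b / 2 * eulerU b L m g t x ^ 2 + (1 - b) / 2 * eulerV b L m g t x ^ 2 -
      lagB b L m (g t) (label b L m g t x)| ≤ (|b| + |3 - b|) * M ^ 2 + M ^ 2 + N := fun x => by
    have e : b / 2 * eulerU b L m g t x ^ 2 + (1 - b) / 2 * eulerV b L m g t x ^ 2 -
        lagB b L m (g t) (label b L m g t x) = source b (eulerU b L m g t) (eulerV b L m g t) x -
        eulerV b L m g t x ^ 2 - lagB b L m (g t) (label b L m g t x) := by rw [source]; ring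
    have s1 := hsrc x
    have s2 := (hN (label b L m g t x)).2
    have s3 : eulerV b L m g t x ^ 2 ≤ M ^ 2 := by
      rw [← sq_abs]; have := (hMb x).2; gcongr
    have s4 := sq_nonneg (eulerV b L m g t x)
    rw [e]
    rw [abs_le] at s1 s2 ⊢
    constructor <;> linarith [s1.1, s1.2, s2.1, s2.2]
  refine eq_helmholtzInv (f := source b (eulerU b L m g t) (eulerV b L m g t))
    (by unfold source; fun_prop) hsrc hα hβ hαb (fun x => ?_) x
  rw [abs_neg]
  have : 0 ≤ (|b| + |3 - b|) * M ^ 2 + M ^ 2 := by positivity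
  linarith [(hN (label b L m g t x)).1]

/-- The slope along a trajectory satisfies a Riccati equation. -/
theorem hasDerivAt_slope (h : IsLagrangianSolution b L R a c m g) {t : ℝ} (ht : t ∈ Ioo a c)
    (ξ : ℝ) : HasDerivAt (fun τ => lagV b L m (g τ) ξ)
      ((1 - b) / 2 * lagV b L m (g t) ξ ^ 2 + b / 2 * lagU b L m (g t) ξ ^ 2 -
        helmholtzInv (source b (eulerU b L m g t) (eulerV b L m g t)) (position b L m g t ξ)) t := by
  refine (h.hasDerivAt_lagV_t ht ξ).congr_deriv ?_
  rw [← (h.helmholtz_source ht _).1, eulerU, eulerV, h.label_position ht]; ring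

/-- The time derivative at a fixed point is the derivative along the trajectory minus the transport
part. The inverse flow is thus never differentiated in time. -/
theorem hasDerivAt_eulerU_t (h : IsLagrangianSolution b L R a c m g) {t : ℝ} (ht : t ∈ Ioo a c)
    (x : ℝ) : HasDerivAt (fun τ => eulerU b L m g τ x)
      (-(eulerU b L m g t x * eulerV b L m g t x) -
        helmholtzDeriv (source b (eulerU b L m g t) (eulerV b L m g t)) x) t := by
  set ξ := label b L m g t x with hξ
  have hx : position b L m g t ξ = x := h.position_label ht x
  have h1 := hasDerivAt_along_curve (f := eulerU b L m g) (f' := eulerV b L m g)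
    (Y := fun τ => position b L m g τ ξ) (s := t)
    (by filter_upwards [isOpen_Ioo.mem_nhds ht] with τ hτ using fun x => h.hasDerivAt_eulerU hτ x)
    ((h.jointSmooth_eulerV 0).continuousOn.continuousAt
      ((isOpen_Ioo.prod isOpen_univ).mem_nhds ⟨ht, mem_univ _⟩))
    (h.hasDerivAt_position_t ht ξ)
  have h2 := (h.hasDerivAt_lagU_t ht ξ).fun_sub h1
  have h3 : HasDerivAt (fun τ => eulerU b L m g τ x) (lagA b L m (g t) ξ -
      eulerV b L m g t (position b L m g t ξ) * lagU b L m (g t) ξ) t := by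
    refine h2.congr_of_eventuallyEq ?_
    filter_upwards [isOpen_Ioo.mem_nhds ht] with τ hτ
    rw [hx, show eulerU b L m g τ (position b L m g τ ξ) = lagU b L m (g τ) ξ by
      rw [eulerU, h.label_position hτ]]
    ring
  refine h3.congr_deriv ?_
  rw [← (h.helmholtz_source ht x).2, hx]
  simp only [eulerU, eulerV, ← hξ]; ring

theorem eulerU_eq_helmholtzInv (h : IsLagrangianSolution b L R a c m g) {t : ℝ} (ht : t ∈ Ioo a c)
    (x : ℝ) : eulerU b L m g t x = helmholtzInv (momentum b L m g t) x ∧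
      eulerV b L m g t x = helmholtzDeriv (momentum b L m g t) x := by
  have hsupp : HasCompactSupport m :=
    HasCompactSupport.intro (isCompact_Icc (a := -L) (b := L)) fun x hx => h.supp x (by
      by_contra! hlt
      exact hx ⟨(abs_lt.1 hlt).1.le, (abs_lt.1 hlt).2.le⟩)
  obtain ⟨K, hK⟩ := hsupp.exists_bound_of_continuous h.smooth.continuous
  refine eq_helmholtzInv
    (continuous_section_right (h.jointSmooth_momentum 0).continuousOn ht)
    (M := K * Real.exp (|-b| * R)) (fun x => ?_) (h.hasDerivAt_eulerU ht) (h.hasDerivAt_eulerV ht)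
    (fun x => (h.bounded_euler ht x).1) (fun x => (h.bounded_euler ht x).2) x
  rw [momentum, abs_mul, Real.abs_exp]
  exact mul_le_mul (hK _) (exp_mul_le (h.bounded t ht _)) (Real.exp_pos _).le
    ((norm_nonneg _).trans (hK 0))

theorem momentum_zero (h : IsLagrangianSolution b L R a c m g) (x : ℝ) :
    momentum b L m g 0 x = m x := by
  have hp : ∀ ξ, position b L m g 0 ξ = ξ := fun ξ => by
    simp [position, flowMap, h.initial]
  have : label b L m g 0 x = x := by
    conv_lhs => rw [← hp x]
    exact h.label_position h.zero_mem x
  rw [momentum, this, h.initial]; simp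

/-- A bound for the momentum and its support in terms of the size of the stretching. -/
theorem momentum_bound (h : IsLagrangianSolution b L R a c m g) {t r K : ℝ} (ht : t ∈ Ioo a c)
    (hr : ∀ ξ, |g t ξ| ≤ r) (hK : ∀ x, |m x| ≤ K) (x : ℝ) :
    |momentum b L m g t x| ≤ K * Real.exp (|b| * r) ∧
      (x ∉ Icc (position b L m g t (-L)) (position b L m g t L) → momentum b L m g t x = 0) := by
  constructor
  · rw [momentum, abs_mul, Real.abs_exp, ← abs_neg b]
    exact mul_le_mul (hK _) (exp_mul_le (hr _)) (Real.exp_pos _).le ((abs_nonneg _).trans (hK 0))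
  · intro hx
    rw [momentum, h.supp _ ?_, zero_mul]
    by_contra! hlt
    have hmono : Monotone (position b L m g t) := fun p q hpq => by
      simp only [position]; linarith [monotone_flowMap (h.continuous_g ht) hpq]
    apply hx
    rw [← h.position_label ht x]
    exact ⟨hmono (abs_lt.1 hlt).1.le, hmono (abs_lt.1 hlt).2.le⟩

theorem position_width (h : IsLagrangianSolution b L R a c m g) {t r : ℝ} (ht : t ∈ Ioo a c)
    (hL : 0 ≤ L) (hr : ∀ ξ, |g t ξ| ≤ r) :
    position b L m g t L - position b L m g t (-L) ≤ 2 * L * Real.exp r := by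
  have := flowMap_sub_le (h.continuous_g ht) hr (show -L ≤ L by linarith)
  simp only [position]
  linarith

/-- The supports of the momenta lie in a common compact interval. -/
theorem exists_momentum_support (h : IsLagrangianSolution b L R a c m g) (hL : 0 ≤ L) :
    ∃ Λ : ℝ, 0 ≤ Λ ∧ ∀ t ∈ Ioo a c, ∀ x, Λ ≤ |x| → momentum b L m g t x = 0 := by
  set N := Real.exp (|1 - b| * R) * ∫ η, |m η| with hN
  have hN0 : 0 ≤ N := mul_nonneg (Real.exp_pos _).le (integral_nonneg fun _ => abs_nonneg _)
  refine ⟨N * (|a| + |c|) + Real.exp R * L, by positivity, fun t ht x hx => ?_⟩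
  rw [momentum, h.supp _ ?_, zero_mul]
  by_contra! hlt
  set ξ := label b L m g t x with hξ
  have e : x = position b L m g t ξ := (h.position_label ht x).symm
  have h1 : ‖∫ s in (0 : ℝ)..t, lagU b L m (g s) 0‖ ≤ N * |t - 0| :=
    intervalIntegral.norm_integral_le_of_norm_le_const fun s hs =>
      have hs' := h.uIcc_subset ht (uIoc_subset_uIcc hs)
      (abs_lagU_lagV_le h.smooth.continuous h.supp (h.continuous_g hs') (h.bounded s hs') 0).1
  have ht' : |t - 0| ≤ |a| + |c| := by
    rw [sub_zero, abs_le]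
    constructor
    · linarith [ht.1, neg_abs_le a, abs_nonneg c]
    · linarith [ht.2, le_abs_self c, abs_nonneg a]
  have h2 : |flowMap (g t) ξ| < Real.exp R * L := by
    have f0 : flowMap (g t) 0 = 0 := by simp [flowMap]
    have hmono := monotone_flowMap (h.continuous_g ht)
    rcases le_total 0 ξ with hle | hle
    · have := flowMap_sub_le (h.continuous_g ht) (h.bounded t ht) hle
      rw [abs_of_nonneg (by rw [← f0]; exact hmono hle)]
      have : Real.exp R * ξ < Real.exp R * L :=
        mul_lt_mul_of_pos_left (abs_lt.1 hlt).2 (Real.exp_pos _)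
      linarith
    · have := flowMap_sub_le (h.continuous_g ht) (h.bounded t ht) hle
      rw [abs_of_nonpos (by rw [← f0]; exact hmono hle)]
      have : Real.exp R * (0 - ξ) < Real.exp R * L :=
        mul_lt_mul_of_pos_left (by linarith [(abs_lt.1 hlt).1]) (Real.exp_pos _)
      linarith
  have h3 : |x| < N * (|a| + |c|) + Real.exp R * L := by
    rw [e, position]
    refine (abs_add_le _ _).trans_lt (add_lt_add_of_le_of_lt (h1.trans ?_) h2)
    gcongr
  linarith

theorem isSmoothSolution (h : IsLagrangianSolution b L R a c m g) :
    IsSmoothSolution b c (helmholtzInv m) (eulerU b L m g) where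
  smooth := by
    have hsub : Ico 0 c ⊆ Ioo a c := fun t ht => ⟨h.zero_mem.1.trans_le ht.1, ht.2⟩
    exact ⟨fun t ht => JointSmooth.contDiff_infty h.jointSmooth_eulerU (hsub ht),
      fun k => (h.jointSmooth_eulerU k).continuousOn_iteratedDeriv.mono
        (prod_mono hsub subset_rfl)⟩
  bounded T' hT' := by
    refine ⟨Real.exp (|1 - b| * R) * ∫ η, |m η|, fun t ht x => ?_⟩
    have ht' : t ∈ Ioo a c := ⟨h.zero_mem.1.trans_le ht.1, ht.2.trans_lt hT'⟩
    rw [h.deriv_eulerU ht']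
    exact h.bounded_euler ht' x
  initial := funext fun x => by
    rw [(h.eulerU_eq_helmholtzInv h.zero_mem x).1, funext h.momentum_zero]
  equation t ht x := by
    have ht' : t ∈ Ioo a c := ⟨h.zero_mem.1.trans ht.1, ht.2⟩
    have cU := continuous_section_right (h.jointSmooth_eulerU 0).continuousOn ht'
    have cV := continuous_section_right (h.jointSmooth_eulerV 0).continuousOn ht'
    have hsrc : ∀ x, |source b (eulerU b L m g t) (eulerV b L m g t) x| ≤ _ :=
      fun x => abs_source_le (h.bounded_euler ht' x).1 (h.bounded_euler ht' x).2
    have := h.hasDerivAt_eulerU_t ht' x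
    rw [← (hasDerivAt_helmholtzInv (by unfold source; fun_prop) hsrc x).deriv] at this
    rw [h.deriv_eulerU ht']
    exact this

/-- The second derivative `u - momentum` is bounded, because the momentum is the transported initial
one times a bounded factor. -/
theorem unique (h : IsLagrangianSolution b L R a c m g) {v : ℝ → ℝ → ℝ}
    (hv : IsSmoothSolution b c (helmholtzInv m) v) : ∀ t ∈ Ico 0 c, v t = eulerU b L m g t := by
  refine h.isSmoothSolution.eq_of_bounded_deriv2 hv fun T' hT' => ?_
  have hsupp : HasCompactSupport m :=
    HasCompactSupport.intro (isCompact_Icc (a := -L) (b := L)) fun x hx => h.supp x (by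
      by_contra! hlt
      exact hx ⟨(abs_lt.1 hlt).1.le, (abs_lt.1 hlt).2.le⟩)
  obtain ⟨K, hK⟩ := hsupp.exists_bound_of_continuous h.smooth.continuous
  refine ⟨(Real.exp (|1 - b| * R) * ∫ η, |m η|) + K * Real.exp (|b| * R), fun t ht x => ?_⟩
  have ht' : t ∈ Ioo a c := ⟨h.zero_mem.1.trans_le ht.1, ht.2.trans_lt hT'⟩
  rw [h.deriv_eulerU ht', (h.hasDerivAt_eulerV ht' x).deriv]
  exact (abs_sub _ _).trans (add_le_add (h.bounded_euler ht' x).1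
    (h.momentum_bound ht' (h.bounded t ht') hK x).1)

end IsLagrangianSolution

end BEquation

namespace BEquation

open scoped SchwartzMap

/-! ### Velocities of compactly supported momenta are Schwartz functions -/

/-- The kernel `p'` equals `p` up to sign. -/
theorem abs_helmholtzDeriv_le_helmholtzInv_abs {f : ℝ → ℝ} (hf : Continuous f) {M : ℝ}
    (hM : ∀ x, |f x| ≤ M) (x : ℝ) : |helmholtzDeriv f x| ≤ helmholtzInv (fun y => |f y|) x := by
  have hM' : ∀ x, |(|f x|)| ≤ M := fun x => by rw [abs_abs]; exact hM x
  have key : ∀ e : ℝ → ℝ, |∫ z in Ioi (0 : ℝ), Real.exp (-z) * f (e z)| ≤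
      ∫ z in Ioi (0 : ℝ), Real.exp (-z) * |f (e z)| := fun e => by
    refine (norm_integral_le_integral_norm (fun z => Real.exp (-z) * f (e z))).trans (le_of_eq ?_)
    congr 1; ext z
    rw [norm_mul, Real.norm_eq_abs, Real.abs_exp, Real.norm_eq_abs]
  have h1 : |laplaceRight f x| ≤ laplaceRight (fun y => |f y|) x := key _
  have h2 : |laplaceLeft f x| ≤ laplaceLeft (fun y => |f y|) x := key _
  rw [helmholtzInv_eq hf.abs hM', helmholtzDeriv]
  rw [abs_le] at h1 h2 ⊢
  constructor <;> linarith [h1.1, h1.2, h2.1, h2.2]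

/-- For `|y| < Λ` one has `e^{-|x-y|} ≤ e^{Λ - |x|}`. -/
theorem abs_helmholtzInv_le_exp {f : ℝ → ℝ} {Λ : ℝ} (hf : Continuous f)
    (hΛ : ∀ x, Λ ≤ |x| → f x = 0) (x : ℝ) :
    |helmholtzInv f x| ≤ Real.exp Λ * (∫ y, |f y|) * Real.exp (-|x|) := by
  have hi := integrable_of_support hf hΛ
  have h1 : ‖helmholtzInv f x‖ ≤ ∫ y, (Real.exp Λ * Real.exp (-|x|)) * |f y| := by
    refine norm_integral_le_of_norm_le (hi.abs.const_mul _) (ae_of_all _ fun y => ?_)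
    by_cases hy : Λ ≤ |y|
    · simp [hΛ y hy]
    · rw [norm_mul, norm_mul, Real.norm_eq_abs (f y), Real.norm_eq_abs (Real.exp _), Real.abs_exp]
      refine mul_le_mul_of_nonneg_right ?_ (abs_nonneg _)
      rw [← Real.exp_add]
      have h2 : Real.exp (-|x - y|) ≤ Real.exp (Λ + -|x|) := by
        apply Real.exp_le_exp.2
        have := abs_sub_abs_le_abs_sub x y
        linarith
      have h3 := (Real.exp_pos (-|x - y|)).le
      norm_num
      linarith
  rw [integral_const_mul] at h1
  rw [Real.norm_eq_abs] at h1
  linarith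

theorem pow_mul_exp_neg_le (k : ℕ) (x : ℝ) : |x| ^ k * Real.exp (-|x|) ≤ k.factorial := by
  have h := Real.pow_div_factorial_le_exp |x| (abs_nonneg x) k
  rw [div_le_iff₀ (by positivity)] at h
  calc |x| ^ k * Real.exp (-|x|) ≤ (Real.exp |x| * k.factorial) * Real.exp (-|x|) := by gcongr
    _ = (Real.exp |x| * Real.exp (-|x|)) * k.factorial := by ring
    _ = _ := by rw [← Real.exp_add]; simp

/-- Both `u` and `v` decay like `e^{-|x|}`. The system `u' = v`, `v' = u - f` expresses every higher
derivative through these two and derivatives of the compactly supported `f`. -/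
theorem exists_schwartzMap {u v f : ℝ → ℝ} {Λ : ℝ} (hf : ContDiff ℝ ∞ f)
    (hΛ : ∀ x, Λ ≤ |x| → f x = 0) (hu : ∀ x, u x = helmholtzInv f x)
    (hv : ∀ x, v x = helmholtzDeriv f x) (hd : ∀ x, HasDerivAt u (v x) x)
    (hdd : ∀ x, HasDerivAt v (u x - f x) x) (hus : ContDiff ℝ ∞ u) :
    ∃ F : 𝓢(ℝ, ℂ), ∀ x, F x = (u x : ℂ) := by
  have hcs : HasCompactSupport f :=
    HasCompactSupport.intro (isCompact_Icc (a := -Λ) (b := Λ)) fun x hx => hΛ x (by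
      by_contra! hlt
      exact hx ⟨(abs_lt.1 hlt).1.le, (abs_lt.1 hlt).2.le⟩)
  obtain ⟨M, hM⟩ := hcs.exists_bound_of_continuous hf.continuous
  have hexp : ∀ (w : ℝ → ℝ) (C : ℝ), (∀ x, |w x| ≤ C * Real.exp (-|x|)) →
      ∀ k : ℕ, ∃ C, ∀ x, |x| ^ k * |w x| ≤ C := fun w C hw k => by
    refine ⟨C * k.factorial, fun x => ?_⟩
    have hC : 0 ≤ C := by
      have := (abs_nonneg _).trans (hw 0)
      simpa using this
    calc |x| ^ k * |w x| ≤ |x| ^ k * (C * Real.exp (-|x|)) := by gcongr; exact hw x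
      _ = C * (|x| ^ k * Real.exp (-|x|)) := by ring
      _ ≤ _ := by gcongr; exact pow_mul_exp_neg_le k x
  have du : deriv u = v := funext fun x => (hd x).deriv
  have dv : deriv v = fun x => u x - f x := funext fun x => (hdd x).deriv
  have hfd : ∀ n k : ℕ, ∃ C, ∀ x, |x| ^ k * |iteratedDeriv n f x| ≤ C := fun n k => by
    obtain ⟨C, -, hC⟩ := (hcs.toSchwartzMap hf).decay k n
    refine ⟨C, fun x => ?_⟩
    have := hC x
    rw [norm_iteratedFDeriv_eq_norm_iteratedDeriv] at this
    exact this
  have key : ∀ n k : ℕ, (∃ C, ∀ x, |x| ^ k * |iteratedDeriv n u x| ≤ C) ∧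
      ∃ C, ∀ x, |x| ^ k * |iteratedDeriv n v x| ≤ C := by
    intro n
    induction n with
    | zero =>
      intro k
      simp only [iteratedDeriv_zero]
      refine ⟨hexp u (Real.exp Λ * (∫ y, |f y|)) (fun x => ?_) k,
        hexp v (Real.exp Λ * (∫ y, |(|f y|)|)) (fun x => ?_) k⟩
      · rw [hu]; exact abs_helmholtzInv_le_exp hf.continuous hΛ x
      · rw [hv]
        refine (abs_helmholtzDeriv_le_helmholtzInv_abs hf.continuous hM x).trans
          ((le_abs_self _).trans (abs_helmholtzInv_le_exp hf.continuous.abs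
            (fun x hx => by rw [hΛ x hx, abs_zero]) x))
    | succ n ih =>
      intro k
      refine ⟨?_, ?_⟩
      · rw [iteratedDeriv_succ', du]; exact (ih k).2
      · obtain ⟨C₁, h₁⟩ := (ih k).1
        obtain ⟨C₂, h₂⟩ := hfd n k
        refine ⟨C₁ + C₂, fun x => ?_⟩
        have e : iteratedDeriv (n + 1) v x = iteratedDeriv n u x - iteratedDeriv n f x := by
          rw [iteratedDeriv_succ', dv]
          exact iteratedDeriv_fun_sub (hus.contDiffAt.of_le (mod_cast le_top))
            (hf.contDiffAt.of_le (mod_cast le_top))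
        rw [e]
        calc |x| ^ k * |iteratedDeriv n u x - iteratedDeriv n f x|
            ≤ |x| ^ k * (|iteratedDeriv n u x| + |iteratedDeriv n f x|) := by
              gcongr; exact abs_sub _ _
          _ ≤ _ := by rw [mul_add]; exact add_le_add (h₁ x) (h₂ x)
  let S : 𝓢(ℝ, ℝ) :=
    { toFun := u
      smooth' := hus
      decay' := fun k n => by
        obtain ⟨C, hC⟩ := (key n k).1
        refine ⟨C, fun x => ?_⟩
        rw [norm_iteratedFDeriv_eq_norm_iteratedDeriv]
        exact hC x }
  refine ⟨SchwartzMap.postcompCLM Complex.ofRealCLM S, fun x => ?_⟩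
  rfl

/-! ### Fourier analysis of Schwartz functions -/

theorem schwartz_eLpNorm_ne_top (F : 𝓢(ℝ, ℂ)) : eLpNorm F 2 volume ≠ ⊤ :=
  (F.memLp 2 volume).eLpNorm_lt_top.ne

theorem schwartz_eLpNorm_fourier (F : 𝓢(ℝ, ℂ)) :
    eLpNorm (⇑(𝓕 F : 𝓢(ℝ, ℂ))) 2 volume = eLpNorm F 2 volume := by
  have h := SchwartzMap.norm_fourier_toL2_eq F
  rw [SchwartzMap.norm_toLp, SchwartzMap.norm_toLp] at h
  rwa [ENNReal.toReal_eq_toReal_iff' (schwartz_eLpNorm_ne_top _) (schwartz_eLpNorm_ne_top _)] at h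

theorem eLpNorm_two_sq {f : ℝ → ℂ} : eLpNorm f 2 volume ^ 2 = ∫⁻ x, ‖f x‖ₑ ^ 2 := by
  have := eLpNorm_nnreal_pow_eq_lintegral (f := f) (μ := volume) (p := 2) (by norm_num)
  simpa using this

theorem lintegral_sq_fourier (F : 𝓢(ℝ, ℂ)) :
    ∫⁻ η, ‖(𝓕 F) η‖ₑ ^ 2 = ∫⁻ x, ‖F x‖ₑ ^ 2 := by
  rw [← eLpNorm_two_sq, ← eLpNorm_two_sq, schwartz_eLpNorm_fourier]

theorem enorm_le_lintegral_fourier (F : 𝓢(ℝ, ℂ)) (x : ℝ) :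
    ‖F x‖ₑ ≤ ∫⁻ η, ‖(𝓕 F) η‖ₑ := by
  have h : F x = 𝓕⁻ (𝓕 F) x := by rw [FourierTransform.fourierInv_fourier_eq]
  rw [h, SchwartzMap.fourierInv_coe, Real.fourierInv_eq']
  refine (enorm_integral_le_lintegral_enorm _).trans (le_of_eq ?_)
  congr 1; ext η
  rw [enorm_smul, ← ofReal_norm, Complex.norm_exp_ofReal_mul_I]
  simp

theorem fourier_of_deriv {F G : 𝓢(ℝ, ℂ)} (h : ∀ x, HasDerivAt F (G x) x) (η : ℝ) :
    (𝓕 G) η = (2 * Real.pi * η * Complex.I) * (𝓕 F) η := by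
  have hd : deriv F = G := funext fun x => (h x).deriv
  have := Real.fourier_deriv F.integrable F.differentiable (by rw [hd]; exact G.integrable)
  rw [hd] at this
  have h2 := congrFun this η
  rw [SchwartzMap.fourier_coe, SchwartzMap.fourier_coe, h2, smul_eq_mul]
  ring

theorem enorm_fourier_of_deriv {F G : 𝓢(ℝ, ℂ)} (h : ∀ x, HasDerivAt F (G x) x) (η : ℝ) :
    ‖(𝓕 G) η‖ₑ = ENNReal.ofReal |2 * Real.pi * η| * ‖(𝓕 F) η‖ₑ := by
  rw [fourier_of_deriv h, enorm_mul]
  congr 1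
  rw [← ofReal_norm, norm_mul, Complex.norm_I, mul_one]
  congr 1
  rw [← Real.norm_eq_abs, ← Complex.norm_real]
  push_cast; rfl

/-- The Fourier transform of `m = u - uₓₓ`. -/
theorem fourier_momentum {F G H : 𝓢(ℝ, ℂ)} (h : ∀ x, HasDerivAt F (G x) x)
    (h' : ∀ x, HasDerivAt G (F x - H x) x) (η : ℝ) :
    (𝓕 H) η = ((1 + (2 * Real.pi * η) ^ 2 : ℝ) : ℂ) * (𝓕 F) η := by
  have e1 := fourier_of_deriv (G := F - H) (F := G) h' η
  rw [fourier_of_deriv h] at e1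
  have e0 : (𝓕 F) η = (𝓕 (F - H)) η + (𝓕 H) η := by
    rw [← add_apply, ← FourierTransform.fourier_add, sub_add_cancel]
  push_cast
  linear_combination (-1 : ℂ) * e0 + (-1 : ℂ) * e1 + (-(2 * Real.pi * η) ^ 2 * (𝓕 F) η) * Complex.I_sq

theorem enorm_fourier_momentum {F G H : 𝓢(ℝ, ℂ)} (h : ∀ x, HasDerivAt F (G x) x)
    (h' : ∀ x, HasDerivAt G (F x - H x) x) (η : ℝ) :
    ‖(𝓕 H) η‖ₑ = ENNReal.ofReal (1 + (2 * Real.pi * η) ^ 2) * ‖(𝓕 F) η‖ₑ := by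
  rw [fourier_momentum h h', enorm_mul]
  congr 1
  rw [← ofReal_norm, Complex.norm_real, Real.norm_eq_abs, abs_of_nonneg (by positivity)]

end BEquation

/-! ### Littlewood–Paley blocks as Fourier multipliers -/

namespace LittlewoodPaleyPair

open BEquation
open scoped SchwartzMap

/-- The multipliers of a Littlewood–Paley pair, as one sequence. -/
noncomputable def psi (P : LittlewoodPaleyPair) : ℕ → ℝ → ℝ
  | 0, ξ => P.chi ξ
  | j + 1, ξ => P.phi (ξ / 2 ^ j)

variable (P : LittlewoodPaleyPair)

theorem psi_smooth (j : ℕ) : ContDiff ℝ ∞ (P.psi j) := by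
  cases j with
  | zero => exact P.chi_smooth
  | succ j => exact P.phi_smooth.comp (by fun_prop)

theorem psi_mem (j : ℕ) (ξ : ℝ) : P.psi j ξ ∈ Icc (0 : ℝ) 1 := by
  cases j with
  | zero => exact P.chi_mem ξ
  | succ j => exact P.phi_mem _

theorem psi_supp_le {j : ℕ} {ξ : ℝ} (h : P.psi j ξ ≠ 0) : |ξ| ≤ 4 / 3 * 2 ^ j := by
  cases j with
  | zero => simpa using P.chi_supp ξ h
  | succ j =>
    have h1 := (P.phi_supp _ h).2
    rw [abs_div, abs_of_pos (by positivity : (0 : ℝ) < 2 ^ j), div_le_iff₀ (by positivity)] at h1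
    rw [pow_succ]; linarith

theorem le_psi_supp {j : ℕ} {ξ : ℝ} (h : P.psi (j + 1) ξ ≠ 0) : 3 / 4 * 2 ^ j ≤ |ξ| := by
  have h1 := (P.phi_supp _ h).1
  rwa [abs_div, abs_of_pos (by positivity : (0 : ℝ) < 2 ^ j), le_div_iff₀ (by positivity)] at h1

theorem hasSum_psi (ξ : ℝ) : HasSum (fun j => P.psi j ξ) 1 := by
  have h : HasSum (fun j => P.psi (j + 1) ξ) (1 - P.chi ξ) := P.partition ξ
  have := (hasSum_nat_add_iff (f := fun j => P.psi j ξ) 1).1 h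
  simpa [psi] using this

theorem tsum_psi (ξ : ℝ) : ∑' j, ENNReal.ofReal (P.psi j ξ) = 1 := by
  rw [← ENNReal.ofReal_tsum_of_nonneg (fun j => (P.psi_mem j ξ).1) (P.hasSum_psi ξ).summable,
    (P.hasSum_psi ξ).tsum_eq, ENNReal.ofReal_one]

/-- At every frequency at most three consecutive multipliers do not vanish. -/
theorem exists_psi_support (ξ : ℝ) : ∃ n : ℕ, ∀ j, P.psi j ξ ≠ 0 → j ∈ Finset.Icc n (n + 2) := by
  have two_pow : ∀ a b : ℕ, (2 : ℝ) ^ a < 2 ^ b → a < b := fun a b h =>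
    (pow_lt_pow_iff_right₀ (by norm_num)).1 h
  rcases lt_or_ge |ξ| 1 with h1 | h1
  · refine ⟨0, fun j hj => ?_⟩
    rw [Finset.mem_Icc]
    refine ⟨Nat.zero_le _, ?_⟩
    cases j with
    | zero => omega
    | succ j =>
      have := P.le_psi_supp hj
      have : j < 1 := two_pow _ _ (by norm_num; linarith)
      omega
  · obtain ⟨n, hn1, hn2⟩ := exists_nat_pow_near h1 (by norm_num : (1 : ℝ) < 2)
    refine ⟨n, fun j hj => ?_⟩
    rw [Finset.mem_Icc]
    constructor
    · have := P.psi_supp_le hj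
      have : n < j + 1 := two_pow _ _ (by
        have : (0 : ℝ) < 2 ^ j := by positivity
        rw [pow_succ]; linarith)
      omega
    · cases j with
      | zero => omega
      | succ j =>
        have := P.le_psi_supp hj
        have : j < n + 2 := two_pow _ _ (by
          have : (0 : ℝ) < 2 ^ n := by positivity
          rw [pow_succ] at hn2
          rw [pow_succ, pow_succ]; linarith)
        omega

/-- Cauchy–Schwarz for a sum equal to `1` with at most three nonzero terms. -/
theorem one_le_three_mul_tsum_psi_sq (ξ : ℝ) :
    1 ≤ 3 * ∑' j, ENNReal.ofReal (P.psi j ξ ^ 2) := by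
  obtain ⟨n, hn⟩ := P.exists_psi_support ξ
  have h1 : ∑ j ∈ Finset.Icc n (n + 2), P.psi j ξ = 1 := by
    rw [← (P.hasSum_psi ξ).tsum_eq]
    exact (tsum_eq_sum fun j hj => by by_contra h; exact hj (hn j h)).symm
  have h2 := sq_sum_le_card_mul_sum_sq (s := Finset.Icc n (n + 2)) (f := fun j => P.psi j ξ)
  rw [h1] at h2
  simp only [one_pow, Nat.card_Icc] at h2
  have h3 : (1 : ℝ) ≤ 3 * ∑ j ∈ Finset.Icc n (n + 2), P.psi j ξ ^ 2 := by
    rw [show n + 2 + 1 - n = 3 by omega] at h2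
    exact_mod_cast h2
  calc (1 : ℝ≥0∞) = ENNReal.ofReal 1 := ENNReal.ofReal_one.symm
    _ ≤ ENNReal.ofReal (3 * ∑ j ∈ Finset.Icc n (n + 2), P.psi j ξ ^ 2) := ENNReal.ofReal_le_ofReal h3
    _ = 3 * ∑ j ∈ Finset.Icc n (n + 2), ENNReal.ofReal (P.psi j ξ ^ 2) := by
      rw [ENNReal.ofReal_mul (by norm_num), ENNReal.ofReal_sum_of_nonneg fun _ _ => sq_nonneg _]
      norm_num
    _ ≤ _ := by gcongr; exact ENNReal.sum_le_tsum _

/-- The multiplier `ψ_j(2πη)` as a Schwartz function. -/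
theorem exists_multiplier (j : ℕ) : ∃ Ψ : 𝓢(ℝ, ℂ), ∀ η, Ψ η = (P.psi j (2 * Real.pi * η) : ℂ) := by
  have hs : ContDiff ℝ ∞ fun η : ℝ => (P.psi j (2 * Real.pi * η) : ℂ) :=
    Complex.ofRealCLM.contDiff.comp ((P.psi_smooth j).comp (by fun_prop))
  have hc : HasCompactSupport fun η : ℝ => (P.psi j (2 * Real.pi * η) : ℂ) := by
    refine HasCompactSupport.intro (isCompact_Icc (a := -(4 / 3 * 2 ^ j)) (b := 4 / 3 * 2 ^ j))
      fun η hη => ?_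
    by_contra h
    apply hη
    have h1 := P.psi_supp_le (j := j) (ξ := 2 * Real.pi * η) (by simpa using h)
    rw [abs_mul, abs_of_pos (by positivity : 0 < 2 * Real.pi)] at h1
    refine abs_le.1 ?_
    have : 1 * |η| ≤ 2 * Real.pi * |η| := by
      gcongr; linarith [Real.pi_gt_three]
    linarith
  exact ⟨hc.toSchwartzMap hs, fun η => rfl⟩

/-- The substitution `ξ = 2πη / s` reconciles the kernel `e^{2πiηy}` with the normalization of
`invFourier`; `s = 2^j` produces the dilated kernels of the blocks. -/
theorem integral_exp_dilation (h : ℝ → ℝ) {s : ℝ} (hs : 0 < s) (y : ℝ) :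
    ∫ η : ℝ, Complex.exp (↑(2 * Real.pi * (η * y)) * Complex.I) * (h (2 * Real.pi * η / s) : ℂ) =
      s * invFourier h (s * y) := by
  have e := Measure.integral_comp_mul_left
    (fun ξ : ℝ => Complex.exp (Complex.I * ((s * y : ℝ) : ℂ) * ξ) * (h ξ : ℂ)) (2 * Real.pi / s)
  have hp : 0 < 2 * Real.pi / s := by have := Real.pi_pos; positivity
  have hpi : (Real.pi : ℂ) ≠ 0 := by exact_mod_cast Real.pi_ne_zero
  have hs' : (s : ℂ) ≠ 0 := by exact_mod_cast hs.ne'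
  rw [abs_of_pos (inv_pos.2 hp)] at e
  have e2 : ∫ η : ℝ, Complex.exp (↑(2 * Real.pi * (η * y)) * Complex.I) * (h (2 * Real.pi * η / s) : ℂ)
      = ∫ η : ℝ, Complex.exp (Complex.I * ((s * y : ℝ) : ℂ) * ((2 * Real.pi / s * η : ℝ) : ℂ)) *
        (h (2 * Real.pi / s * η) : ℂ) := by
    congr 1; ext η
    congr 2
    · push_cast; field_simp
    · congr 1; ring
  rw [e2, e, invFourier, inv_div, Complex.real_smul]
  push_cast
  field_simp

/-- The sequence `psi` starts at `0` with `χ`, whence the shift: `psi j` is the multiplier of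
`Δ_{j-1}`. -/
theorem block_eq {j : ℕ} {Ψ : 𝓢(ℝ, ℂ)} (hΨ : ∀ η, Ψ η = (P.psi j (2 * Real.pi * η) : ℂ))
    {u : ℝ → ℝ} {F : 𝓢(ℝ, ℂ)} (hF : ∀ x, F x = (u x : ℂ)) (x : ℝ) :
    P.block ((j : ℤ) - 1) u x =
      SchwartzMap.convolution (ContinuousLinearMap.mul ℂ ℂ) (𝓕⁻ Ψ) F x := by
  rw [SchwartzMap.convolution_apply, MeasureTheory.convolution]
  have hK : ∀ y, (𝓕⁻ Ψ) y = ∫ η : ℝ, Complex.exp (↑(2 * Real.pi * (η * y)) * Complex.I) *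
      (P.psi j (2 * Real.pi * η) : ℂ) := fun y => by
    rw [SchwartzMap.fourierInv_coe, Real.fourierInv_eq']
    congr 1; ext η
    rw [hΨ, smul_eq_mul]
    simp [mul_comm]
  cases j with
  | zero =>
    have e : ∀ y, (𝓕⁻ Ψ) y = invFourier P.chi y := fun y => by
      have := integral_exp_dilation P.chi one_pos y
      simp only [div_one, Complex.ofReal_one, one_mul] at this
      rw [hK, ← this]; rfl
    simp only [block, Nat.cast_zero, zero_sub]
    rw [if_neg (by norm_num), if_pos trivial]
    congr 1; ext y
    rw [e, hF]; rfl
  | succ j =>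
    have e : ∀ y, (𝓕⁻ Ψ) y = ((2 : ℝ) ^ j : ℝ) * invFourier P.phi (2 ^ j * y) := fun y => by
      rw [hK, ← integral_exp_dilation P.phi (by positivity) y]; rfl
    have e3 : ((j + 1 : ℕ) : ℤ) - 1 = j := by push_cast; ring
    rw [block, if_neg (by omega), if_neg (by omega), e3]
    congr 1; ext y
    rw [e, hF, zpow_natCast]; rfl

/-- The squared `L²` norm of the frequency localization of `F`. -/
noncomputable def blockSq (j : ℕ) (F : 𝓢(ℝ, ℂ)) : ℝ≥0∞ :=
  ∫⁻ η, ENNReal.ofReal (P.psi j (2 * Real.pi * η) ^ 2) * ‖(𝓕 F) η‖ₑ ^ 2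

theorem eLpNorm_block_sq (j : ℕ) {u : ℝ → ℝ} {F : 𝓢(ℝ, ℂ)} (hF : ∀ x, F x = (u x : ℂ)) :
    eLpNorm (P.block ((j : ℤ) - 1) u) 2 volume ^ 2 = P.blockSq j F := by
  obtain ⟨Ψ, hΨ⟩ := P.exists_multiplier j
  rw [funext (P.block_eq hΨ hF), eLpNorm_two_sq, ← lintegral_sq_fourier,
    SchwartzMap.fourier_convolution, FourierTransform.fourier_fourierInv_eq, blockSq]
  congr 1; ext η
  rw [SchwartzMap.pairing_apply_apply, ContinuousLinearMap.mul_apply', hΨ, enorm_mul, mul_pow]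
  congr 1
  rw [← ofReal_norm, Complex.norm_real, Real.norm_eq_abs, abs_of_nonneg (P.psi_mem _ _).1,
    ENNReal.ofReal_pow (P.psi_mem _ _).1]

end LittlewoodPaleyPair

namespace BEquation

open scoped SchwartzMap

/-! ### Sequence norms -/

theorem le_ellNorm {r : ℝ≥0∞} (hr : 1 < r) (a : ℤ → ℝ≥0∞) (j : ℤ) : a j ≤ ellNorm r a := by
  rw [ellNorm]
  split_ifs with h
  · exact le_iSup a j
  · have hr0 : 0 < r.toReal := ENNReal.toReal_pos (zero_lt_one.trans hr).ne' h
    calc a j = (a j ^ r.toReal) ^ (1 / r.toReal) := by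
          rw [← ENNReal.rpow_mul, mul_one_div_cancel hr0.ne', ENNReal.rpow_one]
      _ ≤ _ := ENNReal.rpow_le_rpow (ENNReal.le_tsum j) (by positivity)

theorem tsum_int_eq_tsum_nat {a : ℤ → ℝ≥0∞} (ha : ∀ j ≤ -2, a j = 0) :
    ∑' j, a j = ∑' n : ℕ, a ((n : ℤ) - 1) := by
  have hinj : Function.Injective fun n : ℕ => (n : ℤ) - 1 := fun m n h => by
    simp only at h; omega
  refine (hinj.tsum_eq (f := a) fun j hj => ?_).symm
  have : ¬ j ≤ -2 := fun h => hj (ha j h)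
  exact ⟨(j + 1).toNat, by simp only; omega⟩

theorem tsum_eq_sum_range_add_tsum (a : ℕ → ℝ≥0∞) (J : ℕ) :
    ∑' j, a j = ∑ j ∈ Finset.range J, a j + ∑' i, a (i + J) :=
  (Summable.sum_add_tsum_nat_add' (f := a) ENNReal.summable).symm

theorem ofReal_two_rpow (x : ℝ) : ENNReal.ofReal ((2 : ℝ) ^ x) = (2 : ℝ≥0∞) ^ x := by
  rw [← ENNReal.ofReal_rpow_of_pos (by norm_num)]; norm_num

theorem two_rpow_add (x y : ℝ) : (2 : ℝ≥0∞) ^ (x + y) = 2 ^ x * 2 ^ y :=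
  ENNReal.rpow_add _ _ (by norm_num) (by norm_num)

theorem two_rpow_neg_mul (x : ℝ) (a : ℝ≥0∞) : (2 : ℝ≥0∞) ^ (-x) * (2 ^ x * a) = a := by
  rw [← mul_assoc, ← two_rpow_add]; simp

theorem tsum_two_rpow_sub (c : ℝ) : ∑' j : ℕ, (2 : ℝ≥0∞) ^ (c - j) = 2 ^ (c + 1) := by
  have h : ∀ j : ℕ, (2 : ℝ≥0∞) ^ (c - j) = 2 ^ c * 2⁻¹ ^ j := fun j => by
    rw [sub_eq_add_neg, two_rpow_add, ENNReal.rpow_neg, ENNReal.rpow_natCast, ENNReal.inv_pow]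
  simp only [h]
  rw [ENNReal.tsum_mul_left, ENNReal.tsum_geometric, ENNReal.one_sub_inv_two, inv_inv, two_rpow_add,
    ENNReal.rpow_one]

theorem tsum_two_rpow_neg_half_le : ∑' j : ℕ, (2 : ℝ≥0∞) ^ (-(j : ℝ) / 2) ≤ 4 := by
  have h : ∀ j : ℕ, (2 : ℝ≥0∞) ^ (-(j : ℝ) / 2) ≤ (3 / 4) ^ j := fun j => by
    have e : (2 : ℝ≥0∞) ^ (-(j : ℝ) / 2) = (2 ^ (-1 / 2 : ℝ)) ^ j := by
      rw [← ENNReal.rpow_natCast, ← ENNReal.rpow_mul]; congr 1; ring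
    rw [e]
    gcongr
    rw [← ofReal_two_rpow, show (3 / 4 : ℝ≥0∞) = ENNReal.ofReal (3 / 4) by
      rw [ENNReal.ofReal_div_of_pos (by norm_num)]; norm_num]
    apply ENNReal.ofReal_le_ofReal
    rw [← pow_le_pow_iff_left₀ (by positivity) (by norm_num) two_ne_zero, ← Real.rpow_natCast,
      ← Real.rpow_mul (by norm_num)]
    norm_num [Real.rpow_neg_one]
  refine (ENNReal.tsum_le_tsum h).trans ?_
  rw [ENNReal.tsum_geometric]
  have e : (1 : ℝ≥0∞) - 3 / 4 = 4⁻¹ := by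
    rw [show (3 / 4 : ℝ≥0∞) = ENNReal.ofReal (3 / 4) by
      rw [ENNReal.ofReal_div_of_pos (by norm_num)]; norm_num, ← ENNReal.ofReal_one,
      ← ENNReal.ofReal_sub _ (by norm_num), show (1 - 3 / 4 : ℝ) = 4⁻¹ by norm_num,
      ENNReal.ofReal_inv_of_pos (by norm_num)]
    norm_num
  rw [e, inv_inv]

end BEquation

namespace LittlewoodPaleyPair

open BEquation
open scoped SchwartzMap

variable (P : LittlewoodPaleyPair)

/-! ### Estimates on frequency shells -/

theorem abs_le_two_rpow {j : ℕ} {ξ : ℝ} (h : P.psi j ξ ≠ 0) : |ξ| ≤ 2 ^ ((j : ℝ) + 1) := by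
  rw [Real.rpow_add_one (by norm_num), Real.rpow_natCast]
  have := P.psi_supp_le h
  have : (0 : ℝ) < 2 ^ j := by positivity
  linarith

theorem two_rpow_le {j : ℕ} {ξ : ℝ} (h : P.psi j ξ ≠ 0) : 2 ^ (2 * ((j : ℝ) - 2)) ≤ 1 + ξ ^ 2 := by
  cases j with
  | zero =>
    have : (2 : ℝ) ^ (2 * (((0 : ℕ) : ℝ) - 2)) ≤ 1 :=
      Real.rpow_le_one_of_one_le_of_nonpos (by norm_num) (by norm_num)
    nlinarith [sq_nonneg ξ]
  | succ j =>
    have h1 := P.le_psi_supp h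
    have e : (2 : ℝ) ^ (2 * (((j + 1 : ℕ) : ℝ) - 2)) = (2 ^ j) ^ 2 / 4 := by
      rw [show 2 * (((j + 1 : ℕ) : ℝ) - 2) = (j : ℝ) * 2 - 2 by push_cast; ring,
        Real.rpow_sub (by norm_num), Real.rpow_mul (by norm_num), Real.rpow_natCast]
      norm_num
    rw [e]
    have h2 : (0 : ℝ) < 2 ^ j := by positivity
    have h3 : (3 / 4 * 2 ^ j) ^ 2 ≤ ξ ^ 2 := by rw [← sq_abs ξ]; gcongr
    nlinarith

theorem one_add_sq_le {j : ℕ} {ξ : ℝ} (h : P.psi j ξ ≠ 0) : 1 + ξ ^ 2 ≤ 2 ^ (2 * ((j : ℝ) + 1)) := by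
  have h1 := P.psi_supp_le h
  have e : (2 : ℝ) ^ (2 * ((j : ℝ) + 1)) = (2 ^ j) ^ 2 * 4 := by
    rw [show 2 * ((j : ℝ) + 1) = (j : ℝ) * 2 + 2 by ring, Real.rpow_add (by norm_num),
      Real.rpow_mul (by norm_num), Real.rpow_natCast]
    norm_num
  rw [e]
  have h2 : (1 : ℝ) ≤ 2 ^ j := one_le_pow₀ (by norm_num)
  have h3 : ξ ^ 2 ≤ (4 / 3 * 2 ^ j) ^ 2 := by rw [← sq_abs ξ]; gcongr
  nlinarith

theorem measurable_psi (j : ℕ) : Measurable fun η : ℝ => P.psi j (2 * Real.pi * η) :=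
  ((P.psi_smooth j).continuous.comp (by fun_prop)).measurable

theorem measurable_enorm_fourier (F : 𝓢(ℝ, ℂ)) : Measurable fun η : ℝ => ‖(𝓕 F) η‖ₑ :=
  (𝓕 F).continuous.enorm.measurable

theorem volume_shell_le (j : ℕ) :
    volume {η : ℝ | |2 * Real.pi * η| ≤ 2 ^ ((j : ℝ) + 1)} ≤ 2 ^ ((j : ℝ) + 1) := by
  have hp : 0 < 2 * Real.pi := by positivity
  have hsub : {η : ℝ | |2 * Real.pi * η| ≤ 2 ^ ((j : ℝ) + 1)} ⊆
      Icc (-(2 ^ ((j : ℝ) + 1) / 2)) (2 ^ ((j : ℝ) + 1) / 2) := fun η hη => by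
    rw [mem_ofPred_eq, abs_mul, abs_of_pos hp] at hη
    refine abs_le.1 ?_
    have : 2 * |η| ≤ 2 * Real.pi * |η| := by
      gcongr; linarith [Real.pi_gt_three]
    linarith
  refine (measure_mono hsub).trans ?_
  rw [Real.volume_Icc, ← ofReal_two_rpow]
  apply ENNReal.ofReal_le_ofReal
  linarith

/-- Bernstein's inequality on the Fourier side: Cauchy–Schwarz against the indicator of a set of
measure at most `2^{j+1}` that contains the shell. -/
theorem lintegral_shell_le (j : ℕ) (F : 𝓢(ℝ, ℂ)) :
    ∫⁻ η, ENNReal.ofReal (P.psi j (2 * Real.pi * η)) * ‖(𝓕 F) η‖ₑ ≤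
      2 ^ (((j : ℝ) + 1) / 2) * P.blockSq j F ^ (1 / 2 : ℝ) := by
  set S : Set ℝ := {η : ℝ | |2 * Real.pi * η| ≤ 2 ^ ((j : ℝ) + 1)} with hS
  have hSm : MeasurableSet S := measurableSet_le (by fun_prop) (by fun_prop)
  have hm : Measurable fun η : ℝ => ENNReal.ofReal (P.psi j (2 * Real.pi * η)) * ‖(𝓕 F) η‖ₑ :=
    (P.measurable_psi j).ennreal_ofReal.mul (measurable_enorm_fourier F)
  have h1 := ENNReal.lintegral_mul_le_Lp_mul_Lq volume Real.HolderConjugate.two_two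
    (f := S.indicator 1) (g := fun η => ENNReal.ofReal (P.psi j (2 * Real.pi * η)) * ‖(𝓕 F) η‖ₑ)
    (measurable_one.indicator hSm).aemeasurable hm.aemeasurable
  have e0 : ∫⁻ η, ENNReal.ofReal (P.psi j (2 * Real.pi * η)) * ‖(𝓕 F) η‖ₑ =
      ∫⁻ η, (S.indicator (1 : ℝ → ℝ≥0∞) * (fun η : ℝ =>
        ENNReal.ofReal (P.psi j (2 * Real.pi * η)) * ‖(𝓕 F) η‖ₑ) : ℝ → ℝ≥0∞) η := by
    congr 1; ext η
    by_cases hη : P.psi j (2 * Real.pi * η) = 0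
    · simp [hη]
    · have : η ∈ S := P.abs_le_two_rpow hη
      simp [this]
  have e1 : ∫⁻ η, (S.indicator 1 η : ℝ≥0∞) ^ (2 : ℝ) = volume S := by
    rw [← lintegral_indicator_one hSm]
    congr 1; ext η
    by_cases hη : η ∈ S <;> simp [hη]
  have e2 : ∫⁻ η, (ENNReal.ofReal (P.psi j (2 * Real.pi * η)) * ‖(𝓕 F) η‖ₑ) ^ (2 : ℝ) =
      P.blockSq j F := by
    rw [blockSq]
    congr 1; ext η
    rw [ENNReal.rpow_two, mul_pow, ENNReal.ofReal_pow (P.psi_mem _ _).1]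
  rw [e0]
  refine h1.trans ?_
  rw [e1, e2]
  gcongr
  calc volume S ^ (1 / 2 : ℝ) ≤ ((2 : ℝ≥0∞) ^ ((j : ℝ) + 1)) ^ (1 / 2 : ℝ) := by
        gcongr; exact volume_shell_le j
    _ = _ := by rw [← ENNReal.rpow_mul]; congr 1; ring

theorem lintegral_shell_mul_le (j : ℕ) (F : 𝓢(ℝ, ℂ)) :
    ∫⁻ η, ENNReal.ofReal (P.psi j (2 * Real.pi * η)) *
        (ENNReal.ofReal |2 * Real.pi * η| * ‖(𝓕 F) η‖ₑ) ≤
      2 ^ (3 * ((j : ℝ) + 1) / 2) * P.blockSq j F ^ (1 / 2 : ℝ) := by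
  calc _ ≤ ∫⁻ η, 2 ^ ((j : ℝ) + 1) * (ENNReal.ofReal (P.psi j (2 * Real.pi * η)) * ‖(𝓕 F) η‖ₑ) := by
        refine lintegral_mono fun η => ?_
        by_cases hη : P.psi j (2 * Real.pi * η) = 0
        · simp [hη]
        · have : ENNReal.ofReal |2 * Real.pi * η| ≤ 2 ^ ((j : ℝ) + 1) := by
            rw [← ofReal_two_rpow]; exact ENNReal.ofReal_le_ofReal (P.abs_le_two_rpow hη)
          rw [mul_left_comm]
          exact mul_le_mul_left this _
    _ = 2 ^ ((j : ℝ) + 1) * ∫⁻ η, ENNReal.ofReal (P.psi j (2 * Real.pi * η)) * ‖(𝓕 F) η‖ₑ :=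
        lintegral_const_mul _
          ((P.measurable_psi j).ennreal_ofReal.mul (measurable_enorm_fourier F))
    _ ≤ 2 ^ ((j : ℝ) + 1) * (2 ^ (((j : ℝ) + 1) / 2) * P.blockSq j F ^ (1 / 2 : ℝ)) := by
        gcongr; exact P.lintegral_shell_le j F
    _ = _ := by rw [← mul_assoc, ← two_rpow_add]; congr 2; ring

theorem lintegral_eq_tsum_shell {w : ℝ → ℝ≥0∞} (hw : Measurable w) :
    ∫⁻ η, w η = ∑' j, ∫⁻ η, ENNReal.ofReal (P.psi j (2 * Real.pi * η)) * w η := by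
  have hm : ∀ j, Measurable fun η : ℝ => ENNReal.ofReal (P.psi j (2 * Real.pi * η)) * w η :=
    fun j => (P.measurable_psi j).ennreal_ofReal.mul hw
  rw [← lintegral_tsum fun j => (hm j).aemeasurable]
  congr 1; ext η
  rw [ENNReal.tsum_mul_right, P.tsum_psi, one_mul]

theorem lintegral_le_tsum_shell_sq {w : ℝ → ℝ≥0∞} (hw : Measurable w) :
    ∫⁻ η, w η ≤ 3 * ∑' j, ∫⁻ η, ENNReal.ofReal (P.psi j (2 * Real.pi * η) ^ 2) * w η := by
  have hm : ∀ j, Measurable fun η : ℝ => ENNReal.ofReal (P.psi j (2 * Real.pi * η) ^ 2) * w η :=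
    fun j => ((P.measurable_psi j).pow_const 2).ennreal_ofReal.mul hw
  rw [← lintegral_tsum fun j => (hm j).aemeasurable,
    ← lintegral_const_mul _ (Measurable.tsum hm)]
  refine lintegral_mono fun η => ?_
  rw [ENNReal.tsum_mul_right, ← mul_assoc]
  exact le_mul_of_one_le_left zero_le (P.one_le_three_mul_tsum_psi_sq _)

/-- On the shell of `psi j` the symbol `1 + ξ²` is at least `2^{2(j-2)}`. This decay beats the
critical one and handles the high frequencies. -/
theorem blockSq_le_momentum (j : ℕ) {F H : 𝓢(ℝ, ℂ)}
    (hH : ∀ η, ‖(𝓕 H) η‖ₑ = ENNReal.ofReal (1 + (2 * Real.pi * η) ^ 2) * ‖(𝓕 F) η‖ₑ) :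
    P.blockSq j F ^ (1 / 2 : ℝ) ≤ 2 ^ (-(2 * ((j : ℝ) - 2))) * eLpNorm H 2 volume := by
  have h1 : P.blockSq j F ≤ (2 ^ (-(2 * ((j : ℝ) - 2))) * eLpNorm H 2 volume) ^ 2 := by
    rw [mul_pow, eLpNorm_two_sq, ← lintegral_sq_fourier,
      ← lintegral_const_mul _ ((measurable_enorm_fourier H).pow_const 2), blockSq]
    refine lintegral_mono fun η => ?_
    by_cases hη : P.psi j (2 * Real.pi * η) = 0
    · simp [hη]
    · rw [hH, ← mul_pow]
      have h2 : (2 : ℝ≥0∞) ^ (2 * ((j : ℝ) - 2)) ≤ ENNReal.ofReal (1 + (2 * Real.pi * η) ^ 2) := by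
        rw [← ofReal_two_rpow]; exact ENNReal.ofReal_le_ofReal (P.two_rpow_le hη)
      have h3 : ‖(𝓕 F) η‖ₑ ≤ 2 ^ (-(2 * ((j : ℝ) - 2))) *
          (ENNReal.ofReal (1 + (2 * Real.pi * η) ^ 2) * ‖(𝓕 F) η‖ₑ) := by
        calc ‖(𝓕 F) η‖ₑ = 2 ^ (-(2 * ((j : ℝ) - 2))) * (2 ^ (2 * ((j : ℝ) - 2)) * ‖(𝓕 F) η‖ₑ) :=
              (two_rpow_neg_mul _ _).symm
          _ ≤ _ := by gcongr
      have h4 : ENNReal.ofReal (P.psi j (2 * Real.pi * η) ^ 2) ≤ 1 := by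
        rw [← ENNReal.ofReal_one]
        apply ENNReal.ofReal_le_ofReal
        have := P.psi_mem j (2 * Real.pi * η)
        exact pow_le_one₀ this.1 this.2
      calc _ ≤ 1 * ‖(𝓕 F) η‖ₑ ^ 2 := by gcongr
        _ ≤ _ := by rw [one_mul]; gcongr
  calc _ ≤ ((2 ^ (-(2 * ((j : ℝ) - 2))) * eLpNorm H 2 volume) ^ 2) ^ (1 / 2 : ℝ) := by gcongr
    _ = _ := by rw [← ENNReal.rpow_two, ← ENNReal.rpow_mul]; norm_num

/-! ### Consequences of a bound in the critical Besov space -/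

section critical

variable {F G H : 𝓢(ℝ, ℂ)} {B : ℝ≥0∞}

theorem block_le_of_bound
    (hB : ∀ j : ℕ, 2 ^ (((j : ℝ) - 1) * (3 / 2)) * P.blockSq j F ^ (1 / 2 : ℝ) ≤ B) (j : ℕ) :
    P.blockSq j F ^ (1 / 2 : ℝ) ≤ 2 ^ (-(((j : ℝ) - 1) * (3 / 2))) * B := by
  calc _ = 2 ^ (-(((j : ℝ) - 1) * (3 / 2))) *
        (2 ^ (((j : ℝ) - 1) * (3 / 2)) * P.blockSq j F ^ (1 / 2 : ℝ)) := (two_rpow_neg_mul _ _).symm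
    _ ≤ _ := by gcongr; exact hB j

/-- The shell `j` contributes at most `2^{(j+1)/2} 2^{-3(j-1)/2} B = 2^{2-j} B`, and these sum to `8
B`. Only the supremum of the weighted blocks is used, so every `q` is covered. -/
theorem enorm_le_of_bound
    (hB : ∀ j : ℕ, 2 ^ (((j : ℝ) - 1) * (3 / 2)) * P.blockSq j F ^ (1 / 2 : ℝ) ≤ B) (x : ℝ) :
    ‖F x‖ₑ ≤ 8 * B := by
  refine (enorm_le_lintegral_fourier F x).trans ?_
  rw [P.lintegral_eq_tsum_shell (measurable_enorm_fourier F)]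
  calc _ ≤ ∑' j : ℕ, 2 ^ ((2 : ℝ) - j) * B := by
        refine ENNReal.tsum_le_tsum fun j => (P.lintegral_shell_le j F).trans ?_
        calc _ ≤ 2 ^ (((j : ℝ) + 1) / 2) * (2 ^ (-(((j : ℝ) - 1) * (3 / 2))) * B) := by
              gcongr; exact P.block_le_of_bound hB j
          _ = _ := by rw [← mul_assoc, ← two_rpow_add]; congr 2; ring
    _ = 8 * B := by
        rw [ENNReal.tsum_mul_right, tsum_two_rpow_sub]; norm_num

/-- A logarithmic estimate of the slope. -/
theorem enorm_deriv_le_of_bound (hG : ∀ η, ‖(𝓕 G) η‖ₑ = ENNReal.ofReal |2 * Real.pi * η| * ‖(𝓕 F) η‖ₑ)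
    (hH : ∀ η, ‖(𝓕 H) η‖ₑ = ENNReal.ofReal (1 + (2 * Real.pi * η) ^ 2) * ‖(𝓕 F) η‖ₑ)
    (hB : ∀ j : ℕ, 2 ^ (((j : ℝ) - 1) * (3 / 2)) * P.blockSq j F ^ (1 / 2 : ℝ) ≤ B) (J : ℕ) (x : ℝ) :
    ‖G x‖ₑ ≤ J * (8 * B) + 256 * 2 ^ (-(J : ℝ) / 2) * eLpNorm H 2 volume := by
  refine (enorm_le_lintegral_fourier G x).trans ?_
  rw [P.lintegral_eq_tsum_shell (measurable_enorm_fourier G)]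
  simp only [hG]
  -- Below `J` the exponents cancel and each shell costs `8 B`, without decay. From `J` on the
  -- momentum gives `2^{11/2} 2^{-j/2}`; with `2^{11/2} ≤ 2^6` and a geometric sum of at most `4`
  -- this makes `256 · 2^{-J/2}`.
  rw [tsum_eq_sum_range_add_tsum _ J]
  refine add_le_add ?_ ?_
  · refine (Finset.sum_le_card_nsmul _ _ (8 * B) fun j _ => ?_).trans (by simp)
    refine (P.lintegral_shell_mul_le j F).trans ?_
    calc _ ≤ 2 ^ (3 * ((j : ℝ) + 1) / 2) * (2 ^ (-(((j : ℝ) - 1) * (3 / 2))) * B) := by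
          gcongr; exact P.block_le_of_bound hB j
      _ = 2 ^ (3 : ℝ) * B := by rw [← mul_assoc, ← two_rpow_add]; congr 2; ring
      _ = _ := by norm_num
  · calc _ ≤ ∑' i : ℕ, 2 ^ (-(i : ℝ) / 2) *
          (2 ^ (11 / 2 : ℝ) * 2 ^ (-(J : ℝ) / 2) * eLpNorm H 2 volume) := by
          refine ENNReal.tsum_le_tsum fun i => (P.lintegral_shell_mul_le (i + J) F).trans ?_
          calc _ ≤ 2 ^ (3 * (((i + J : ℕ) : ℝ) + 1) / 2) *
                (2 ^ (-(2 * (((i + J : ℕ) : ℝ) - 2))) * eLpNorm H 2 volume) := by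
                gcongr; exact P.blockSq_le_momentum _ hH
            _ = _ := by
                rw [← mul_assoc, ← two_rpow_add, ← mul_assoc, ← mul_assoc, ← two_rpow_add,
                  ← two_rpow_add]
                congr 2; push_cast; ring
      _ ≤ 4 * (2 ^ (6 : ℝ) * 2 ^ (-(J : ℝ) / 2) * eLpNorm H 2 volume) := by
          rw [ENNReal.tsum_mul_right]
          gcongr
          · exact tsum_two_rpow_neg_half_le
          · norm_num
          · norm_num
      _ = _ := by rw [← mul_assoc, ← mul_assoc]; norm_num

/-- In `L²` one derivative leaves half a derivative to spare: the shells contribute `2^{2(j+1) -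
3(j-1)} = 2^{5-j}`, with sum `64`, and the overlap of the shells costs a factor `3`. The estimate
controls `p * u_x²` whatever the maximal slope. -/
theorem lintegral_deriv_sq_le_of_bound
    (hG : ∀ η, ‖(𝓕 G) η‖ₑ = ENNReal.ofReal |2 * Real.pi * η| * ‖(𝓕 F) η‖ₑ)
    (hB : ∀ j : ℕ, 2 ^ (((j : ℝ) - 1) * (3 / 2)) * P.blockSq j F ^ (1 / 2 : ℝ) ≤ B) :
    ∫⁻ x, ‖G x‖ₑ ^ 2 ≤ 192 * B ^ 2 := by
  rw [← lintegral_sq_fourier]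
  refine (P.lintegral_le_tsum_shell_sq ((measurable_enorm_fourier G).pow_const 2)).trans ?_
  have key : ∀ j : ℕ, ∫⁻ η, ENNReal.ofReal (P.psi j (2 * Real.pi * η) ^ 2) * ‖(𝓕 G) η‖ₑ ^ 2 ≤
      2 ^ ((5 : ℝ) - j) * B ^ 2 := fun j => by
    calc _ ≤ ∫⁻ η, 2 ^ (2 * ((j : ℝ) + 1)) *
          (ENNReal.ofReal (P.psi j (2 * Real.pi * η) ^ 2) * ‖(𝓕 F) η‖ₑ ^ 2) := by
          refine lintegral_mono fun η => ?_
          by_cases hη : P.psi j (2 * Real.pi * η) = 0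
          · simp [hη]
          · have h1 : ENNReal.ofReal |2 * Real.pi * η| ≤ 2 ^ ((j : ℝ) + 1) := by
              rw [← ofReal_two_rpow]; exact ENNReal.ofReal_le_ofReal (P.abs_le_two_rpow hη)
            have h2 : ENNReal.ofReal |2 * Real.pi * η| ^ 2 ≤ 2 ^ (2 * ((j : ℝ) + 1)) := by
              calc _ ≤ ((2 : ℝ≥0∞) ^ ((j : ℝ) + 1)) ^ 2 := by gcongr
                _ = _ := by rw [← ENNReal.rpow_two, ← ENNReal.rpow_mul]; congr 1; ring
            rw [hG, mul_pow, mul_left_comm]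
            exact mul_le_mul_left h2 _
      _ = 2 ^ (2 * ((j : ℝ) + 1)) * P.blockSq j F :=
          lintegral_const_mul _ (((P.measurable_psi j).pow_const 2).ennreal_ofReal.mul
            ((measurable_enorm_fourier F).pow_const 2))
      _ = 2 ^ (2 * ((j : ℝ) + 1)) * (P.blockSq j F ^ (1 / 2 : ℝ)) ^ 2 := by
          rw [← ENNReal.rpow_two, ← ENNReal.rpow_mul]; norm_num
      _ ≤ 2 ^ (2 * ((j : ℝ) + 1)) * (2 ^ (-(((j : ℝ) - 1) * (3 / 2))) * B) ^ 2 := by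
          gcongr; exact P.block_le_of_bound hB j
      _ = _ := by
          rw [mul_pow, ← ENNReal.rpow_two (2 ^ _), ← ENNReal.rpow_mul, ← mul_assoc, ← two_rpow_add]
          congr 2; ring
  calc _ ≤ 3 * ∑' j : ℕ, 2 ^ ((5 : ℝ) - j) * B ^ 2 := by
        gcongr with j; exact key j
    _ = _ := by
        rw [ENNReal.tsum_mul_right, tsum_two_rpow_sub, ← mul_assoc]; norm_num

end critical

/-! ### Besov and Sobolev norms of Schwartz functions -/

theorem eLpNorm_block_eq (j : ℕ) {u : ℝ → ℝ} {F : 𝓢(ℝ, ℂ)} (hF : ∀ x, F x = (u x : ℂ)) :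
    eLpNorm (P.block ((j : ℤ) - 1) u) 2 volume = P.blockSq j F ^ (1 / 2 : ℝ) := by
  rw [← P.eLpNorm_block_sq j hF, ← ENNReal.rpow_two, ← ENNReal.rpow_mul]; norm_num

/-- The `j`-th term of the Besov norm of a Schwartz function. -/
theorem besov_term_eq (j : ℕ) {u : ℝ → ℝ} {F : 𝓢(ℝ, ℂ)} (hF : ∀ x, F x = (u x : ℂ)) :
    (2 : ℝ≥0∞) ^ ((((j : ℤ) - 1 : ℤ) : ℝ) * (3 / 2)) * eLpNorm (P.block ((j : ℤ) - 1) u) 2 volume =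
      2 ^ (((j : ℝ) - 1) * (3 / 2)) * P.blockSq j F ^ (1 / 2 : ℝ) := by
  rw [P.eLpNorm_block_eq j hF]; push_cast; rfl

theorem besov_term_zero {j : ℤ} (hj : j ≤ -2) (s : ℝ) (u : ℝ → ℝ) :
    (2 : ℝ≥0∞) ^ ((j : ℝ) * s) * eLpNorm (P.block j u) 2 volume = 0 := by
  have : P.block j u = 0 := by funext x; simp [block, hj]
  rw [this, eLpNorm_zero, mul_zero]

theorem besov_term_le {q : ℝ≥0∞} (hq : 1 < q) {u : ℝ → ℝ} {F : 𝓢(ℝ, ℂ)}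
    (hF : ∀ x, F x = (u x : ℂ)) (j : ℕ) :
    2 ^ (((j : ℝ) - 1) * (3 / 2)) * P.blockSq j F ^ (1 / 2 : ℝ) ≤ besovNorm P (3 / 2) 2 q u := by
  rw [← P.besov_term_eq j hF]
  exact le_ellNorm hq (fun j : ℤ => (2 : ℝ≥0∞) ^ ((j : ℝ) * (3 / 2)) * eLpNorm (P.block j u) 2 volume)
    ((j : ℤ) - 1)

theorem besovNorm_two_sq {u : ℝ → ℝ} {F : 𝓢(ℝ, ℂ)} (hF : ∀ x, F x = (u x : ℂ)) :
    besovNorm P (3 / 2) 2 2 u ^ 2 = ∑' j : ℕ, 2 ^ (3 * ((j : ℝ) - 1)) * P.blockSq j F := by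
  rw [besovNorm, ellNorm, if_neg (by norm_num), ← ENNReal.rpow_two, ← ENNReal.rpow_mul,
    tsum_int_eq_tsum_nat fun j hj => by rw [P.besov_term_zero hj]; norm_num]
  norm_num only [ENNReal.toReal_ofNat, ENNReal.rpow_one, div_mul_cancel₀]
  refine tsum_congr fun j => ?_
  rw [P.besov_term_eq j hF, ENNReal.mul_rpow_of_nonneg _ _ (by norm_num), ← ENNReal.rpow_mul,
    ← ENNReal.rpow_mul]
  congr 1
  · congr 1; ring
  · norm_num

end LittlewoodPaleyPair

namespace BEquation

open scoped SchwartzMap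

theorem sobolevNorm_eq (s : ℝ) {u : ℝ → ℝ} {F : 𝓢(ℝ, ℂ)} (hF : ∀ x, F x = (u x : ℂ)) :
    sobolevNorm s u ^ 2 = ENNReal.ofReal (2 * Real.pi) *
      ∫⁻ η : ℝ, ENNReal.ofReal ((1 + (2 * Real.pi * η) ^ 2) ^ s) * ‖(𝓕 F) η‖ₑ ^ 2 := by
  have e : (fun x => (u x : ℂ)) = F := funext fun x => (hF x).symm
  have h : MemLp (fun x => (u x : ℂ)) 2 (volume : Measure ℝ) := by rw [e]; exact F.memLp 2 volume
  have h2 : h.toLp (fun x => (u x : ℂ)) = F.toLp 2 volume := by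
    apply MemLp.toLp_congr; rw [e]
  rw [sobolevNorm, dif_pos h, h2, SchwartzMap.toLp_fourier_eq, ← ENNReal.rpow_two, ← ENNReal.rpow_mul]
  norm_num only [one_div, ENNReal.rpow_one, inv_mul_cancel₀]
  congr 1
  refine lintegral_congr_ae ?_
  filter_upwards [(𝓕 F).coeFn_toLp 2 volume] with η hη
  rw [hη]

/-- The weights `(1 + ξ²)^{3/2}` and `2^{3(j-1)}` are comparable on each shell. The constant is
generous: for the squares `8 · 3 · 64 = 1536 ≤ 100²`. -/
theorem sobolevNorm_le_besovNorm (P : LittlewoodPaleyPair) {u : ℝ → ℝ} {F : 𝓢(ℝ, ℂ)}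
    (hF : ∀ x, F x = (u x : ℂ)) :
    sobolevNorm (3 / 2) u ≤ 100 * besovNorm P (3 / 2) 2 2 u := by
  rw [← ENNReal.pow_le_pow_left_iff two_ne_zero, mul_pow, P.besovNorm_two_sq hF,
    sobolevNorm_eq _ hF]
  have hw : Measurable fun η : ℝ => ENNReal.ofReal ((1 + (2 * Real.pi * η) ^ 2) ^ (3 / 2 : ℝ)) *
      ‖(𝓕 F) η‖ₑ ^ 2 :=
    (Measurable.ennreal_ofReal (by fun_prop)).mul
      ((LittlewoodPaleyPair.measurable_enorm_fourier F).pow_const 2)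
  have key : ∀ j : ℕ, ∫⁻ η, ENNReal.ofReal (P.psi j (2 * Real.pi * η) ^ 2) *
      (ENNReal.ofReal ((1 + (2 * Real.pi * η) ^ 2) ^ (3 / 2 : ℝ)) * ‖(𝓕 F) η‖ₑ ^ 2) ≤
      64 * (2 ^ (3 * ((j : ℝ) - 1)) * P.blockSq j F) := fun j => by
    calc _ ≤ ∫⁻ η, 2 ^ (3 * ((j : ℝ) + 1)) *
          (ENNReal.ofReal (P.psi j (2 * Real.pi * η) ^ 2) * ‖(𝓕 F) η‖ₑ ^ 2) := by
          refine lintegral_mono fun η => ?_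
          by_cases hη : P.psi j (2 * Real.pi * η) = 0
          · simp [hη]
          · have h2 : ENNReal.ofReal ((1 + (2 * Real.pi * η) ^ 2) ^ (3 / 2 : ℝ)) ≤
                2 ^ (3 * ((j : ℝ) + 1)) := by
              rw [← ofReal_two_rpow]
              apply ENNReal.ofReal_le_ofReal
              calc _ ≤ ((2 : ℝ) ^ (2 * ((j : ℝ) + 1))) ^ (3 / 2 : ℝ) := by
                    gcongr; exact P.one_add_sq_le hη
                _ = _ := by rw [← Real.rpow_mul (by norm_num)]; congr 1; ring
            rw [mul_left_comm]
            exact mul_le_mul_left h2 _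
      _ = 2 ^ (3 * ((j : ℝ) + 1)) * P.blockSq j F :=
          lintegral_const_mul _ (((P.measurable_psi j).pow_const 2).ennreal_ofReal.mul
            ((LittlewoodPaleyPair.measurable_enorm_fourier F).pow_const 2))
      _ = 2 ^ (6 : ℝ) * (2 ^ (3 * ((j : ℝ) - 1)) * P.blockSq j F) := by
          rw [← mul_assoc, ← two_rpow_add]; congr 2; ring
      _ = _ := by norm_num
  have hpi : ENNReal.ofReal (2 * Real.pi) ≤ 8 := by
    rw [show (8 : ℝ≥0∞) = ENNReal.ofReal 8 by norm_num]
    exact ENNReal.ofReal_le_ofReal (by linarith [Real.pi_lt_four])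
  calc _ ≤ 8 * (3 * ∑' j : ℕ, 64 * (2 ^ (3 * ((j : ℝ) - 1)) * P.blockSq j F)) := by
        refine mul_le_mul' hpi ((P.lintegral_le_tsum_shell_sq hw).trans ?_)
        gcongr with j; exact key j
    _ = 1536 * ∑' j : ℕ, 2 ^ (3 * ((j : ℝ) - 1)) * P.blockSq j F := by
        rw [ENNReal.tsum_mul_left, ← mul_assoc, ← mul_assoc]; norm_num
    _ ≤ _ := by gcongr; norm_num

theorem besovNorm_le_sobolevNorm (P : LittlewoodPaleyPair) {u : ℝ → ℝ} {F : 𝓢(ℝ, ℂ)}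
    (hF : ∀ x, F x = (u x : ℂ)) :
    besovNorm P (3 / 2) 2 2 u ≤ 100 * sobolevNorm (3 / 2) u := by
  rw [← ENNReal.pow_le_pow_left_iff two_ne_zero, mul_pow, P.besovNorm_two_sq hF,
    sobolevNorm_eq _ hF]
  have hw : Measurable fun η : ℝ => ENNReal.ofReal ((1 + (2 * Real.pi * η) ^ 2) ^ (3 / 2 : ℝ)) *
      ‖(𝓕 F) η‖ₑ ^ 2 :=
    (Measurable.ennreal_ofReal (by fun_prop)).mul
      ((LittlewoodPaleyPair.measurable_enorm_fourier F).pow_const 2)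
  have key : ∀ j : ℕ, 2 ^ (3 * ((j : ℝ) - 1)) * P.blockSq j F ≤
      8 * ∫⁻ η, ENNReal.ofReal (P.psi j (2 * Real.pi * η)) *
      (ENNReal.ofReal ((1 + (2 * Real.pi * η) ^ 2) ^ (3 / 2 : ℝ)) * ‖(𝓕 F) η‖ₑ ^ 2) := fun j => by
    have hm : Measurable fun η : ℝ => ENNReal.ofReal (P.psi j (2 * Real.pi * η)) *
        (ENNReal.ofReal ((1 + (2 * Real.pi * η) ^ 2) ^ (3 / 2 : ℝ)) * ‖(𝓕 F) η‖ₑ ^ 2) :=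
      (P.measurable_psi j).ennreal_ofReal.mul hw
    have hm' : Measurable fun η : ℝ => ENNReal.ofReal (P.psi j (2 * Real.pi * η) ^ 2) *
        ‖(𝓕 F) η‖ₑ ^ 2 :=
      ((P.measurable_psi j).pow_const 2).ennreal_ofReal.mul
        ((LittlewoodPaleyPair.measurable_enorm_fourier F).pow_const 2)
    rw [← lintegral_const_mul _ hm, LittlewoodPaleyPair.blockSq, ← lintegral_const_mul _ hm']
    refine lintegral_mono fun η => ?_
    by_cases hη : P.psi j (2 * Real.pi * η) = 0
    · simp [hη]
    · have h1 : ENNReal.ofReal (P.psi j (2 * Real.pi * η) ^ 2) ≤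
          ENNReal.ofReal (P.psi j (2 * Real.pi * η)) := by
        apply ENNReal.ofReal_le_ofReal
        have := P.psi_mem j (2 * Real.pi * η)
        exact pow_le_of_le_one this.1 this.2 two_ne_zero
      have h2 : (2 : ℝ≥0∞) ^ (3 * ((j : ℝ) - 1)) ≤
          8 * ENNReal.ofReal ((1 + (2 * Real.pi * η) ^ 2) ^ (3 / 2 : ℝ)) := by
        rw [show (8 : ℝ≥0∞) = ENNReal.ofReal 8 by norm_num, ← ENNReal.ofReal_mul (by norm_num),
          ← ofReal_two_rpow]
        apply ENNReal.ofReal_le_ofReal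
        calc (2 : ℝ) ^ (3 * ((j : ℝ) - 1)) = 8 * ((2 : ℝ) ^ (2 * ((j : ℝ) - 2))) ^ (3 / 2 : ℝ) := by
              rw [← Real.rpow_mul (by norm_num), show (8 : ℝ) = 2 ^ (3 : ℝ) by norm_num,
                ← Real.rpow_add (by norm_num)]
              congr 1; ring
          _ ≤ _ := by gcongr; exact P.two_rpow_le hη
      calc _ ≤ (8 * ENNReal.ofReal ((1 + (2 * Real.pi * η) ^ 2) ^ (3 / 2 : ℝ))) *
            (ENNReal.ofReal (P.psi j (2 * Real.pi * η)) * ‖(𝓕 F) η‖ₑ ^ 2) := by gcongr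
        _ = _ := by ring
  have hpi : 1 ≤ ENNReal.ofReal (2 * Real.pi) := by
    rw [← ENNReal.ofReal_one]
    exact ENNReal.ofReal_le_ofReal (by linarith [Real.pi_gt_three])
  calc _ ≤ ∑' j : ℕ, 8 * ∫⁻ η, ENNReal.ofReal (P.psi j (2 * Real.pi * η)) *
      (ENNReal.ofReal ((1 + (2 * Real.pi * η) ^ 2) ^ (3 / 2 : ℝ)) * ‖(𝓕 F) η‖ₑ ^ 2) :=
        ENNReal.tsum_le_tsum key
    _ = 8 * (1 * ∫⁻ η, ENNReal.ofReal ((1 + (2 * Real.pi * η) ^ 2) ^ (3 / 2 : ℝ)) *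
        ‖(𝓕 F) η‖ₑ ^ 2) := by
        rw [ENNReal.tsum_mul_left, ← P.lintegral_eq_tsum_shell hw, one_mul]
    _ ≤ _ := by gcongr; norm_num

end BEquation

namespace BEquation

open scoped SchwartzMap

/-! ### Small data in the critical Besov space with a large slope -/

/-- Interpolation between `ℓ^∞` and `ℓ^1` through `a^r ≤ M^{r-1} a`: about `n` terms of size `M`
have norm `M n^{1/r}`, which is much less than their sum. -/
theorem ellNorm_le_of_tsum_le {r : ℝ≥0∞} (hr : 1 < r) {a : ℤ → ℝ≥0∞} {M n : ℝ≥0∞}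
    (ha : ∀ j, a j ≤ M) (hs : ∑' j, a j ≤ M * n) : ellNorm r a ≤ M * n ^ (1 / r.toReal) := by
  rw [ellNorm]
  split_ifs with h
  -- Since `⊤.toReal = 0`, the exponent `1 / r.toReal` is `0` here and the factor in `n` is `1`, as
  -- it should be.
  · subst h; simpa using ha
  · have hr1 : 1 < r.toReal := by
      rw [← ENNReal.toReal_one]; exact (ENNReal.toReal_lt_toReal (by norm_num) h).2 hr
    have hr0 : 0 < r.toReal := by linarith
    have split : ∀ x : ℝ≥0∞, x ^ r.toReal = x ^ (r.toReal - 1) * x := fun x => by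
      conv_rhs => rw [← ENNReal.rpow_one x, ← ENNReal.rpow_mul, one_mul]
      rw [← ENNReal.rpow_add_of_nonneg _ _ (by linarith) (by norm_num)]; congr 1; ring
    calc (∑' j, a j ^ r.toReal) ^ (1 / r.toReal)
        ≤ (M ^ r.toReal * n) ^ (1 / r.toReal) := by
          gcongr
          calc ∑' j, a j ^ r.toReal ≤ ∑' j, M ^ (r.toReal - 1) * a j := by
                refine ENNReal.tsum_le_tsum fun j => ?_
                rw [split]
                exact mul_le_mul' (ENNReal.rpow_le_rpow (ha j) (by linarith)) le_rfl
            _ ≤ M ^ (r.toReal - 1) * (M * n) := by rw [ENNReal.tsum_mul_left]; gcongr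
            _ = _ := by rw [split M, mul_assoc]
      _ = _ := by
          rw [ENNReal.mul_rpow_of_nonneg _ _ (by positivity), ← ENNReal.rpow_mul,
            mul_one_div_cancel hr0.ne', ENNReal.rpow_one]

theorem tsum_two_rpow_neg_abs_sub_le (k : ℕ) :
    ∑' j : ℕ, (2 : ℝ≥0∞) ^ (-|(j : ℝ) - k|) ≤ 4 := by
  have h0 : ∑' j : ℕ, (2 : ℝ≥0∞) ^ (0 - (j : ℝ)) = 2 := by
    rw [tsum_two_rpow_sub]; norm_num
  rw [tsum_eq_sum_range_add_tsum _ k]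
  have h1 : ∑ j ∈ Finset.range k, (2 : ℝ≥0∞) ^ (-|(j : ℝ) - k|) ≤ 2 := by
    rw [← Finset.sum_range_reflect]
    refine le_trans (Finset.sum_le_sum (g := fun j : ℕ => (2 : ℝ≥0∞) ^ (0 - (j : ℝ))) fun j hj => ?_) 
      ((ENNReal.sum_le_tsum (Finset.range k)).trans h0.le)
    have hj' := Finset.mem_range.1 hj
    apply ENNReal.rpow_le_rpow_of_exponent_le (by norm_num)
    have e : ((k - 1 - j : ℕ) : ℝ) = k - 1 - j := by
      rw [Nat.cast_sub (by omega), Nat.cast_sub (by omega)]; simp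
    rw [e]
    have := neg_le_abs ((k : ℝ) - 1 - j - k)
    linarith
  have h2 : ∑' i : ℕ, (2 : ℝ≥0∞) ^ (-|((i + k : ℕ) : ℝ) - k|) = 2 := by
    refine Eq.trans ?_ h0
    refine tsum_congr fun i => ?_
    push_cast
    rw [add_sub_cancel_right, abs_of_nonneg (by positivity), zero_sub]
  rw [h2]
  calc _ ≤ (2 : ℝ≥0∞) + 2 := by gcongr
    _ = 4 := by norm_num

/-- A superposition of `n` dyadic rescalings of one profile. -/
noncomputable def superposition (f : ℝ → ℝ) (δ : ℝ) (n : ℕ) (x : ℝ) : ℝ :=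
  ∑ k ∈ Finset.range n, δ / 2 ^ k * f (2 ^ k * x)

theorem contDiff_superposition {f : ℝ → ℝ} (hf : ContDiff ℝ ∞ f) (δ : ℝ) (n : ℕ) :
    ContDiff ℝ ∞ (superposition f δ n) :=
  ContDiff.sum fun k _ => contDiff_const.mul (hf.comp (by fun_prop))

theorem superposition_eq_zero {f : ℝ → ℝ} {L : ℝ} (hL0 : 0 ≤ L) (hL : ∀ x, L ≤ |x| → f x = 0) (δ : ℝ) (n : ℕ)
    {x : ℝ} (hx : L ≤ |x|) : superposition f δ n x = 0 := by
  refine Finset.sum_eq_zero fun k _ => ?_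
  rw [hL, mul_zero]
  rw [abs_mul, abs_of_pos (by positivity)]
  have : (1 : ℝ) ≤ 2 ^ k := one_le_pow₀ (by norm_num)
  nlinarith

theorem deriv_superposition {f : ℝ → ℝ} (hf : ContDiff ℝ ∞ f) (δ : ℝ) (n : ℕ) :
    deriv (superposition f δ n) 0 = n * (δ * deriv f 0) := by
  have h : ∀ k ∈ Finset.range n, HasDerivAt (fun x => δ / 2 ^ k * f (2 ^ k * x)) (δ * deriv f 0) 0 := by
    intro k _
    have h1 : HasDerivAt f (deriv f 0) (2 ^ k * 0) := by
      rw [mul_zero]; exact (hf.differentiable (by simp)).differentiableAt.hasDerivAt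
    have h2 : HasDerivAt (fun x : ℝ => (2 : ℝ) ^ k * x) (2 ^ k) 0 := by
      simpa using (hasDerivAt_id (0 : ℝ)).const_mul ((2 : ℝ) ^ k)
    refine ((h1.comp 0 h2).const_mul (δ / 2 ^ k)).congr_deriv ?_
    have : (2 : ℝ) ^ k ≠ 0 := by positivity
    field_simp
  have := (HasDerivAt.fun_sum h).deriv
  simp only [Finset.sum_const, Finset.card_range, nsmul_eq_mul] at this
  exact this

theorem fourier_comp_mul_left (f : ℝ → ℂ) {a : ℝ} (ha : 0 < a) (η : ℝ) :
    𝓕 (fun x => f (a * x)) η = (a⁻¹ : ℝ) • 𝓕 f (η / a) := by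
  rw [Real.fourier_eq, Real.fourier_eq]
  have := Measure.integral_comp_mul_left
    (fun v : ℝ => Real.fourierChar (-inner ℝ v (η / a)) • f v) a
  rw [abs_of_pos (inv_pos.2 ha)] at this
  rw [← this]
  congr 1; ext v
  congr 3
  simp only [RCLike.inner_apply, conj_trivial]
  field_simp

theorem fourier_superposition {f : ℝ → ℝ} (hf : Integrable f) (δ : ℝ) (n : ℕ) (η : ℝ) :
    𝓕 (fun x => (superposition f δ n x : ℂ)) η =
      ∑ k ∈ Finset.range n, ((δ / 2 ^ k * (2 ^ k)⁻¹ : ℝ) : ℂ) * 𝓕 (fun x => (f x : ℂ)) (η / 2 ^ k) := by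
  have e : ∀ k : ℕ, ((δ / 2 ^ k * (2 ^ k)⁻¹ : ℝ) : ℂ) * 𝓕 (fun x => (f x : ℂ)) (η / 2 ^ k) =
      ∫ v : ℝ, Real.fourierChar (-inner ℝ v η) • ((δ / 2 ^ k * f (2 ^ k * v) : ℝ) : ℂ) := fun k => by
    have h1 := fourier_comp_mul_left (fun x => (f x : ℂ)) (a := 2 ^ k) (by positivity) η
    rw [Complex.ofReal_mul, mul_assoc, ← Complex.real_smul (x := ((2 : ℝ) ^ k)⁻¹), ← h1, Real.fourier_eq,
      ← integral_const_mul]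
    congr 1; ext v
    rw [Circle.smul_def, Circle.smul_def, smul_eq_mul, smul_eq_mul]; push_cast; ring
  rw [Finset.sum_congr rfl fun k _ => e k, ← integral_finsetSum, Real.fourier_eq]
  · congr 1; ext v
    rw [superposition, Complex.ofReal_sum, Finset.smul_sum]
  · intro k _
    have h1 : Integrable fun v : ℝ => δ / 2 ^ k * f (2 ^ k * v) :=
      (hf.comp_mul_left' (by positivity)).const_mul _
    exact (Real.fourierIntegral_convergent_iff η).2 h1.ofReal

end BEquation

namespace LittlewoodPaleyPair

open BEquation
open scoped SchwartzMap

variable (P : LittlewoodPaleyPair)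

theorem blockSq_le_of_enorm_le {j : ℕ} {F : 𝓢(ℝ, ℂ)} {M : ℝ≥0∞}
    (h : ∀ η, P.psi j (2 * Real.pi * η) ≠ 0 → ‖(𝓕 F) η‖ₑ ≤ M) :
    P.blockSq j F ^ (1 / 2 : ℝ) ≤ 2 ^ (((j : ℝ) + 1) / 2) * M := by
  set S : Set ℝ := {η : ℝ | |2 * Real.pi * η| ≤ 2 ^ ((j : ℝ) + 1)} with hS
  have hSm : MeasurableSet S := measurableSet_le (by fun_prop) (by fun_prop)
  have h1 : P.blockSq j F ≤ 2 ^ ((j : ℝ) + 1) * M ^ 2 := by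
    calc P.blockSq j F ≤ ∫⁻ η, S.indicator (fun _ => M ^ 2) η := by
          refine lintegral_mono fun η => ?_
          by_cases hη : P.psi j (2 * Real.pi * η) = 0
          · simp [hη]
          · have hm : η ∈ S := P.abs_le_two_rpow hη
            rw [indicator_of_mem hm]
            have h4 : ENNReal.ofReal (P.psi j (2 * Real.pi * η) ^ 2) ≤ 1 := by
              rw [← ENNReal.ofReal_one]
              apply ENNReal.ofReal_le_ofReal
              have := P.psi_mem j (2 * Real.pi * η)
              exact pow_le_one₀ this.1 this.2
            calc _ ≤ 1 * M ^ 2 := by gcongr; exact h η hη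
              _ = _ := one_mul _
      _ = M ^ 2 * volume S := by rw [lintegral_indicator hSm, setLIntegral_const]
      _ ≤ _ := by rw [mul_comm]; gcongr; exact volume_shell_le j
  calc _ ≤ (2 ^ ((j : ℝ) + 1) * M ^ 2) ^ (1 / 2 : ℝ) := by gcongr
    _ = _ := by
      rw [ENNReal.mul_rpow_of_nonneg _ _ (by norm_num), ← ENNReal.rpow_two, ← ENNReal.rpow_mul,
        ← ENNReal.rpow_mul]
      norm_num
      congr 2; ring

/-- The frequencies of the `k`-th rescaling concentrate on the `k`-th shell. -/
theorem enorm_rescaled_le {f : ℝ → ℂ} {C δ : ℝ} (hC0 : 0 ≤ C) (h0 : ∀ ζ, ‖f ζ‖ ≤ C)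
    (h3 : ∀ ζ, |2 * Real.pi * ζ| ^ 3 * ‖f ζ‖ ≤ C) {j : ℕ} (k : ℕ) {η : ℝ}
    (hη : P.psi j (2 * Real.pi * η) ≠ 0) :
    ‖((δ / 2 ^ k * (2 ^ k)⁻¹ : ℝ) : ℂ) * f (η / 2 ^ k)‖ₑ ≤
      ENNReal.ofReal (32 * (C * |δ|)) * (2 ^ (-(2 * (j : ℝ))) * 2 ^ (-|(j : ℝ) - k|)) := by
  rw [← two_rpow_add, ← ofReal_two_rpow, ← ENNReal.ofReal_mul (by positivity), ← ofReal_norm]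
  apply ENNReal.ofReal_le_ofReal
  have hk : (0 : ℝ) < 2 ^ k := by positivity
  have hj : (0 : ℝ) < 2 ^ j := by positivity
  rw [norm_mul, Complex.norm_real, Real.norm_eq_abs, abs_mul, abs_div, abs_inv, abs_of_pos hk]
  -- Below the shell `k` boundedness of `f` suffices; above it the cubic decay is used. The constant
  -- is `32 = 4 · 8`: `(3/4)³ ≥ 1/4` from the support, and `2³` from the index shift of `psi`.
  rcases le_total j k with hjk | hjk
  · have e : (2 : ℝ) ^ (-(2 * (j : ℝ)) + -|(j : ℝ) - k|) = (2 ^ j)⁻¹ * (2 ^ k)⁻¹ := by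
      have : (j : ℝ) ≤ k := by exact_mod_cast hjk
      rw [abs_of_nonpos (by linarith), show -(2 * (j : ℝ)) + - -((j : ℝ) - k) = -(j : ℝ) + -(k : ℝ) by ring,
        Real.rpow_add (by norm_num), Real.rpow_neg (by norm_num), Real.rpow_neg (by norm_num),
        Real.rpow_natCast, Real.rpow_natCast]
    rw [e]
    have h1 : ((2 : ℝ) ^ k)⁻¹ ≤ (2 ^ j)⁻¹ := by gcongr; norm_num
    calc |δ| / 2 ^ k * (2 ^ k)⁻¹ * ‖f (η / 2 ^ k)‖ ≤ |δ| / 2 ^ k * (2 ^ j)⁻¹ * C := by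
          gcongr; exact h0 _
      _ = 1 * (C * |δ|) * ((2 ^ j)⁻¹ * (2 ^ k)⁻¹) := by ring
      _ ≤ _ := by gcongr; norm_num
  · have e : (2 : ℝ) ^ (-(2 * (j : ℝ)) + -|(j : ℝ) - k|) = 2 ^ k / (2 ^ j) ^ 3 := by
      have : (k : ℝ) ≤ j := by exact_mod_cast hjk
      rw [abs_of_nonneg (by linarith), show -(2 * (j : ℝ)) + -((j : ℝ) - k) = (k : ℝ) - j * 3 by ring,
        Real.rpow_sub (by norm_num), Real.rpow_natCast, Real.rpow_mul (by norm_num), Real.rpow_natCast]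
      norm_num
    rw [e]
    cases j with
    | zero =>
      obtain rfl : k = 0 := by omega
      have := h0 η
      have h5 : 0 ≤ |δ| := abs_nonneg _
      simp only [pow_zero, div_one, inv_one, mul_one, one_pow]
      have : |δ| * ‖f η‖ ≤ |δ| * C := by gcongr
      nlinarith [mul_nonneg hC0 h5]
    | succ j =>
      have h1 := P.le_psi_supp hη
      have hj' : (0 : ℝ) < 2 ^ j := by positivity
      have h2 := h3 (η / 2 ^ k)
      rw [← mul_div_assoc, abs_div, abs_of_pos hk, div_pow] at h2
      have h4 : (3 / 4 * 2 ^ j) ^ 3 ≤ |2 * Real.pi * η| ^ 3 := by gcongr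
      have h5 : ((2 : ℝ) ^ j) ^ 3 / 4 ≤ |2 * Real.pi * η| ^ 3 := by
        refine le_trans ?_ h4
        rw [mul_pow]
        have : (0 : ℝ) < (2 ^ j) ^ 3 := by positivity
        linarith
      have h6 : ((2 : ℝ) ^ j) ^ 3 / 4 / (2 ^ k) ^ 3 * ‖f (η / 2 ^ k)‖ ≤ C :=
        le_trans (by gcongr) h2
      have h7 : ‖f (η / 2 ^ k)‖ ≤ C * (4 * (2 ^ k) ^ 3 / (2 ^ j) ^ 3) := by
        have : ‖f (η / 2 ^ k)‖ = (((2 : ℝ) ^ j) ^ 3 / 4 / (2 ^ k) ^ 3 * ‖f (η / 2 ^ k)‖) *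
            (4 * (2 ^ k) ^ 3 / (2 ^ j) ^ 3) := by field_simp
        rw [this]
        gcongr
      calc |δ| / 2 ^ k * (2 ^ k)⁻¹ * ‖f (η / 2 ^ k)‖
          ≤ |δ| / 2 ^ k * (2 ^ k)⁻¹ * (C * (4 * (2 ^ k) ^ 3 / (2 ^ j) ^ 3)) := by gcongr
        _ = _ := by rw [pow_succ (2 : ℝ) j, mul_pow]; field_simp; ring

/-- The scaling `2^{-k} f(2^k x)` keeps the critical weighted blocks at a fixed size: the `k`-th
summand contributes `O(|δ| 2^{-|j-k|})` to the `j`-th term. Each term is thus `O(|δ|)` and all terms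
together are `O(|δ| n)`, and `ellNorm_le_of_tsum_le` interpolates. -/
theorem besovNorm_superposition_le {q : ℝ≥0∞} (hq : 1 < q) {f : ℝ → ℝ} (hf : ContDiff ℝ ∞ f) {L : ℝ}
    (hL0 : 0 ≤ L) (hL : ∀ x, L ≤ |x| → f x = 0) :
    ∃ C : ℝ, 0 ≤ C ∧ ∀ (δ : ℝ) (n : ℕ), besovNorm P (3 / 2) 2 q (superposition f δ n) ≤
      ENNReal.ofReal (C * |δ|) * (n : ℝ≥0∞) ^ (1 / q.toReal) := by
  have toSchwartz : ∀ {w : ℝ → ℝ}, ContDiff ℝ ∞ w → (∀ x, L ≤ |x| → w x = 0) →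
      ∃ F : 𝓢(ℝ, ℂ), ∀ x, F x = (w x : ℂ) := fun {w} hw hwL => by
    have hc : HasCompactSupport fun x => (w x : ℂ) :=
      HasCompactSupport.intro (isCompact_Icc (a := -L) (b := L)) fun x hx => by
        rw [hwL x (by
          by_contra! hlt
          exact hx ⟨(abs_lt.1 hlt).1.le, (abs_lt.1 hlt).2.le⟩), Complex.ofReal_zero]
    exact ⟨hc.toSchwartzMap (Complex.ofRealCLM.contDiff.comp hw), fun x => rfl⟩
  obtain ⟨Φ, hΦ⟩ := toSchwartz hf hL
  have eΦ : (fun x => (f x : ℂ)) = Φ := funext fun x => (hΦ x).symm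
  obtain ⟨C0, hC0, hd0⟩ := (𝓕 Φ).decay 0 0
  obtain ⟨C3, hC3, hd3⟩ := (𝓕 Φ).decay 3 0
  simp only [norm_iteratedFDeriv_zero, pow_zero, one_mul, Real.norm_eq_abs] at hd0 hd3
  set C := C0 + (2 * Real.pi) ^ 3 * C3 with hC
  have hCpos : 0 ≤ C := by positivity
  have h0 : ∀ ζ, ‖(𝓕 Φ) ζ‖ ≤ C := fun ζ => (hd0 ζ).trans (le_add_of_nonneg_right (by positivity))
  have h3 : ∀ ζ : ℝ, |2 * Real.pi * ζ| ^ 3 * ‖(𝓕 Φ) ζ‖ ≤ C := fun ζ => by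
    rw [abs_mul, abs_of_pos Real.two_pi_pos, mul_pow, mul_assoc]
    have := hd3 ζ
    have : (2 * Real.pi) ^ 3 * (|ζ| ^ 3 * ‖(𝓕 Φ) ζ‖) ≤ (2 * Real.pi) ^ 3 * C3 := by gcongr
    linarith
  refine ⟨128 * C, by positivity, fun δ n => ?_⟩
  obtain ⟨F, hF⟩ := toSchwartz (contDiff_superposition hf δ n)
    (fun x hx => superposition_eq_zero hL0 hL δ n hx)
  have eF : (fun x => (superposition f δ n x : ℂ)) = F := funext fun x => (hF x).symm
  have hint : Integrable f := integrable_of_support hf.continuous hL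
  have hfour : ∀ η, (𝓕 F) η = ∑ k ∈ Finset.range n,
      ((δ / 2 ^ k * (2 ^ k)⁻¹ : ℝ) : ℂ) * (𝓕 Φ) (η / 2 ^ k) := fun η => by
    rw [SchwartzMap.fourier_coe, SchwartzMap.fourier_coe, ← eF, fourier_superposition hint, eΦ]
  set A := ENNReal.ofReal (32 * (C * |δ|)) with hA
  have term : ∀ j : ℕ, 2 ^ (((j : ℝ) - 1) * (3 / 2)) * P.blockSq j F ^ (1 / 2 : ℝ) ≤
      A * ∑ k ∈ Finset.range n, 2 ^ (-|(j : ℝ) - k|) := fun j => by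
    calc 2 ^ (((j : ℝ) - 1) * (3 / 2)) * P.blockSq j F ^ (1 / 2 : ℝ)
        ≤ 2 ^ (((j : ℝ) - 1) * (3 / 2)) * (2 ^ (((j : ℝ) + 1) / 2) * ∑ k ∈ Finset.range n,
            A * (2 ^ (-(2 * (j : ℝ))) * 2 ^ (-|(j : ℝ) - k|))) := by
          gcongr
          refine P.blockSq_le_of_enorm_le fun η hη => ?_
          rw [hfour]
          refine (enorm_sum_le _ _).trans (Finset.sum_le_sum fun k _ => ?_)
          exact P.enorm_rescaled_le hCpos h0 h3 k hη
      _ = 2 ^ (-1 : ℝ) * (A * ∑ k ∈ Finset.range n, 2 ^ (-|(j : ℝ) - k|)) := by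
          rw [← Finset.mul_sum, ← Finset.mul_sum]
          rw [show ∀ x y z w v : ℝ≥0∞, x * (y * (z * (w * v))) = (x * y * w) * (z * v) by intros; ring,
            ← two_rpow_add, ← two_rpow_add]
          congr 2; ring
      _ ≤ 1 * _ := by
          gcongr
          exact ENNReal.rpow_le_one_of_one_le_of_neg (by norm_num) (by norm_num)
      _ = _ := one_mul _
  have e128 : ENNReal.ofReal (128 * C * |δ|) = A * 4 := by
    rw [hA, show (4 : ℝ≥0∞) = ENNReal.ofReal 4 by norm_num, ← ENNReal.ofReal_mul (by positivity)]
    congr 1; ring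
  have hzero : ∀ j : ℤ, j ≤ -2 → (2 : ℝ≥0∞) ^ ((j : ℝ) * (3 / 2)) *
      eLpNorm (P.block j (superposition f δ n)) 2 volume = 0 := fun j hj => P.besov_term_zero hj _ _
  rw [e128]
  refine ellNorm_le_of_tsum_le hq (fun j => ?_) ?_
  · by_cases hj : j ≤ -2
    · rw [hzero j hj]; exact zero_le
    · obtain ⟨i, rfl⟩ : ∃ i : ℕ, j = (i : ℤ) - 1 := ⟨(j + 1).toNat, by omega⟩
      rw [P.besov_term_eq i hF]
      refine (term i).trans ?_
      gcongr
      refine (ENNReal.sum_le_tsum (Finset.range n)).trans ?_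
      simp only [abs_sub_comm (i : ℝ)]
      exact tsum_two_rpow_neg_abs_sub_le i
  · rw [tsum_int_eq_tsum_nat hzero]
    calc _ ≤ ∑' j : ℕ, A * ∑ k ∈ Finset.range n, (2 : ℝ≥0∞) ^ (-|(j : ℝ) - k|) := by
          refine ENNReal.tsum_le_tsum fun j => ?_
          rw [P.besov_term_eq j hF]; exact term j
      _ = A * ∑ k ∈ Finset.range n, ∑' j : ℕ, (2 : ℝ≥0∞) ^ (-|(j : ℝ) - k|) := by
          rw [ENNReal.tsum_mul_left, Summable.tsum_finsetSum fun _ _ => ENNReal.summable]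
      _ ≤ A * ∑ k ∈ Finset.range n, 4 := by
          gcongr with k; exact tsum_two_rpow_neg_abs_sub_le k
      _ = _ := by rw [Finset.sum_const, Finset.card_range, nsmul_eq_mul]; ring

/-- There are smooth compactly supported functions with arbitrarily small norm in `B^{3/2}_{2,q}`,
`q > 1`, and with prescribed slope at the origin. -/
theorem exists_small_besovNorm_deriv_eq {q : ℝ≥0∞} (hq : 1 < q) {ε : ℝ} (hε : 0 < ε) (h : ℝ) :
    ∃ (u : ℝ → ℝ) (L : ℝ), 0 ≤ L ∧ ContDiff ℝ ∞ u ∧ (∀ x, L ≤ |x| → u x = 0) ∧ deriv u 0 = h ∧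
      besovNorm P (3 / 2) 2 q u ≤ ENNReal.ofReal ε := by
  let β : ContDiffBump (0 : ℝ) := ⟨1, 2, by norm_num, by norm_num⟩
  set f : ℝ → ℝ := fun x => x * β x with hfdef
  have hf : ContDiff ℝ ∞ f := contDiff_id.mul β.contDiff
  have hL : ∀ x, (2 : ℝ) ≤ |x| → f x = 0 := fun x hx => by
    rw [hfdef]
    simp only
    rw [β.zero_of_le_dist (by simpa [Real.dist_eq] using hx), mul_zero]
  have hd : deriv f 0 = 1 := by
    have h1 : f =ᶠ[𝓝 0] fun x => x := by
      filter_upwards [β.eventuallyEq_one] with x hx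
      rw [hfdef]; simp only; rw [hx]; simp
    rw [h1.deriv_eq]; simp
  obtain ⟨C, hC, hb⟩ := P.besovNorm_superposition_le hq hf (by norm_num) hL
  -- The only place where `q > 1` is decisive: the norm is at most `C |h| n^{1/q - 1}`, which tends
  -- to `0`, while the slope stays `h`.
  have hp : 1 / q.toReal - 1 < 0 := by
    by_cases hq' : q = ⊤
    · subst hq'; simp
    · have h1 : 1 < q.toReal := by
        rw [← ENNReal.toReal_one]; exact (ENNReal.toReal_lt_toReal (by norm_num) hq').2 hq
      rw [sub_neg, div_lt_one (by linarith)]; exact h1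
  have hlim : Tendsto (fun n : ℕ => C * |h| * (n : ℝ) ^ (1 / q.toReal - 1)) atTop (𝓝 0) := by
    have h1 := (tendsto_rpow_neg_atTop (neg_pos.2 hp)).comp (tendsto_natCast_atTop_atTop (R := ℝ))
    simp only [neg_neg] at h1
    simpa using h1.const_mul (C * |h|)
  obtain ⟨n, hn, hn1⟩ := ((hlim.eventually (gt_mem_nhds hε)).and (eventually_ge_atTop 1)).exists
  have hn0 : (0 : ℝ) < n := by exact_mod_cast hn1
  refine ⟨superposition f (h / n) n, 2, by norm_num, contDiff_superposition hf _ _,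
    fun x hx => superposition_eq_zero (by norm_num) hL _ _ hx, ?_, (hb _ _).trans ?_⟩
  · rw [deriv_superposition hf, hd]; field_simp
  · rw [← ENNReal.ofReal_natCast, ENNReal.ofReal_rpow_of_pos hn0, ← ENNReal.ofReal_mul (by positivity)]
    apply ENNReal.ofReal_le_ofReal
    refine le_trans (le_of_eq ?_) hn.le
    rw [Real.rpow_sub hn0, Real.rpow_one, abs_div, abs_of_pos hn0]
    ring

end LittlewoodPaleyPair

namespace BEquation

open scoped SchwartzMap

/-! ### Continuity in time with values in the Sobolev spaces -/

theorem JointSmooth.deriv {I : Set ℝ} {n : ℕ} {f : ℝ → ℝ → ℝ} (hf : JointSmooth I (n + 1) f) :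
    JointSmooth I n fun t x => deriv (f t) x := by
  obtain ⟨-, f', hd, hf'⟩ := hf
  exact hf'.congr fun t ht x => (hd t ht x).deriv

theorem hasCompactSupport_of_abs_lt {w : ℝ → ℝ} {Λ : ℝ} (h : ∀ x, Λ < |x| → w x = 0) :
    HasCompactSupport w :=
  HasCompactSupport.intro (isCompact_Icc (a := -Λ) (b := Λ)) fun x hx => h x (by
    by_contra! hle
    exact hx ⟨(abs_le.1 hle).1, (abs_le.1 hle).2⟩)

theorem deriv_eq_zero_of_abs_lt {w : ℝ → ℝ} {Λ : ℝ} (h : ∀ x, Λ < |x| → w x = 0) (x : ℝ)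
    (hx : Λ < |x|) : deriv w x = 0 := by
  have h1 : w =ᶠ[𝓝 x] fun _ => 0 := by
    filter_upwards [(isOpen_lt continuous_const continuous_abs).mem_nhds hx] with y hy using h y hy
  rw [h1.deriv_eq]; simp

theorem exists_schwartzMap_of_support {w : ℝ → ℝ} (hw : ContDiff ℝ ∞ w) {Λ : ℝ}
    (h : ∀ x, Λ < |x| → w x = 0) : ∃ F : 𝓢(ℝ, ℂ), ∀ x, F x = (w x : ℂ) :=
  ⟨((hasCompactSupport_of_abs_lt h).comp_left (g := Complex.ofReal) rfl).toSchwartzMap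
    (Complex.ofRealCLM.contDiff.comp hw), fun _ => rfl⟩

theorem hasDerivAt_schwartz {F : 𝓢(ℝ, ℂ)} {w : ℝ → ℝ} {w' : ℂ} (hF : ∀ x, F x = (w x : ℂ))
    {d x : ℝ} (hd : HasDerivAt w d x) (hw' : w' = d) : HasDerivAt F w' x := by
  rw [hw', show (F : ℝ → ℂ) = fun x => (w x : ℂ) from funext hF]
  exact hd.ofReal_comp

/-- Iterates of `1 - ∂ₓₓ` on families of smooth functions with common compact support. -/
theorem exists_elliptic_iterate {I : Set ℝ} {f : ℝ → ℝ → ℝ} {Λ : ℝ} (hf : ∀ n, JointSmooth I n f)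
    (hΛ : ∀ t ∈ I, ∀ x, Λ < |x| → f t x = 0) (k : ℕ) :
    ∃ w : ℝ → ℝ → ℝ, (∀ n, JointSmooth I n w) ∧ (∀ t ∈ I, ∀ x, Λ < |x| → w t x = 0) ∧
      ∀ t ∈ I, ∀ F H : 𝓢(ℝ, ℂ), (∀ x, F x = (f t x : ℂ)) → (∀ x, H x = (w t x : ℂ)) →
        ∀ η, (𝓕 H) η = ((1 + (2 * Real.pi * η) ^ 2 : ℝ) : ℂ) ^ k * (𝓕 F) η := by
  induction k with
  | zero =>
    refine ⟨f, hf, hΛ, fun t _ F H hF hH η => ?_⟩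
    rw [show H = F from SchwartzMap.ext fun x => by rw [hF, hH], pow_zero, one_mul]
  | succ k ih =>
    obtain ⟨w, hw, hwΛ, hk⟩ := ih
    have hw1 : ∀ n, JointSmooth I n fun t x => deriv (w t) x := fun n => (hw (n + 1)).deriv
    have hw2 : ∀ n, JointSmooth I n fun t x => deriv (deriv (w t)) x := fun n => (hw1 (n + 1)).deriv
    have s1 : ∀ t ∈ I, ∀ x, Λ < |x| → deriv (w t) x = 0 := fun t ht =>
      deriv_eq_zero_of_abs_lt (hwΛ t ht)
    have s2 : ∀ t ∈ I, ∀ x, Λ < |x| → deriv (deriv (w t)) x = 0 := fun t ht =>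
      deriv_eq_zero_of_abs_lt (s1 t ht)
    refine ⟨fun t x => w t x - deriv (deriv (w t)) x, fun n => (hw n).sub (hw2 n),
      fun t ht x hx => by simp only [hwΛ t ht x hx, s2 t ht x hx, sub_zero], fun t ht F H hF hH η => ?_⟩
    have cw := JointSmooth.contDiff_infty hw ht
    have cw1 := JointSmooth.contDiff_infty hw1 ht
    obtain ⟨W, hW⟩ := exists_schwartzMap_of_support cw (hwΛ t ht)
    obtain ⟨W', hW'⟩ := exists_schwartzMap_of_support cw1 (s1 t ht)
    rw [fourier_momentum (F := W) (G := W') (H := H)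
      (fun x => hasDerivAt_schwartz hW
        (cw.differentiable (by simp)).differentiableAt.hasDerivAt (hW' x))
      (fun x => hasDerivAt_schwartz hW'
        (cw1.differentiable (by simp)).differentiableAt.hasDerivAt
        (by rw [hW, hH]; push_cast; ring)), hk t ht F W hF hW, pow_succ]
    ring

theorem fourier_sub_apply (F G : 𝓢(ℝ, ℂ)) (η : ℝ) : (𝓕 (F - G)) η = (𝓕 F) η - (𝓕 G) η := by
  rw [eq_sub_iff_add_eq, ← add_apply, ← FourierTransform.fourier_add, sub_add_cancel]

/-- For `s ≤ 2k` the `H^s` norm is dominated by the `L²` norm of `(1 - ∂ₓₓ)^k u`, represented here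
by `H`. -/
theorem sobolevNorm_le_of_fourier {u : ℝ → ℝ} {F H : 𝓢(ℝ, ℂ)} (hF : ∀ x, F x = (u x : ℂ)) {k : ℕ}
    (hH : ∀ η, (𝓕 H) η = ((1 + (2 * Real.pi * η) ^ 2 : ℝ) : ℂ) ^ k * (𝓕 F) η) {s : ℝ}
    (hs : s ≤ 2 * k) :
    sobolevNorm s u ≤ (ENNReal.ofReal (2 * Real.pi) * ∫⁻ x, ‖H x‖ₑ ^ 2) ^ (1 / 2 : ℝ) := by
  have h1 : sobolevNorm s u ^ 2 ≤ ENNReal.ofReal (2 * Real.pi) * ∫⁻ x, ‖H x‖ₑ ^ 2 := by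
    rw [sobolevNorm_eq s hF, ← lintegral_sq_fourier]
    refine mul_le_mul' le_rfl (lintegral_mono fun η => ?_)
    rw [hH, enorm_mul, mul_pow ‖_‖ₑ ‖_‖ₑ]
    refine mul_le_mul' ?_ le_rfl
    have hpos : 1 ≤ 1 + (2 * Real.pi * η) ^ 2 := by nlinarith [sq_nonneg (2 * Real.pi * η)]
    rw [← ofReal_norm, ← ENNReal.ofReal_pow (norm_nonneg _)]
    apply ENNReal.ofReal_le_ofReal
    rw [norm_pow, Complex.norm_real, Real.norm_eq_abs, abs_of_nonneg (by linarith), ← pow_mul,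
      ← Real.rpow_natCast _ (k * 2)]
    apply Real.rpow_le_rpow_of_exponent_le hpos
    push_cast; linarith
  calc sobolevNorm s u = (sobolevNorm s u ^ 2) ^ (1 / 2 : ℝ) := by
        rw [← ENNReal.rpow_two, ← ENNReal.rpow_mul]; norm_num
    _ ≤ _ := by gcongr

theorem lintegral_sq_eq_of_support {w : ℝ → ℝ} (hw : Continuous w) {Λ : ℝ} (hΛ0 : 0 ≤ Λ)
    (hΛ : ∀ x, Λ < |x| → w x = 0) {H : 𝓢(ℝ, ℂ)} (hH : ∀ x, H x = (w x : ℂ)) :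
    ∫⁻ x, ‖H x‖ₑ ^ 2 = ENNReal.ofReal (∫ x in -Λ..Λ, w x ^ 2) := by
  have e : ∀ x, ‖H x‖ₑ ^ 2 = ENNReal.ofReal (w x ^ 2) := fun x => by
    rw [hH, ← ofReal_norm, ← ENNReal.ofReal_pow (norm_nonneg _), Complex.norm_real,
      Real.norm_eq_abs, sq_abs]
  simp only [e]
  have hc : Continuous fun x => w x ^ 2 := by fun_prop
  rw [intervalIntegral.integral_of_le (by linarith), ← integral_Icc_eq_integral_Ioc,
    ofReal_integral_eq_lintegral_ofReal (hc.continuousOn.integrableOn_compact isCompact_Icc)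
      (ae_of_all _ fun x => sq_nonneg _), setLIntegral_eq_of_support_subset]
  intro x hx
  by_contra hx'
  have hlt : Λ < |x| := by
    by_contra! hle
    exact hx' ⟨(abs_le.1 hle).1, (abs_le.1 hle).2⟩
  exact hx (by simp [hΛ x hlt])

namespace IsLagrangianSolution

variable {b L R a c : ℝ} {m : ℝ → ℝ} {g : ℝ → ℝ → ℝ}

/-- The velocity, the slope and the momentum are Schwartz functions. -/
theorem exists_schwartzMaps (h : IsLagrangianSolution b L R a c m g) (hL : 0 ≤ L) {t : ℝ}
    (ht : t ∈ Ioo a c) : ∃ F G H : 𝓢(ℝ, ℂ), (∀ x, F x = (eulerU b L m g t x : ℂ)) ∧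
      (∀ x, G x = (eulerV b L m g t x : ℂ)) ∧ (∀ x, H x = (momentum b L m g t x : ℂ)) ∧
      (∀ x, HasDerivAt F (G x) x) ∧ ∀ x, HasDerivAt G (F x - H x) x := by
  obtain ⟨Λ, -, hΛ⟩ := h.exists_momentum_support hL
  have cm := JointSmooth.contDiff_infty h.jointSmooth_momentum ht
  obtain ⟨F, hF⟩ := exists_schwartzMap cm (hΛ t ht)
    (fun x => (h.eulerU_eq_helmholtzInv ht x).1) (fun x => (h.eulerU_eq_helmholtzInv ht x).2)
    (h.hasDerivAt_eulerU ht) (h.hasDerivAt_eulerV ht)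
    (JointSmooth.contDiff_infty h.jointSmooth_eulerU ht)
  obtain ⟨H, hH⟩ := exists_schwartzMap_of_support cm fun x hx => hΛ t ht x hx.le
  have hG : ∀ x, SchwartzMap.derivCLM ℝ ℂ F x = (eulerV b L m g t x : ℂ) := fun x => by
    rw [SchwartzMap.derivCLM_apply]
    exact (hasDerivAt_schwartz hF (h.hasDerivAt_eulerU ht x) rfl).deriv
  exact ⟨F, SchwartzMap.derivCLM ℝ ℂ F, H, hF, hG, hH,
    fun x => hasDerivAt_schwartz hF (h.hasDerivAt_eulerU ht x) (hG x),
    fun x => hasDerivAt_schwartz hG (h.hasDerivAt_eulerV ht x)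
      (by rw [hF, hH]; push_cast; ring)⟩

/-- The function `(1 - ∂ₓₓ)^{k+1} u = (1 - ∂ₓₓ)^k` momentum is jointly continuous with support in an
interval independent of time, although `u` itself is not compactly supported. Its `L²` differences
are integrals over a fixed compact interval, hence continuous in time. -/
theorem continuousInHInfty (h : IsLagrangianSolution b L R a c m g) (hL : 0 ≤ L) :
    ContinuousInHInfty c (eulerU b L m g) := by
  intro s t ht
  have hsub : Ico 0 c ⊆ Ioo a c := fun t ht => ⟨h.zero_mem.1.trans_le ht.1, ht.2⟩
  obtain ⟨k, hk⟩ := exists_nat_ge (s / 2)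
  have hs : s ≤ 2 * ((k + 1 : ℕ) : ℝ) := by push_cast; linarith
  obtain ⟨Λ, hΛ0, hΛ⟩ := h.exists_momentum_support hL
  obtain ⟨w, hw, hwΛ, hwk⟩ := exists_elliptic_iterate h.jointSmooth_momentum
    (fun t ht x hx => hΛ t ht x hx.le) k
  have key : ∀ τ ∈ Ioo a c, ∃ F H : 𝓢(ℝ, ℂ), (∀ x, F x = (eulerU b L m g τ x : ℂ)) ∧
      (∀ x, H x = (w τ x : ℂ)) ∧
      ∀ η, (𝓕 H) η = ((1 + (2 * Real.pi * η) ^ 2 : ℝ) : ℂ) ^ (k + 1) * (𝓕 F) η := by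
    intro τ hτ
    obtain ⟨F, G, M, hF, -, hM, hd, hd'⟩ := h.exists_schwartzMaps hL hτ
    obtain ⟨H, hH⟩ := exists_schwartzMap_of_support (JointSmooth.contDiff_infty hw hτ) (hwΛ τ hτ)
    refine ⟨F, H, hF, hH, fun η => ?_⟩
    rw [hwk τ hτ M H hM hH, fourier_momentum hd hd', pow_succ]; ring
  obtain ⟨F, H, hF, hH, hFH⟩ := key t (hsub ht)
  constructor
  · refine (sobolevNorm_le_of_fourier hF hFH hs).trans_lt ?_
    rw [← eLpNorm_two_sq]
    exact ENNReal.rpow_lt_top_of_nonneg (by norm_num) (ENNReal.mul_ne_top ENNReal.ofReal_ne_top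
      (ENNReal.pow_ne_top (schwartz_eLpNorm_ne_top _)))
  · set E : ℝ → ℝ := fun τ => ∫ x in -Λ..Λ, (w τ x - w t x) ^ 2 with hE
    have hbound : ∀ τ ∈ Ico 0 c, sobolevNorm s (fun x => eulerU b L m g τ x - eulerU b L m g t x) ≤
        (ENNReal.ofReal (2 * Real.pi) * ENNReal.ofReal (E τ)) ^ (1 / 2 : ℝ) := by
      intro τ hτ
      obtain ⟨F', H', hF', hH', hFH'⟩ := key τ (hsub hτ)
      have e := lintegral_sq_eq_of_support (H := H' - H)
        ((continuous_section_right (hw 0).continuousOn (hsub hτ)).sub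
          (continuous_section_right (hw 0).continuousOn (hsub ht))) hΛ0
        (fun x hx => by simp [hwΛ τ (hsub hτ) x hx, hwΛ t (hsub ht) x hx])
        (fun x => by rw [sub_apply, hH', hH]; simp)
      rw [show ENNReal.ofReal (E τ) = ∫⁻ x, ‖(H' - H) x‖ₑ ^ 2 from e.symm]
      refine sobolevNorm_le_of_fourier (F := F' - F)
        (fun x => by rw [sub_apply, hF', hF]; push_cast; rfl) (fun η => ?_) hs
      rw [fourier_sub_apply, fourier_sub_apply, hFH',
        hFH, mul_sub]
    have hcont : ContinuousOn E (Ico 0 c) := by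
      refine continuousOn_intervalIntegral_param (F := fun τ x => (w τ x - w t x) ^ 2)
        (by linarith) ?_
      have h1 : ContinuousOn (Function.uncurry w) (Ico 0 c ×ˢ Icc (-Λ) Λ) :=
        (hw 0).continuousOn.mono (prod_mono hsub (subset_univ _))
      have h2 : Continuous fun z : ℝ × ℝ => w t z.2 :=
        (continuous_section_right (hw 0).continuousOn (hsub ht)).comp continuous_snd
      exact (h1.sub h2.continuousOn).pow 2
    have h0 : E t = 0 := by simp [hE]
    have hlim : Tendsto (fun τ => (ENNReal.ofReal (2 * Real.pi) * ENNReal.ofReal (E τ)) ^ (1 / 2 : ℝ))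
        (𝓝[Ico 0 c] t) (𝓝 0) := by
      have h1 := hcont t ht
      rw [ContinuousWithinAt, h0] at h1
      have h2 := ENNReal.Tendsto.const_mul (a := ENNReal.ofReal (2 * Real.pi))
        (ENNReal.tendsto_ofReal h1) (Or.inr ENNReal.ofReal_ne_top)
      have h3 := h2.ennrpow_const (1 / 2 : ℝ)
      simpa using h3
    refine tendsto_of_tendsto_of_tendsto_of_le_of_le' tendsto_const_nhds hlim
      (Eventually.of_forall fun _ => zero_le) ?_
    filter_upwards [self_mem_nhdsWithin] with τ hτ using hbound τ hτ

end IsLagrangianSolution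

end BEquation

namespace BEquation

open scoped SchwartzMap

/-! ### A priori estimates under a bound in the critical Besov space -/

theorem abs_le_of_enorm_le {F : ℂ} {w : ℝ} (hF : F = (w : ℂ)) {C : ℝ} (hC : 0 ≤ C)
    (h : ‖F‖ₑ ≤ ENNReal.ofReal C) : |w| ≤ C := by
  rw [hF, ← ofReal_norm, Complex.norm_real, Real.norm_eq_abs] at h
  exact (ENNReal.ofReal_le_ofReal_iff hC).1 h

/-- An essential supremum bounds the norm only at almost every time. The pointwise consequences are
continuous in time, so they extend to all times, the initial one included. -/
theorem nonpos_of_ae_nonpos {f : ℝ → ℝ} {c : ℝ} (hf : ContinuousOn f (Ico 0 c))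
    (h : ∀ᵐ t ∂volume.restrict (Ioo 0 c), f t ≤ 0) : ∀ t ∈ Ico 0 c, f t ≤ 0 := by
  have h1 : (fun t => max (f t) 0) =ᵐ[volume.restrict (Ico 0 c)] fun _ => 0 := by
    rw [← restrict_Ioo_eq_restrict_Ico]
    filter_upwards [h] with t ht using max_eq_right ht
  intro t ht
  have h2 := Measure.eqOn_Ico_of_ae_eq volume h1 (hf.sup continuousOn_const) continuousOn_const ht
  exact max_eq_right_iff.1 h2

/-- Because `log 2 > 1/2`, the exponent is at most `x - J/4`. -/
theorem two_rpow_mul_exp_le_one {J : ℕ} {x : ℝ} (h : 4 * x ≤ J) :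
    (2 : ℝ) ^ (-(J : ℝ) / 2) * Real.exp x ≤ 1 := by
  rw [Real.rpow_def_of_pos (by norm_num), ← Real.exp_add, ← Real.exp_zero]
  apply Real.exp_le_exp.2
  have h1 := Real.log_two_gt_d9
  have h2 : (0 : ℝ) ≤ J := Nat.cast_nonneg J
  nlinarith

namespace IsLagrangianSolution

variable {b L R a c : ℝ} {m : ℝ → ℝ} {g : ℝ → ℝ → ℝ}

/-- The momentum is at most `K e^{|b| r}` on an interval of length at most `2 L e^r`. The `+ 1`
makes `(2 L + 1) e^r ≥ 1`, so that this length is bounded by its square. -/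
theorem eLpNorm_momentum_le (h : IsLagrangianSolution b L R a c m g) (hL : 0 ≤ L) {t r K : ℝ}
    (ht : t ∈ Ioo a c) (hr : ∀ ξ, |g t ξ| ≤ r) (hK : ∀ x, |m x| ≤ K) {H : 𝓢(ℝ, ℂ)}
    (hH : ∀ x, H x = (momentum b L m g t x : ℂ)) :
    eLpNorm H 2 volume ≤ ENNReal.ofReal ((2 * L + 1) * K * Real.exp ((|b| + 1) * r)) := by
  have hr0 : 0 ≤ r := (abs_nonneg _).trans (hr 0)
  have hK0 : 0 ≤ K := (abs_nonneg _).trans (hK 0)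
  set p := position b L m g t (-L)
  set p' := position b L m g t L
  rw [← ENNReal.pow_le_pow_left_iff two_ne_zero, eLpNorm_two_sq,
    ← ENNReal.ofReal_pow (by positivity)]
  calc ∫⁻ x, ‖H x‖ₑ ^ 2
      ≤ ∫⁻ x, (Icc p p').indicator (fun _ => ENNReal.ofReal ((K * Real.exp (|b| * r)) ^ 2)) x := by
        refine lintegral_mono fun x => ?_
        have hb := h.momentum_bound ht hr hK x
        by_cases hx : x ∈ Icc p p'
        · rw [indicator_of_mem hx, hH, ← ofReal_norm, ← ENNReal.ofReal_pow (norm_nonneg _),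
            Complex.norm_real, Real.norm_eq_abs]
          apply ENNReal.ofReal_le_ofReal
          exact pow_le_pow_left₀ (abs_nonneg _) hb.1 2
        · rw [hH, hb.2 hx]; simp
    _ = ENNReal.ofReal ((K * Real.exp (|b| * r)) ^ 2) * ENNReal.ofReal (p' - p) := by
        rw [lintegral_indicator measurableSet_Icc, setLIntegral_const, Real.volume_Icc]
    _ ≤ _ := by
        rw [← ENNReal.ofReal_mul (by positivity)]
        apply ENNReal.ofReal_le_ofReal
        have hw : p' - p ≤ 2 * L * Real.exp r := h.position_width ht hL hr
        have he : 1 ≤ Real.exp r := Real.one_le_exp hr0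
        have hw' : p' - p ≤ ((2 * L + 1) * Real.exp r) ^ 2 := by
          have h1 : 1 ≤ (2 * L + 1) * Real.exp r := by nlinarith
          calc p' - p ≤ 1 * ((2 * L + 1) * Real.exp r) := by linarith
            _ ≤ ((2 * L + 1) * Real.exp r) * ((2 * L + 1) * Real.exp r) := by gcongr
            _ = _ := by ring
        calc (K * Real.exp (|b| * r)) ^ 2 * (p' - p)
            ≤ (K * Real.exp (|b| * r)) ^ 2 * ((2 * L + 1) * Real.exp r) ^ 2 := by gcongr
          _ = _ := by
            rw [show (|b| + 1) * r = |b| * r + r by ring, Real.exp_add]; ring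

theorem bounds_of_besovNorm_le (h : IsLagrangianSolution b L R a c m g) (hL : 0 ≤ L)
    {P : LittlewoodPaleyPair} {q : ℝ≥0∞} (hq : 1 < q) {t B r K : ℝ} (ht : t ∈ Ioo a c)
    (hB0 : 0 ≤ B) (hB : besovNorm P (3 / 2) 2 q (eulerU b L m g t) ≤ ENNReal.ofReal B)
    (hr : ∀ ξ, |g t ξ| ≤ r) (hK : ∀ x, |m x| ≤ K) (x : ℝ) :
    |eulerU b L m g t x| ≤ 8 * B ∧
      helmholtzInv (fun y => eulerV b L m g t y ^ 2) x ≤ 96 * B ^ 2 ∧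
      |eulerV b L m g t x| ≤ 8 * B + 256 * ((2 * L + 1) * K) + 32 * B * (|b| + 1) * r := by
  obtain ⟨F, G, H, hF, hG, hH, hd, hd'⟩ := h.exists_schwartzMaps hL ht
  have hr0 : 0 ≤ r := (abs_nonneg _).trans (hr 0)
  have hK0 : 0 ≤ K := (abs_nonneg _).trans (hK 0)
  have hBj := fun j => (P.besov_term_le hq hF j).trans hB
  have hGη := enorm_fourier_of_deriv hd
  have hHη := enorm_fourier_momentum hd hd'
  refine ⟨?_, ?_, ?_⟩
  · refine abs_le_of_enorm_le (hF x) (by positivity) ((P.enorm_le_of_bound hBj x).trans ?_)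
    rw [ENNReal.ofReal_mul (by norm_num)]; norm_num
  · have h1 := P.lintegral_deriv_sq_le_of_bound hGη hBj
    have e : ∀ x, ‖G x‖ₑ ^ 2 = ENNReal.ofReal (eulerV b L m g t x ^ 2) := fun x => by
      rw [hG, ← ofReal_norm, ← ENNReal.ofReal_pow (norm_nonneg _), Complex.norm_real,
        Real.norm_eq_abs, sq_abs]
    simp only [e] at h1
    have cV : Continuous fun x => eulerV b L m g t x ^ 2 :=
      (continuous_section_right (h.jointSmooth_eulerV 0).continuousOn ht).pow 2
    have e192 : 192 * ENNReal.ofReal B ^ 2 = ENNReal.ofReal (192 * B ^ 2) := by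
      rw [ENNReal.ofReal_mul (by norm_num), ENNReal.ofReal_pow hB0]; norm_num
    rw [e192] at h1
    have hint : Integrable fun x => eulerV b L m g t x ^ 2 := by
      refine ⟨cV.aestronglyMeasurable, ?_⟩
      rw [hasFiniteIntegral_iff_ofReal (ae_of_all _ fun x => sq_nonneg _)]
      exact h1.trans_lt ENNReal.ofReal_lt_top
    rw [← ofReal_integral_eq_lintegral_ofReal hint (ae_of_all _ fun x => sq_nonneg _),
      ENNReal.ofReal_le_ofReal_iff (by positivity)] at h1
    calc helmholtzInv (fun y => eulerV b L m g t y ^ 2) x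
        ≤ ∫ y, 1 / 2 * eulerV b L m g t y ^ 2 := by
          refine integral_mono_of_nonneg (ae_of_all _ fun y => ?_) (hint.const_mul _)
            (ae_of_all _ fun y => ?_)
          · show 0 ≤ 1 / 2 * Real.exp (-|x - y|) * eulerV b L m g t y ^ 2
            positivity
          · show 1 / 2 * Real.exp (-|x - y|) * eulerV b L m g t y ^ 2 ≤ 1 / 2 * eulerV b L m g t y ^ 2
            have : Real.exp (-|x - y|) ≤ 1 := Real.exp_le_one_iff.2 (by simp)
            gcongr
            linarith
      _ ≤ _ := by rw [integral_const_mul]; linarith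
  -- With this cut-off `2^{-J/2}` cancels the exponential growth of the momentum. The price is `J ·
  -- 8 B`, which is only linear in `r`; this lets Gronwall's inequality close.
  · set J := ⌈4 * ((|b| + 1) * r)⌉₊ with hJ
    have hJ1 : 4 * ((|b| + 1) * r) ≤ J := Nat.le_ceil _
    have hJ2 : (J : ℝ) ≤ 4 * ((|b| + 1) * r) + 1 := (Nat.ceil_lt_add_one (by positivity)).le
    set Q := (2 * L + 1) * K with hQ
    have hQ0 : 0 ≤ Q := by positivity
    have h1 : |eulerV b L m g t x| ≤ J * (8 * B) +
        256 * (2 : ℝ) ^ (-(J : ℝ) / 2) * (Q * Real.exp ((|b| + 1) * r)) := by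
      refine abs_le_of_enorm_le (hG x) (by positivity)
        ((P.enorm_deriv_le_of_bound hGη hHη hBj J x).trans ?_)
      rw [ENNReal.ofReal_add (by positivity) (by positivity), ENNReal.ofReal_mul (by positivity),
        ENNReal.ofReal_natCast, ENNReal.ofReal_mul (by norm_num), ENNReal.ofReal_mul (by positivity),
        ENNReal.ofReal_mul (by norm_num), ofReal_two_rpow]
      norm_num only [ENNReal.ofReal_ofNat]
      gcongr
      exact h.eLpNorm_momentum_le hL ht hr hK hH
    have h2 := two_rpow_mul_exp_le_one hJ1
    have h3 : 256 * (2 : ℝ) ^ (-(J : ℝ) / 2) * (Q * Real.exp ((|b| + 1) * r)) ≤ 256 * Q := by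
      calc _ = 256 * Q * ((2 : ℝ) ^ (-(J : ℝ) / 2) * Real.exp ((|b| + 1) * r)) := by ring
        _ ≤ 256 * Q * 1 := by gcongr
        _ = _ := mul_one _
    have h4 : (J : ℝ) * (8 * B) ≤ (4 * ((|b| + 1) * r) + 1) * (8 * B) := by gcongr
    linarith

theorem bounds_of_ae_besovNorm_le (h : IsLagrangianSolution b L R a c m g) (hL : 0 ≤ L)
    {P : LittlewoodPaleyPair} {q : ℝ≥0∞} (hq : 1 < q) {B K : ℝ} (hB0 : 0 ≤ B)
    (hB : ∀ᵐ t ∂volume.restrict (Ioo 0 c),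
      besovNorm P (3 / 2) 2 q (eulerU b L m g t) ≤ ENNReal.ofReal B)
    {r : ℝ → ℝ} (hrc : ContinuousOn r (Ico 0 c)) (hr : ∀ t ∈ Ico 0 c, ∀ ξ, |g t ξ| ≤ r t)
    (hK : ∀ x, |m x| ≤ K) {t : ℝ} (ht : t ∈ Ico 0 c) (x : ℝ) :
    |eulerU b L m g t x| ≤ 8 * B ∧
      helmholtzInv (fun y => eulerV b L m g t y ^ 2) x ≤ 96 * B ^ 2 ∧
      |eulerV b L m g t x| ≤ 8 * B + 256 * ((2 * L + 1) * K) + 32 * B * (|b| + 1) * r t := by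
  have hsub : Ico 0 c ⊆ Ioo a c := fun t ht => ⟨h.zero_mem.1.trans_le ht.1, ht.2⟩
  have hae : ∀ᵐ t ∂volume.restrict (Ioo 0 c), |eulerU b L m g t x| ≤ 8 * B ∧
      helmholtzInv (fun y => eulerV b L m g t y ^ 2) x ≤ 96 * B ^ 2 ∧
      |eulerV b L m g t x| ≤ 8 * B + 256 * ((2 * L + 1) * K) + 32 * B * (|b| + 1) * r t := by
    filter_upwards [hB, ae_restrict_mem measurableSet_Ioo] with t ht hm
    exact h.bounds_of_besovNorm_le hL hq (hsub ⟨hm.1.le, hm.2⟩) hB0 ht (hr t ⟨hm.1.le, hm.2⟩) hK x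
  have cU : ContinuousOn (fun t => eulerU b L m g t x) (Ico 0 c) :=
    (continuousOn_section_left (h.jointSmooth_eulerU 0).continuousOn (mem_univ x)).mono hsub
  have cV : ContinuousOn (fun t => eulerV b L m g t x) (Ico 0 c) :=
    (continuousOn_section_left (h.jointSmooth_eulerV 0).continuousOn (mem_univ x)).mono hsub
  have cP : ContinuousOn (fun t => helmholtzInv (fun y => eulerV b L m g t y ^ 2) x) (Ico 0 c) := by
    have h1 := continuousOn_helmholtzInv (F := fun t y => eulerV b L m g t y ^ 2)
      (I := Ioo a c) (((h.jointSmooth_eulerV 0).continuousOn.pow 2).congr fun _ _ => rfl)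
      (M := (Real.exp (|1 - b| * R) * ∫ η, |m η|) ^ 2) fun t ht x => by
        rw [abs_pow]
        exact pow_le_pow_left₀ (abs_nonneg _) (h.bounded_euler ht x).2 2
    exact (continuousOn_section_left h1 (mem_univ x)).mono hsub
  refine ⟨?_, ?_, ?_⟩
  · have := nonpos_of_ae_nonpos (cU.abs.sub (continuousOn_const (c := 8 * B)))
      (by filter_upwards [hae] with t ht using sub_nonpos.2 ht.1) t ht
    exact sub_nonpos.1 this
  · have := nonpos_of_ae_nonpos (cP.sub (continuousOn_const (c := 96 * B ^ 2)))
      (by filter_upwards [hae] with t ht using sub_nonpos.2 ht.2.1) t ht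
    exact sub_nonpos.1 this
  · have := nonpos_of_ae_nonpos (cV.abs.sub ((continuousOn_const
        (c := 8 * B + 256 * ((2 * L + 1) * K))).add (hrc.const_smul (32 * B * (|b| + 1)))))
      (by filter_upwards [hae] with t ht using sub_nonpos.2 ht.2.2) t ht
    exact sub_nonpos.1 this

/-- The square of the slope enters only through its convolution with `p`, which is `O(B²)` even
where the slope is huge. The crude bound `N` is needed only to justify linearity. -/
theorem abs_helmholtzInv_source_le (h : IsLagrangianSolution b L R a c m g) {B t : ℝ}
    (ht : t ∈ Ioo a c) (hU : ∀ x, |eulerU b L m g t x| ≤ 8 * B)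
    (hV : ∀ x, helmholtzInv (fun y => eulerV b L m g t y ^ 2) x ≤ 96 * B ^ 2) (x : ℝ) :
    |helmholtzInv (source b (eulerU b L m g t) (eulerV b L m g t)) x| ≤
      (32 * |b| + 48 * |3 - b|) * B ^ 2 := by
  have cU := continuous_section_right (h.jointSmooth_eulerU 0).continuousOn ht
  have cV := continuous_section_right (h.jointSmooth_eulerV 0).continuousOn ht
  set N := Real.exp (|1 - b| * R) * ∫ η, |m η| with hN
  have bU : ∀ x, |b / 2 * eulerU b L m g t x ^ 2| ≤ 32 * |b| * B ^ 2 := fun x => by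
    rw [abs_mul, abs_div, abs_two, abs_pow]
    calc |b| / 2 * |eulerU b L m g t x| ^ 2 ≤ |b| / 2 * (8 * B) ^ 2 := by gcongr; exact hU x
      _ = _ := by ring
  have bV : ∀ x, |-((3 - b) / 2) * eulerV b L m g t x ^ 2| ≤ |3 - b| / 2 * N ^ 2 := fun x => by
    rw [abs_mul, abs_neg, abs_div, abs_two, abs_pow]
    gcongr; exact (h.bounded_euler ht x).2
  have e1 := (helmholtzInv_sub (f := fun x => b / 2 * eulerU b L m g t x ^ 2)
    (g := fun x => -((3 - b) / 2) * eulerV b L m g t x ^ 2) (by fun_prop) (by fun_prop)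
    (M := 32 * |b| * B ^ 2 + |3 - b| / 2 * N ^ 2)
    (fun x => (bU x).trans (le_add_of_nonneg_right (by positivity)))
    (fun x => (bV x).trans (le_add_of_nonneg_left (by positivity))) x).1
  have e2 : helmholtzInv (fun x => -((3 - b) / 2) * eulerV b L m g t x ^ 2) x =
      -((3 - b) / 2) * helmholtzInv (fun y => eulerV b L m g t y ^ 2) x := by
    rw [helmholtzInv, helmholtzInv, ← integral_const_mul]
    congr 1; ext y; ring
  have e3 : source b (eulerU b L m g t) (eulerV b L m g t) = fun y =>
      b / 2 * eulerU b L m g t y ^ 2 - -((3 - b) / 2) * eulerV b L m g t y ^ 2 := by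
    funext y; rw [source]; ring
  rw [e3, ← e1, e2]
  have hnn : 0 ≤ helmholtzInv (fun y => eulerV b L m g t y ^ 2) x :=
    integral_nonneg fun y => by positivity
  calc _ ≤ |helmholtzInv (fun x => b / 2 * eulerU b L m g t x ^ 2) x| +
        |-((3 - b) / 2) * helmholtzInv (fun y => eulerV b L m g t y ^ 2) x| := abs_sub _ _
    _ ≤ 32 * |b| * B ^ 2 + |3 - b| / 2 * (96 * B ^ 2) := by
        rw [abs_mul, abs_neg, abs_div, abs_two, abs_of_nonneg hnn]
        gcongr
        · exact abs_helmholtzInv_le (by fun_prop) bU x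
        · exact hV x
    _ = _ := by ring

/-- The slope blows up before the time `2 / (κ H)`, `κ = |1 - b| / 2`, if its initial value is
large and the velocity is controlled. -/
theorem false_of_slope (h : IsLagrangianSolution b L R a c m g) (hb : b ≠ 1) {B H σ : ℝ}
    (hU : ∀ t ∈ Ico 0 c, ∀ x, |eulerU b L m g t x| ≤ 8 * B)
    (hV : ∀ t ∈ Ico 0 c, ∀ x, helmholtzInv (fun y => eulerV b L m g t y ^ 2) x ≤ 96 * B ^ 2)
    (hσ : |σ| = 1) (hσb : σ * (1 - b) = |1 - b|) (hH : 0 < H)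
    (hHB : (64 * |b| + 48 * |3 - b|) * B ^ 2 < |1 - b| / 4 * H ^ 2)
    (hHc : 4 / (|1 - b| * H) < c) (h0 : σ * lagV b L m (g 0) 0 = H) : False := by
  have hsub : Ico 0 c ⊆ Ioo a c := fun t ht => ⟨h.zero_mem.1.trans_le ht.1, ht.2⟩
  set κ := |1 - b| / 2 with hκdef
  have hκ : 0 < κ := by
    have : 0 < |1 - b| := abs_pos.2 (sub_ne_zero.2 (Ne.symm hb))
    positivity
  set N := Real.exp (|1 - b| * R) * ∫ η, |m η| with hN
  set A := (64 * |b| + 48 * |3 - b|) * B ^ 2 with hA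
  set f : ℝ → ℝ := fun t => σ * lagV b L m (g t) 0 with hf
  set f' : ℝ → ℝ := fun t => σ * ((1 - b) / 2 * lagV b L m (g t) 0 ^ 2 +
    b / 2 * lagU b L m (g t) 0 ^ 2 - helmholtzInv (source b (eulerU b L m g t) (eulerV b L m g t))
      (position b L m g t 0)) with hf'
  have hd : ∀ t ∈ Ico 0 c, HasDerivAt f (f' t) t := fun t ht =>
    (h.hasDerivAt_slope (hsub ht) 0).const_mul σ
  have hfN : ∀ t ∈ Ico 0 c, f t ≤ N := fun t ht => by
    refine (le_abs_self _).trans ?_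
    rw [hf, abs_mul, hσ, one_mul]
    exact (abs_lagU_lagV_le h.smooth.continuous h.supp (h.continuous_g (hsub ht))
      (h.bounded t (hsub ht)) 0).2
  have hric : ∀ t ∈ Ico 0 c, κ * f t ^ 2 - A ≤ f' t := fun t ht => by
    have e1 := h.abs_helmholtzInv_source_le (hsub ht) (hU t ht) (hV t ht) (position b L m g t 0)
    have e2 : |b / 2 * lagU b L m (g t) 0 ^ 2| ≤ 32 * |b| * B ^ 2 := by
      have hu := hU t ht (position b L m g t 0)
      rw [eulerU, h.label_position (hsub ht)] at hu
      rw [abs_mul, abs_div, abs_two, abs_pow]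
      calc |b| / 2 * |lagU b L m (g t) 0| ^ 2 ≤ |b| / 2 * (8 * B) ^ 2 := by gcongr
        _ = _ := by ring
    set S := helmholtzInv (source b (eulerU b L m g t) (eulerV b L m g t)) (position b L m g t 0)
    have e3 : |σ * (b / 2 * lagU b L m (g t) 0 ^ 2 - S)| ≤ A := by
      rw [abs_mul, hσ, one_mul]
      refine (abs_sub _ _).trans ?_
      rw [hA]; linarith
    -- The sign `σ` turns the quadratic coefficient `(1-b)/2` into `κ > 0`, whichever side of `1`
    -- the parameter lies on.
    have e4 : f' t = κ * f t ^ 2 + σ * (b / 2 * lagU b L m (g t) 0 ^ 2 - S) := by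
      have hσ2 : σ ^ 2 = 1 := by rw [← sq_abs, hσ, one_pow]
      simp only [hf, hf', hκdef, ← hσb]
      linear_combination (-(1 / 2 : ℝ) * σ * (1 - b) * lagV b L m (g t) 0 ^ 2) * hσ2
    rw [e4]
    linarith [neg_abs_le (σ * (b / 2 * lagU b L m (g t) 0 ^ 2 - S))]
  -- A level above the a priori bound `N`. The solution `1/ρ` of `y' = κ/2 y²`, `y(0) = H`, reaches
  -- it at time `s < 2/(κH)`, and `f` will be shown to stay above this solution.
  set D := max N H + 1 with hD
  have hDN : N < D := by linarith [le_max_left N H]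
  have hDH : H < D := by linarith [le_max_right N H]
  set s := 2 / κ * (1 / H - 1 / D) with hs
  have hDpos : 0 < D := hH.trans hDH
  have hs0 : 0 ≤ s := by
    have : 1 / D ≤ 1 / H := by gcongr
    have h2 : 0 ≤ 1 / H - 1 / D := by linarith
    positivity
  have hsc : s < c := by
    refine lt_of_lt_of_le ?_ hHc.le
    have e : 4 / (|1 - b| * H) = 2 / κ * (1 / H) := by rw [hκdef]; field_simp; norm_num
    rw [e, hs]
    have : 0 < 1 / D := by positivity
    gcongr
    linarith
  have hsub' : Icc 0 s ⊆ Ico 0 c := fun t ht => ⟨ht.1, ht.2.trans_lt hsc⟩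
  set ρ : ℝ → ℝ := fun t => 1 / H - κ / 2 * t with hρ
  have hρs : ρ s = 1 / D := by simp only [hρ, hs]; field_simp; ring
  have hρpos : ∀ t ∈ Icc 0 s, 0 < ρ t := fun t ht => by
    have h1 : 0 < ρ s := by rw [hρs]; positivity
    have h2 : ρ s ≤ ρ t := by simp only [hρ]; gcongr; exact ht.2
    linarith
  have hρH : ∀ t ∈ Icc 0 s, H ≤ (ρ t)⁻¹ := fun t ht => by
    rw [le_inv_comm₀ hH (hρpos t ht), ← one_div]
    have : 0 ≤ κ / 2 * t := mul_nonneg (by positivity) ht.1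
    simp only [hρ]; linarith
  have hρd : ∀ t ∈ Icc 0 s, HasDerivAt (fun t => (ρ t)⁻¹) (κ / 2 * ((ρ t)⁻¹) ^ 2) t := fun t ht => by
    have h1 : HasDerivAt ρ (-(κ / 2)) t := by
      have := ((hasDerivAt_id t).const_mul (κ / 2)).const_sub (1 / H)
      simpa [hρ] using this
    refine (h1.fun_inv (hρpos t ht).ne').congr_deriv ?_
    rw [inv_pow]; ring
  -- Where the two functions touch, `f = 1/ρ ≥ H`, so `A < κ/2 f²` and `f' ≥ κ f² - A > κ/2 f²`: the
  -- comparison function cannot cross `f`.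
  have key := image_le_of_deriv_right_lt_deriv_boundary' (a := 0) (b := s)
    (f := fun t => (ρ t)⁻¹) (f' := fun t => κ / 2 * ((ρ t)⁻¹) ^ 2) (B := f) (B' := f')
    (fun t ht => (hρd t ht).continuousAt.continuousWithinAt)
    (fun t ht => (hρd t (Ico_subset_Icc_self ht)).hasDerivWithinAt)
    (by simp only [hρ, hf, mul_zero, sub_zero, one_div, inv_inv, h0]; exact le_rfl)
    (fun t ht => (hd t (hsub' ht)).continuousAt.continuousWithinAt)
    (fun t ht => (hd t (hsub' (Ico_subset_Icc_self ht))).hasDerivWithinAt)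
    (fun t ht heq => by
      have ht' := Ico_subset_Icc_self ht
      have h1 := hric t (hsub' ht')
      rw [← heq] at h1
      have h2 : H ^ 2 ≤ ((ρ t)⁻¹) ^ 2 := by gcongr; exact hρH t ht'
      have h3 : A < κ / 2 * ((ρ t)⁻¹) ^ 2 := by
        refine hHB.trans_le ?_
        rw [show |1 - b| / 4 = κ / 2 by rw [hκdef]; ring]
        gcongr
      linarith)
    (right_mem_Icc.2 hs0)
  simp only [hρs] at key
  rw [one_div, inv_inv] at key
  linarith [hfN s ⟨hs0, hsc⟩]

end IsLagrangianSolution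

end BEquation

namespace BEquation

open scoped SchwartzMap BoundedContinuousFunction

/-! ### Norm inflation -/

/-- A smooth compactly supported velocity comes from a smooth compactly supported momentum. -/
theorem exists_momentum_of_velocity {u : ℝ → ℝ} {Λ : ℝ} (hu : ContDiff ℝ ∞ u)
    (hΛ : ∀ x, Λ ≤ |x| → u x = 0) :
    ∃ m : ℝ → ℝ, ContDiff ℝ ∞ m ∧ (∀ x, Λ + 1 ≤ |x| → m x = 0) ∧ helmholtzInv m = u := by
  have hu1 : ContDiff ℝ ∞ (deriv u) := hu.iterate_deriv 1
  have hu2 : ContDiff ℝ ∞ (deriv (deriv u)) := hu.iterate_deriv 2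
  have s0 : ∀ x, Λ < |x| → u x = 0 := fun x hx => hΛ x hx.le
  have s1 := deriv_eq_zero_of_abs_lt s0
  have s2 := deriv_eq_zero_of_abs_lt s1
  have sm : ∀ x, Λ < |x| → u x - deriv (deriv u) x = 0 := fun x hx => by
    rw [s0 x hx, s2 x hx, sub_zero]
  have hm : ContDiff ℝ ∞ fun x => u x - deriv (deriv u) x := hu.sub hu2
  refine ⟨_, hm, fun x hx => sm x (by linarith), funext fun x => ?_⟩
  obtain ⟨M, hM⟩ := (hasCompactSupport_of_abs_lt sm).exists_bound_of_continuous hm.continuous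
  obtain ⟨N₀, hN₀⟩ := (hasCompactSupport_of_abs_lt s0).exists_bound_of_continuous hu.continuous
  obtain ⟨N₁, hN₁⟩ := (hasCompactSupport_of_abs_lt s1).exists_bound_of_continuous hu1.continuous
  exact (eq_helmholtzInv (α := u) (β := deriv u) hm.continuous hM
    (fun x => (hu.differentiable (by simp)).differentiableAt.hasDerivAt)
    (fun x => (hu1.differentiable (by simp)).differentiableAt.hasDerivAt.congr_deriv (by ring))
    (fun x => (hN₀ x).trans (le_max_left N₀ N₁)) (fun x => (hN₁ x).trans (le_max_right N₀ N₁)) x).1.symm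

/-- The first time at which a continuous function reaches a level, or the final time. -/
theorem exists_exit_time {φ : ℝ → ℝ} {T ρ : ℝ} (hT : 0 < T) (hφ : ContinuousOn φ (Icc 0 T))
    (h0 : φ 0 < ρ) :
    ∃ τ, 0 < τ ∧ τ ≤ T ∧ (∀ t ∈ Ico 0 τ, φ t < ρ) ∧ (τ = T ∨ ρ ≤ φ τ) := by
  set S : Set ℝ := Icc 0 T ∩ φ ⁻¹' Ici ρ with hS
  have hSc : IsClosed S := hφ.preimage_isClosed_of_isClosed isClosed_Icc isClosed_Ici
  by_cases hne : S.Nonempty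
  · have hbd : BddBelow S := ⟨0, fun t ht => ht.1.1⟩
    have hmem : sInf S ∈ S := hSc.csInf_mem hne hbd
    refine ⟨sInf S, ?_, hmem.1.2, fun t ht => ?_, Or.inr hmem.2⟩
    · refine lt_of_le_of_ne hmem.1.1 fun h => ?_
      have h2 : ρ ≤ φ (sInf S) := hmem.2
      rw [← h] at h2
      linarith
    · by_contra! hle
      have : sInf S ≤ t := csInf_le hbd ⟨⟨ht.1, ht.2.le.trans hmem.1.2⟩, hle⟩
      linarith [ht.2]
  · refine ⟨T, hT, le_rfl, fun t ht => ?_, Or.inl rfl⟩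
    by_contra! hle
    exact hne ⟨t, ⟨ht.1, ht.2.le⟩, hle⟩

/-- A solution of the truncated equation is a Lagrangian solution as long as it does not reach the
level of truncation. -/
theorem isLagrangianSolution_of_truncated {b L R T : ℝ} {m : ℝ → ℝ} (hm : ContDiff ℝ ∞ m)
    (hL : ∀ x, L ≤ |x| → m x = 0) {g g' : ℝ → ℝ →ᵇ ℝ} (h0 : g 0 = 0)
    (hg' : ∀ t ξ, g' t ξ = lagV b L m (clamp R (g t)) ξ)
    (hd : ∀ t ∈ Ioo (-T) T, HasDerivAt g (g' t) t) {a c : ℝ} (hsub : Ioo a c ⊆ Ioo (-T) T)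
    (hac : (0 : ℝ) ∈ Ioo a c) (hR : ∀ t ∈ Ioo a c, ‖g t‖ ≤ R) :
    IsLagrangianSolution b L R a c m fun t => g t where
  zero_mem := hac
  smooth := hm
  supp := hL
  initial ξ := by rw [h0]; rfl
  bounded t ht ξ := ((g t).norm_coe_le_norm ξ).trans (hR t ht)
  continuousOn := by
    have h1 : ContinuousOn g (Ioo a c) := fun t ht => (hd t (hsub ht)).continuousAt.continuousWithinAt
    have h2 : ContinuousOn (fun z : ℝ × ℝ => g z.1) (Ioo a c ×ˢ univ) :=
      h1.comp continuousOn_fst fun z hz => hz.1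
    exact h2.eval continuousOn_snd
  hasDerivAt t ht ξ := by
    have h1 := ((BoundedContinuousFunction.evalCLM ℝ ξ).hasFDerivAt (x := g t)).comp_hasDerivAt t
      (hd t (hsub ht))
    refine HasDerivAt.congr_deriv h1 ?_
    show g' t ξ = _
    rw [hg', clamp_eq fun ξ => ((g t).norm_coe_le_norm ξ).trans (hR t ht)]

/-- Norm inflation in the critical Besov space. If the norm stayed below `ρ`, then the slope would
grow at most exponentially, so that the solution would exist up to the time `1 / ρ`; but the Riccati
equation makes it blow up earlier. -/
theorem exists_norm_inflation {b : ℝ} (hb : b ≠ 1) (P : LittlewoodPaleyPair) {q : ℝ≥0∞} (hq : 1 < q)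
    {ρ : ℝ} (hρ : 0 < ρ) :
    ∃ u₀ : ℝ → ℝ, ContDiff ℝ ∞ u₀ ∧ besovNorm P (3 / 2) 2 q u₀ ≤ ENNReal.ofReal (1 / ρ) ∧
      ∃ T : ℝ, 0 < T ∧ T ≤ 1 / ρ ∧ ∃ u : ℝ → ℝ → ℝ, IsUniqueSmoothSolution b T u₀ u ∧
        (∀ t ∈ Ico 0 T, ∃ F : 𝓢(ℝ, ℂ), ∀ x, F x = (u t x : ℂ)) ∧
        ENNReal.ofReal ρ ≤
          essSup (fun t => besovNorm P (3 / 2) 2 q (u t)) (volume.restrict (Ioo 0 T)) := by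
  obtain ⟨σ, hσ, hσb⟩ : ∃ σ : ℝ, |σ| = 1 ∧ σ * (1 - b) = |1 - b| := by
    rcases le_total 0 (1 - b) with h | h
    · exact ⟨1, by simp, by rw [abs_of_nonneg h, one_mul]⟩
    · exact ⟨-1, by simp, by rw [abs_of_nonpos h]; ring⟩
  have hκ : 0 < |1 - b| := abs_pos.2 (sub_ne_zero.2 (Ne.symm hb))
  set A := (64 * |b| + 48 * |3 - b|) * ρ ^ 2 with hA
  have hA0 : 0 ≤ A := by positivity
  -- Then `|1-b| H = |1-b| + 4ρ + 4A`. The term `4ρ` places the blow-up before `1/ρ`, and `4A` makes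
  -- the quadratic term dominate the error.
  set H := 1 + 4 * ρ / |1 - b| + 4 * A / |1 - b| with hH
  have hHpos : 1 ≤ H := by
    have h1 : 0 ≤ 4 * ρ / |1 - b| := by positivity
    have h2 : 0 ≤ 4 * A / |1 - b| := by positivity
    linarith
  have hHA : A < |1 - b| / 4 * H ^ 2 := by
    have h1 : |1 - b| / 4 * H = |1 - b| / 4 + ρ + A := by rw [hH]; field_simp
    have h2 : |1 - b| / 4 * H ≤ |1 - b| / 4 * H ^ 2 := by
      have : H ≤ H ^ 2 := by nlinarith
      gcongr
    linarith
  have hHρ : 4 / (|1 - b| * H) < 1 / ρ := by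
    have h1 : |1 - b| * H = |1 - b| + 4 * ρ + 4 * A := by rw [hH]; field_simp
    rw [h1, div_lt_div_iff₀ (by positivity) hρ]
    linarith
  obtain ⟨u₀, Λ, hΛ0, hu₀, hsupp, hslope, hsmall⟩ :=
    P.exists_small_besovNorm_deriv_eq hq (ε := 1 / ρ) (by positivity) (σ * H)
  obtain ⟨m, hm, hmsupp, hmu⟩ := exists_momentum_of_velocity hu₀ hsupp
  set L := Λ + 1 with hLdef
  have hL0 : 0 ≤ L := by positivity
  obtain ⟨K, hK⟩ := (hasCompactSupport_of_abs_lt fun x hx => hmsupp x (le_of_lt hx)).exists_bound_of_continuous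
    hm.continuous
  have hK0 : 0 ≤ K := (norm_nonneg _).trans (hK 0)
  set C₁ := 8 * ρ + 256 * ((2 * L + 1) * K) with hC₁
  set C₂ := 32 * ρ * (|b| + 1) with hC₂
  have hC₁0 : 0 ≤ C₁ := by positivity
  have hC₂0 : 0 ≤ C₂ := by positivity
  have hmono := gronwallBound_mono (δ := 0) le_rfl hC₁0 hC₂0
  -- The truncation level lies strictly above what Gronwall's inequality permits up to time `1/ρ`.
  -- It may depend on the data through `K` and `L`, since `H` has been fixed in terms of `ρ` and `b`
  -- alone.
  set R := gronwallBound 0 C₂ C₁ (1 / ρ) + 1 with hR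
  have hR0 : 0 < R := by
    have := hmono (show (0 : ℝ) ≤ 1 / ρ by positivity)
    rw [gronwallBound_x0] at this
    linarith
  set T₀ := 1 / ρ with hT₀
  have hT₀pos : 0 < T₀ := by positivity
  obtain ⟨g, g', hg0, hg', hd⟩ := exists_truncated_solution b hR0.le hm.continuous hmsupp
    (T := T₀ + 1) (by linarith)
  have hgc : ∀ t ∈ Ioo (-(T₀ + 1)) (T₀ + 1), ContinuousAt g t := fun t ht => (hd t ht).continuousAt
  obtain ⟨T, hT, hTT₀, hlt, hexit⟩ := exists_exit_time (φ := fun t => ‖g t‖) (ρ := R) hT₀pos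
    (fun t ht => (hgc t ⟨by linarith [ht.1], by linarith [ht.2]⟩).norm.continuousWithinAt)
    (by simpa [hg0] using hR0)
  -- A Lagrangian solution lives on an open interval around `0`, so the bound by `R` must also hold
  -- at slightly negative times.
  obtain ⟨δ, hδ, hδlt⟩ : ∃ δ > 0, ∀ t, |t| < δ → ‖g t‖ < R := by
    have h1 : ContinuousAt (fun t => ‖g t‖) 0 := (hgc 0 ⟨by linarith, by linarith⟩).norm
    have h2 : ∀ᶠ t in 𝓝 (0 : ℝ), ‖g t‖ < R := h1.eventually_lt_const (by simpa [hg0] using hR0)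
    obtain ⟨δ, hδ, h⟩ := Metric.eventually_nhds_iff.1 h2
    exact ⟨δ, hδ, fun t ht => h (by simpa [Real.dist_eq] using ht)⟩
  set a := -min δ 1 with ha
  have ha0 : a < 0 := by rw [ha]; simp [hδ]
  have hR' : ∀ t ∈ Ioo a T, ‖g t‖ ≤ R := fun t ht => by
    rcases le_or_gt 0 t with h | h
    · exact (hlt t ⟨h, ht.2⟩).le
    · refine (hδlt t ?_).le
      rw [abs_of_neg h]
      have := min_le_left δ 1
      linarith [ht.1]
  have hsubT : Ioo a T ⊆ Ioo (-(T₀ + 1)) (T₀ + 1) := fun t ht => by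
    have := min_le_right δ 1
    exact ⟨by linarith [ht.1], by linarith [ht.2]⟩
  have sol : IsLagrangianSolution b L R a T m fun t => g t :=
    isLagrangianSolution_of_truncated hm hmsupp hg0 hg' hd hsubT ⟨ha0, hT⟩ hR'
  have hIco : Ico 0 T ⊆ Ioo a T := fun t ht => ⟨ha0.trans_le ht.1, ht.2⟩
  set u := eulerU b L m fun t => g t with hu
  have hsol := sol.isSmoothSolution
  rw [hmu] at hsol
  refine ⟨u₀, hu₀, hsmall, T, hT, hTT₀, u, ⟨hsol, sol.continuousInHInfty hL0, fun v hv => ?_⟩,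
    fun t ht => ?_, ?_⟩
  · exact sol.unique (by rw [hmu]; exact hv)
  · obtain ⟨F, -, -, hF, -⟩ := sol.exists_schwartzMaps hL0 (hIco ht)
    exact ⟨F, hF⟩
  · by_contra! hlow
    have hae : ∀ᵐ t ∂volume.restrict (Ioo 0 T), besovNorm P (3 / 2) 2 q (u t) ≤ ENNReal.ofReal ρ := by
      filter_upwards [ae_lt_of_essSup_lt hlow] with t ht using ht.le
    have bounds := fun t (ht : t ∈ Ico 0 T) x => sol.bounds_of_ae_besovNorm_le hL0 hq hρ.le hae
      (r := fun t => ‖g t‖)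
      (fun t ht => (hgc t (hsubT (hIco ht))).norm.continuousWithinAt)
      (fun t _ ξ => (g t).norm_coe_le_norm ξ) hK ht x
    -- The derivative of `g` is the slope along trajectories, which is at most `C₁ + C₂ ‖g‖` by the
    -- logarithmic estimate.
    have hgT : ‖g T‖ ≤ gronwallBound 0 C₂ C₁ (T - 0) := by
      refine norm_le_gronwallBound_of_norm_deriv_right_le (f' := g')
        (fun t ht => (hgc t ⟨by linarith [ht.1], by linarith [ht.2]⟩).continuousWithinAt)
        (fun t ht => (hd t (hsubT (hIco ht))).hasDerivWithinAt) (by simp [hg0]) (fun t ht => ?_)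
        T (right_mem_Icc.2 hT.le)
      have h1 : 0 ≤ C₂ * ‖g t‖ + C₁ := by positivity
      refine (BoundedContinuousFunction.norm_le h1).2 fun ξ => ?_
      have h2 := (bounds t ht (position b L m (fun t => g t) t ξ)).2.2
      rw [eulerV, sol.label_position (hIco ht)] at h2
      rw [hg', clamp_eq fun ξ => ((g t).norm_coe_le_norm ξ).trans (hR' t (hIco ht)), Real.norm_eq_abs]
      linarith
    -- Reaching the level `R` would exceed the Gronwall bound. The solution therefore lasts until
    -- `1/ρ`, beyond the Riccati blow-up time.
    have hTeq : T = T₀ := by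
      rcases hexit with h | h
      · exact h
      · have h1 := hmono (show T - 0 ≤ T₀ by linarith)
        exfalso
        have h2 : R ≤ ‖g T‖ := h
        rw [hR] at h2
        linarith
    refine sol.false_of_slope hb (B := ρ) (H := H) (σ := σ) (fun t ht x => (bounds t ht x).1)
      (fun t ht x => (bounds t ht x).2.1) hσ hσb (by linarith) hHA (by rw [hTeq]; exact hHρ) ?_
    have e1 : label b L m (fun t => g t) 0 0 = 0 := by
      have hp : position b L m (fun t => g t) 0 0 = 0 := by simp [position, flowMap]
      have := sol.label_position ⟨ha0, hT⟩ 0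
      rwa [hp] at this
    have e2 : eulerV b L m (fun t => g t) 0 0 = σ * H := by
      rw [← sol.deriv_eulerU ⟨ha0, hT⟩, ← hslope, ← hsol.initial]
    rw [eulerV, e1] at e2
    rw [e2, ← mul_assoc, ← sq, ← sq_abs, hσ, one_pow, one_mul]

end BEquation

/-! ### The theorem in Besov and in Sobolev norms -/

theorem theorem1p2 (b : ℝ) (hb : b ≠ 1) :
    (∀ (P : LittlewoodPaleyPair) (q : ℝ≥0∞), 1 < q →
      ∃ N₀ : ℕ, ∀ N : ℕ, N₀ ≤ N →
        ∃ u₀ : ℝ → ℝ, ContDiff ℝ ∞ u₀ ∧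
          besovNorm P (3 / 2) 2 q u₀ ≤ ENNReal.ofReal (1 / Real.log N) ∧
          ∃ T : ℝ, 0 < T ∧ T ≤ 1 / Real.log N ∧
            ∃ u : ℝ → ℝ → ℝ, IsUniqueSmoothSolution b T u₀ u ∧
              ENNReal.ofReal (Real.log N) ≤
                essSup (fun t => besovNorm P (3 / 2) 2 q (u t)) (volume.restrict (Ioo 0 T))) ∧
    (∀ ε : ℝ, 0 < ε →
      ∃ u₀ : ℝ → ℝ, ContDiff ℝ ∞ u₀ ∧
        sobolevNorm (3 / 2) u₀ ≤ ENNReal.ofReal ε ∧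
        ∃ T : ℝ, 0 < T ∧ T ≤ ε ∧
          ∃ u : ℝ → ℝ → ℝ, IsUniqueSmoothSolution b T u₀ u ∧
            ENNReal.ofReal (1 / ε) ≤
              essSup (fun t => sobolevNorm (3 / 2) (u t)) (volume.restrict (Ioo 0 T))) := by
  constructor
  · intro P q hq
    -- Any `N` with `log N > 0` will do, as the inflation result holds for every positive `ρ`.
    refine ⟨2, fun N hN => ?_⟩
    have hlog : 0 < Real.log N := Real.log_pos (by exact_mod_cast hN)
    obtain ⟨u₀, h1, h2, T, h3, h4, u, h5, -, h6⟩ := BEquation.exists_norm_inflation hb P hq hlog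
    exact ⟨u₀, h1, h2, T, h3, h4, u, h5, h6⟩
  · intro ε hε
    obtain ⟨P⟩ := LittlewoodPaleyPair.nonempty
    obtain ⟨u₀, h1, h2, T, h3, h4, u, h5, hS, h6⟩ :=
      -- The factor `100` pays for the comparison of the two norms, once for the smallness of the
      -- data and once for the growth of the solution.
      BEquation.exists_norm_inflation hb P (q := 2) (by norm_num) (ρ := 100 / ε) (by positivity)
    have e100 : (100 : ℝ≥0∞) = ENNReal.ofReal 100 := by norm_num
    refine ⟨u₀, h1, ?_, T, h3, h4.trans ?_, u, h5, ?_⟩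
    · obtain ⟨F, hF⟩ := hS 0 ⟨le_rfl, h3⟩
      rw [h5.isSolution.initial] at hF
      refine (BEquation.sobolevNorm_le_besovNorm P hF).trans ?_
      calc 100 * besovNorm P (3 / 2) 2 2 u₀ ≤ 100 * ENNReal.ofReal (1 / (100 / ε)) := by gcongr
        _ = ENNReal.ofReal ε := by
          rw [e100, ← ENNReal.ofReal_mul (by norm_num)]; congr 1; field_simp
    · rw [one_div_div]; linarith
    · have h7 : essSup (fun t => besovNorm P (3 / 2) 2 2 (u t)) (volume.restrict (Ioo 0 T)) ≤
          100 * essSup (fun t => sobolevNorm (3 / 2) (u t)) (volume.restrict (Ioo 0 T)) := by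
        rw [← ENNReal.essSup_const_mul]
        refine essSup_mono_ae ?_
        filter_upwards [ae_restrict_mem measurableSet_Ioo] with t ht
        obtain ⟨F, hF⟩ := hS t ⟨ht.1.le, ht.2⟩
        exact BEquation.besovNorm_le_sobolevNorm P hF
      have h8 := h6.trans h7
      have e : ENNReal.ofReal (100 / ε) = 100 * ENNReal.ofReal (1 / ε) := by
        rw [e100, ← ENNReal.ofReal_mul (by norm_num)]; congr 1; ring
      rw [e] at h8
      exact (ENNReal.mul_le_mul_iff_right (by norm_num) (by norm_num)).1 h8
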